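/- For a partition $\lambda$ of an integer $n\ge 0$, the rank of $\lambda$ is its largest part minus its number of parts. The crank of $\lambda$ is its largest part if $\lambda$ contains no ones; otherwise it is the number of parts of $\lambda$ larger than the number of ones of $\lambda$, minus the number of ones. (The empty partition of $0$ has rank and crank $0$.) Let $N(m,n)$ be the number of partitions of $n$ with rank $m$. For $n\neq 1$ let $M(m,n)$ be the number of partitions of $n$ with crank $m$, and for $n=1$ put $M(0,1)=-1$, $M(-1,1)=M(1,1)=1$ and $M(m,1)=0$ for all other $m$. For even $j\ge 2$ define the rank and crank moments $$N_j(n)=\sum_{k\in\mathbb Z}k^jN(k,n),\qquad M_j(n)=\sum_{k\in\mathbb Z}k^jM(k,n).$$ **Theorem 6.1.** For every integer $n\ge 0$ the following congruences hold. 1. $(n+2)M_4(n)+(6n^2+4n+1)M_2(n)\equiv 0\pmod 7$. 2. $(n+5)^3M_4(n)\equiv(5n^4+10n^3+8n^2+8n+9)M_2(n)\pmod{11}$. 3. $M_6(n)\equiv 2(n+7)M_4(n)-(n+8)^2M_2(n)\pmod{11}$. 4. $M_8(n)\equiv 2(n+5)(n^2+5n+10)M_2(n)+6(n^2+n+1)M_4(n)\pmod{11}$.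 5. $M_{10}(n)\equiv 4(n+7)(n^3+5n^2+29n+32)M_2(n)+39(n+7)(n+14)(n+39)M_4(n)+(6n^2+34n+39)M_6(n)+35(n+13)M_8(n)\pmod{41}$. 6. $(n+7)(n+25)(n+31)(n^2+28n+6)N_2(n)+N_{12}(n)\equiv(4n^5+10n^4+6n^3+30n^2+31n+33)M_2(n)+(n^4+4n^3+42n^2+24n+30)M_4(n)+40(n+10)(n^2+32n+7)M_6(n)+31(n+13)(n+41)M_8(n)+(n+11)M_{10}(n)+22M_{12}(n)\pmod{43}$. 7. $M_{10}(n)\equiv 36(n+19)(n^3+50n^2+20n+36)M_2(n)+(52n^3+28n^2+26n+52)M_4(n)+(36n^2+11n+32)M_6(n)+47(n+17)M_8(n)\pmod{53}$. 8. $M_8(n)\equiv(10n^3+73n^2+40n+82)M_2(n)+(72n^2+23n+28)M_4(n)+10(n+41)M_6(n)\pmod{83}$. 9. $N_{12}(n)-367(n+332)(n+487)(n+664)(n^2+265n+155)N_2(n)\equiv 352(n+247)(n+734)(n^3+147n^2+597n+363)M_2(n)+88(n+530)(n+701)(n+709)(n+740)M_4(n)+577(n+114)(n+427)(n+682)M_6(n)+(295n^2+177n+674)M_8(n)+271(n+336)M_{10}(n)+654M_{12}(n)\pmod{797}$.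 10. $M_{14}(n)\equiv(44976165n^6+23584476n^5+19728425n^4+8711555n^3+36781660n^2+70780973n+108798274)M_2(n)+77429163(n+4141548)(n+113894720)(n^3+42853554n^2+28914352n+100598975)M_4(n)+(12571854n^4+82951807n^3+9501843n^2+38248242n+118847240)M_6(n)+84218605(n+53645347)(n^2+6688335n+93582728)M_8(n)+73449678(n+40889782)(n+59666357)M_{10}(n)+89188917(n+120667368)M_{12}(n)\pmod{120667369}$. -/

import Mathlib

namespace RankCrank

/-- The largest part of a partition (`0` for the empty partition of `0`). -/
def largestPart {n : ℕ} (p : n.Partition) : ℕ := p.parts.sup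

/-- Dyson's rank: the largest part minus the number of parts. -/
def rank {n : ℕ} (p : n.Partition) : ℤ :=
  (largestPart p : ℤ) - (Multiset.card p.parts : ℤ)

/-- The crank of Andrews and Garvan: the largest part if the partition contains no ones, and
otherwise the number of parts larger than the number of ones, minus the number of ones. -/
def crank {n : ℕ} (p : n.Partition) : ℤ :=
  if p.parts.count 1 = 0 then (largestPart p : ℤ)
  else (Multiset.card (p.parts.filter fun i => p.parts.count 1 < i) : ℤ) - (p.parts.count 1 : ℤ)

/-- `N(m, n)`: the number of partitions of `n` with rank `m`. -/
def rankCount (m : ℤ) (n : ℕ) : ℤ :=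
  ((Finset.univ.filter fun p : n.Partition => rank p = m).card : ℤ)

/-- `M(m, n)`: the number of partitions of `n` with crank `m`, with the usual amended values
`M(0, 1) = -1`, `M(-1, 1) = M(1, 1) = 1` and `M(m, 1) = 0` otherwise, for which
`∑ M(m, n) z ^ m q ^ n = ∏ (1 - q ^ n) / ((1 - z q ^ n) (1 - z⁻¹ q ^ n))`. -/
def crankCount (m : ℤ) (n : ℕ) : ℤ :=
  if n = 1 then (if m = 0 then -1 else if m = 1 ∨ m = -1 then 1 else 0)
  else ((Finset.univ.filter fun p : n.Partition => crank p = m).card : ℤ)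

/-- The rank moment `N_j(n) = ∑ k ^ j N(k, n)`, over all integers `k`. -/
noncomputable def rankMoment (j n : ℕ) : ℤ := ∑ᶠ k : ℤ, k ^ j * rankCount k n

/-- The crank moment `M_j(n) = ∑ k ^ j M(k, n)`, over all integers `k`. -/
noncomputable def crankMoment (j n : ℕ) : ℤ := ∑ᶠ k : ℤ, k ^ j * crankCount k n

/-- Only finitely many integers are ranks of partitions of `n`, so that `rankMoment` is a genuine
finite sum. -/
theorem finite_support_rankMoment (j n : ℕ) :
    (Function.support fun k : ℤ => k ^ j * rankCount k n).Finite := by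
  refine (Finset.finite_toSet (Finset.univ.image fun p : n.Partition => rank p)).subset ?_
  intro k hk
  by_contra h
  refine hk ?_
  have h0 : rankCount k n = 0 := by
    simp only [Finset.coe_image, Finset.coe_univ, Set.image_univ, Set.mem_range, not_exists] at h
    simp [rankCount, h]
  simp [h0]

/-- Only finitely many `k` have `M(k, n) ≠ 0`, so that `crankMoment` is a genuine finite sum. -/
theorem finite_support_crankMoment (j n : ℕ) :
    (Function.support fun k : ℤ => k ^ j * crankCount k n).Finite := by
  refine (Finset.finite_toSet
    ((Finset.univ.image fun p : n.Partition => crank p) ∪ {0, 1, -1})).subset ?_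
  intro k hk
  by_contra h
  refine hk ?_
  have h0 : crankCount k n = 0 := by
    simp only [Finset.coe_union, Finset.coe_image, Finset.coe_univ, Set.image_univ, Set.mem_union,
      Set.mem_range, not_or, not_exists, Finset.coe_insert, Finset.coe_singleton,
      Set.mem_insert_iff, Set.mem_singleton_iff] at h
    simp [crankCount, h]
  simp [h0]

end RankCrank

open RankCrank

/-! Write Φ_k for `divisorSeries k`, P for `partitionSeries` and θ for X d/dX. Everything takes
place in P times a polynomial ring on which θ acts, so that a congruence with coefficients
polynomial in n becomes the vanishing of one explicit polynomial.

Crank. The generating function C(z) of the crank has a product formula (`crankSeries_mul`), so z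
d/dz log C(z) = Σ (z^k - z^{-k}) q^{ik} over i, k ≥ 1. At z = 1 its moments of even order vanish,
and those of odd order a are 2Φ_a. Leibniz's rule then expresses the series of M_{2t+2} by those of
lower order and Φ_1, Φ_3, …, Φ_{2t+1} (`zMoment_even_succ`); the start is C(1) = P. Hence each crank
moment series is P times a polynomial in the Φ's.

Divisor series. Ramanujan's identities express θΦ_1, θΦ_3, θΦ_5 and Φ_7, …, Φ_13 as polynomials in
Φ_1, Φ_3, Φ_5, apart from denominators. All of them come from one elementary convolution identity
for Lambert series (`sum_coeff_lambert_mul_lambert`). Since θP = Φ_1 P, multiplication of the n-th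
coefficient by n is the operator f ↦ Φ_1 f + θf on the polynomial factor. Modulo p a proposed
relation is thus a polynomial over ℤ/p, and its vanishing is checked by computation
(`hornerValue_moments_eq_zero`). Modulo 7 and 11 some denominators are not invertible, and fewer
divisor series are used.

Rank. The congruences with N_2 and N_12 need the rank-crank equation of Atkin and Garvan, which
relates the rank to C³/P² (`rankLE_eq_crankCubeSum`). The proof here is an induction on n. Partial
sums of the rank counts, weighted by 6n + m(m + 1), and double partial sums of partial sums of the
coefficients of C³/P² obey the same two symmetries, one from z ↦ 1/z and one from z ↦ q/z, and both
vanish for very negative m; these properties determine them. The moments of C³/P² obey the crank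
recursion with factor 3, so they are again P times polynomials in the Φ's. Eliminating N_4, …, N_10
expresses N_12 by N_2 and these moments (`rankMoment_twelve_eq`). -/

open PowerSeries Finset RankCrank

/-! ### Lambert series and a quadratic convolution identity -/

/-- The Lambert term `X ^ a / (1 - X ^ a)`. -/
noncomputable def lambert (a : ℕ) : ℤ⟦X⟧ := mk fun n => if n ≠ 0 ∧ a ∣ n then 1 else 0

/-- The generating function of `σ_k`. -/
noncomputable def divisorSeries (k : ℕ) : ℤ⟦X⟧ := mk fun n => ∑ d ∈ n.divisors, (d : ℤ) ^ k

theorem coeff_lambert (a n : ℕ) : coeff n (lambert a) = if n ≠ 0 ∧ a ∣ n then 1 else 0 :=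
  coeff_mk _ _

theorem one_sub_mul_lambert {a : ℕ} (ha : 1 ≤ a) : (1 - X ^ a) * lambert a = X ^ a := by
  ext n
  rw [sub_mul, one_mul, map_sub, coeff_X_pow_mul', coeff_lambert, coeff_X_pow]
  by_cases h : a ≤ n
  · rw [if_pos h, coeff_lambert]
    rcases eq_or_ne n a with rfl | hn
    · simp [show n ≠ 0 by omega]
    · have h1 : n - a ≠ 0 := by omega
      have h2 : n ≠ 0 := by omega
      have h3 : a ∣ n - a ↔ a ∣ n := by
        rw [Nat.dvd_sub_iff_left h (dvd_refl a)]
      simp [h1, h2, h3, hn]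
  · have h2 : ¬ (n ≠ 0 ∧ a ∣ n) := fun h' => h (Nat.le_of_dvd (by omega) h'.2)
    rw [if_neg h, if_neg h2, if_neg (by omega)]
    simp

theorem one_sub_X_pow_ne_zero {a : ℕ} (ha : 1 ≤ a) : (1 - X ^ a : ℤ⟦X⟧) ≠ 0 := by
  intro h
  have := congrArg (coeff 0) h
  simp [show a ≠ 0 by omega] at this

/-- With x = X^a and y = X^b, clearing denominators reduces this to 1 - xy = (1 - x)(1 - y) + x(1 -
y) + y(1 - x). -/
theorem lambert_mul_lambert {a b : ℕ} (ha : 1 ≤ a) (hb : 1 ≤ b) :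
    lambert a * lambert b =
      lambert (a + b) + lambert (a + b) * lambert a + lambert (a + b) * lambert b := by
  have h1 := one_sub_mul_lambert ha
  have h2 := one_sub_mul_lambert hb
  have h3 := one_sub_mul_lambert (a := a + b) (by omega)
  have hne : (1 - X ^ a : ℤ⟦X⟧) * (1 - X ^ b) * (1 - X ^ (a + b)) ≠ 0 :=
    mul_ne_zero (mul_ne_zero (one_sub_X_pow_ne_zero ha) (one_sub_X_pow_ne_zero hb))
      (one_sub_X_pow_ne_zero (by omega))
  apply mul_left_cancel₀ hne
  have e : (X : ℤ⟦X⟧) ^ (a + b) = X ^ a * X ^ b := pow_add _ _ _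
  calc _ = ((1 - X ^ a) * lambert a) * ((1 - X ^ b) * lambert b) * (1 - X ^ (a + b)) := by ring
    _ = X ^ a * X ^ b * (1 - X ^ (a + b)) := by rw [h1, h2]
    _ = X ^ (a + b) * ((1 - X ^ a) * (1 - X ^ b) + X ^ a * (1 - X ^ b)
          + X ^ b * (1 - X ^ a)) := by rw [e]; ring
    _ = ((1 - X ^ (a + b)) * lambert (a + b)) * ((1 - X ^ a) * (1 - X ^ b)
          + ((1 - X ^ a) * lambert a) * (1 - X ^ b) + ((1 - X ^ b) * lambert b) * (1 - X ^ a)) := by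
        rw [h1, h2, h3]
    _ = _ := by ring

theorem fst_le_of_mem_antidiagonal {n : ℕ} {p : ℕ × ℕ} (hp : p ∈ antidiagonal n) : p.1 ≤ n := by
  rw [HasAntidiagonal.mem_antidiagonal] at hp
  omega

theorem snd_le_of_mem_antidiagonal {n : ℕ} {p : ℕ × ℕ} (hp : p ∈ antidiagonal n) : p.2 ≤ n := by
  rw [HasAntidiagonal.mem_antidiagonal] at hp
  omega

theorem coeff_lambert_mul_eq_zero {a n : ℕ} (h : n < a) (x : ℤ⟦X⟧) :
    coeff n (lambert a * x) = 0 := by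
  rw [coeff_mul]
  refine sum_eq_zero fun p hp => ?_
  have := fst_le_of_mem_antidiagonal hp
  rw [coeff_lambert, if_neg, zero_mul]
  rintro ⟨h0, h1⟩
  exact absurd (Nat.le_of_dvd (by omega) h1) (by omega)

/-- The square is cut into its diagonal and two triangles, each parametrised by the smaller index
and the difference. The vanishing of K outside the square lets the difference run up to n. -/
theorem sum_sum_eq_diag_add {n : ℕ} (K : ℕ → ℕ → ℤ) (hK : ∀ a b, n < a ∨ n < b → K a b = 0) :
    ∑ a ∈ Icc 1 n, ∑ b ∈ Icc 1 n, K a b =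
      ∑ a ∈ Icc 1 n, K a a + ∑ a ∈ Icc 1 n, ∑ b ∈ Icc 1 n, (K a (a + b) + K (a + b) a) := by
  have key : ∀ K : ℕ → ℕ → ℤ, (∀ a b, n < a ∨ n < b → K a b = 0) →
      ∑ a ∈ Icc 1 n, ∑ b ∈ Icc 1 n, K a (a + b) =
        ∑ a ∈ Icc 1 n, ∑ b ∈ Icc 1 n, if a < b then K a b else 0 := by
    intro K hK
    refine sum_congr rfl fun a ha => ?_
    rw [← sum_filter]
    have h1 : ∑ b ∈ Icc 1 n, K a (a + b) = ∑ b ∈ Icc 1 (n - a), K a (a + b) := by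
      symm
      refine sum_subset (Icc_subset_Icc_right (by omega)) fun b hb hb' => hK _ _ (Or.inr ?_)
      simp only [mem_Icc] at *
      omega
    rw [h1]
    refine sum_bij' (fun b _ => a + b) (fun b _ => b - a) ?_ ?_ ?_ ?_ ?_ <;>
      simp only [mem_Icc, mem_filter] at * <;> intros <;> first | omega | rfl | trivial
  simp only [sum_add_distrib]
  rw [key K hK, key (fun a b => K b a) (fun a b h => hK _ _ h.symm), sum_comm (s := Icc 1 n)
    (f := fun a b => if a < b then K b a else 0), ← sum_add_distrib, ← sum_add_distrib]
  refine sum_congr rfl fun a ha => ?_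
  rw [← sum_add_distrib]
  have h2 : K a a = ∑ b ∈ Icc 1 n, if a = b then K a b else 0 := by
    rw [sum_ite_eq, if_pos ha]
  rw [h2, ← sum_add_distrib]
  refine sum_congr rfl fun b _ => ?_
  rcases lt_trichotomy a b with h | h | h
  · simp [h, h.ne, h.not_gt]
  · simp [h]
  · simp [h, h.ne', h.not_gt]

/-- Terms are collected by m = a + b. The term at a = 0 is added and subtracted so that power sums
over `range m` apply. -/
theorem sum_sum_add_eq {n : ℕ} (F : ℕ → ℕ → ℤ) (hF : ∀ a m, n < m → F a m = 0) :
    ∑ a ∈ Icc 1 n, ∑ b ∈ Icc 1 n, F a (a + b) =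
      ∑ m ∈ Icc 1 n, (∑ a ∈ range m, F a m - F 0 m) := by
  have h := fun m (hm : m ∈ Icc 1 n) => sum_range_succ' (fun a => F a m) (m - 1)
  have h1 : ∀ m ∈ Icc 1 n, (∑ a ∈ range m, F a m - F 0 m) =
      ∑ a ∈ Icc 1 n, if a < m then F a m else 0 := by
    intro m hm
    have := h m hm
    simp only [mem_Icc] at hm
    rw [show m - 1 + 1 = m by omega] at this
    rw [this, add_sub_cancel_right, ← sum_filter]
    refine sum_bij' (fun a _ => a + 1) (fun a _ => a - 1) ?_ ?_ ?_ ?_ ?_ <;>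
      simp only [mem_Icc, mem_filter, mem_range] at * <;> intros <;> first | omega | rfl | trivial
  rw [sum_congr rfl h1]
  rw [sum_comm (s := Icc 1 n) (t := Icc 1 n) (f := fun m a => if a < m then F a m else 0)]
  refine sum_congr rfl fun a ha => ?_
  rw [← sum_filter]
  have h2 : ∑ b ∈ Icc 1 n, F a (a + b) = ∑ b ∈ Icc 1 (n - a), F a (a + b) := by
    symm
    refine sum_subset (Icc_subset_Icc_right (by omega)) fun b hb hb' => hF _ _ ?_
    simp only [mem_Icc] at *
    omega
  rw [h2]
  refine sum_bij' (fun b _ => a + b) (fun b _ => b - a) ?_ ?_ ?_ ?_ ?_ <;>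
    simp only [mem_Icc, mem_filter] at * <;> intros <;> first | omega | rfl | trivial

/-- The quadratic convolution identity behind all relations between the series `∑ σ_k(n) X ^ n`:
it holds for every symmetric `f` with `f a (a + b) = f b (a + b)`. -/
theorem sum_coeff_lambert_mul_lambert (n : ℕ) (f : ℕ → ℕ → ℤ) (hf : ∀ a b, f a b = f b a)
    (hf' : ∀ a b, f a (a + b) = f b (a + b)) :
    ∑ a ∈ Icc 1 n, ∑ b ∈ Icc 1 n, (f a (a + b) - f a b) * coeff n (lambert a * lambert b) =
      ∑ m ∈ Icc 1 n, (∑ a ∈ range m, f a m - f 0 m) * coeff n (lambert m)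
        - ∑ m ∈ Icc 1 n, f m m * coeff n (lambert m * lambert m) := by
  have h1 := sum_sum_eq_diag_add (n := n) (fun a b => f a b * coeff n (lambert a * lambert b)) (by
    rintro a b (h | h)
    · exact mul_eq_zero_of_right _ (coeff_lambert_mul_eq_zero h _)
    · rw [mul_comm (lambert a)]
      exact mul_eq_zero_of_right _ (coeff_lambert_mul_eq_zero h _))
  have h2 := sum_sum_add_eq (n := n) (fun a m => f a m * coeff n (lambert m)) (by
    intro a m h
    rw [coeff_lambert, if_neg, mul_zero]
    rintro ⟨h0, h1⟩
    exact absurd (Nat.le_of_dvd (by omega) h1) (by omega))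
  -- Expanding the product by `lambert_mul_lambert` yields, besides the single terms, exactly the
  -- off-diagonal sums of `h1`; they cancel in the difference. The hypothesis `hf'` is what permits
  -- the exchange of a and b in `h4`.
  have h3 : ∑ a ∈ Icc 1 n, ∑ b ∈ Icc 1 n, f a (a + b) * coeff n (lambert a * lambert b) =
      ∑ a ∈ Icc 1 n, ∑ b ∈ Icc 1 n, f a (a + b) * coeff n (lambert (a + b)) +
      ∑ a ∈ Icc 1 n, ∑ b ∈ Icc 1 n, (f a (a + b) * coeff n (lambert a * lambert (a + b)) +
        f (a + b) a * coeff n (lambert (a + b) * lambert a)) := by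
    have h4 : ∑ a ∈ Icc 1 n, ∑ b ∈ Icc 1 n, f a (a + b) * coeff n (lambert a * lambert (a + b)) =
        ∑ a ∈ Icc 1 n, ∑ b ∈ Icc 1 n, f a (a + b) * coeff n (lambert (a + b) * lambert b) := by
      rw [sum_comm]
      refine sum_congr rfl fun a _ => sum_congr rfl fun b _ => ?_
      rw [add_comm b a, hf' a b, mul_comm (lambert b)]
    simp only [sum_add_distrib]
    rw [h4]
    simp only [← sum_add_distrib]
    refine sum_congr rfl fun a ha => sum_congr rfl fun b hb => ?_
    rw [lambert_mul_lambert (mem_Icc.1 ha).1 (mem_Icc.1 hb).1, map_add, map_add, hf (a + b) a]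
    ring
  simp only [sub_mul, sum_sub_distrib, sum_mul] at *
  linarith

theorem coeff_divisorSeries {N n : ℕ} (h : n ≤ N) (k : ℕ) :
    coeff n (divisorSeries k) = ∑ a ∈ Icc 1 N, (a : ℤ) ^ k * coeff n (lambert a) := by
  simp only [divisorSeries, coeff_mk, coeff_lambert, mul_ite, mul_one, mul_zero]
  rw [← sum_filter]
  refine sum_congr ?_ fun _ _ => rfl
  ext d
  simp only [Nat.mem_divisors, mem_filter, mem_Icc]
  constructor
  · rintro ⟨h1, h2⟩
    exact ⟨⟨Nat.pos_of_dvd_of_pos h1 (by omega), (Nat.le_of_dvd (by omega) h1).trans h⟩, h2, h1⟩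
  · rintro ⟨_, h1, h2⟩
    exact ⟨h2, h1⟩

theorem coeff_divisorSeries_mul (n i j : ℕ) :
    coeff n (divisorSeries i * divisorSeries j) =
      ∑ a ∈ Icc 1 n, ∑ b ∈ Icc 1 n, ((a : ℤ) ^ i * (b : ℤ) ^ j) * coeff n (lambert a * lambert b)
          := by
  simp only [coeff_mul, mul_sum]
  have h : ∀ p ∈ antidiagonal n, coeff p.1 (divisorSeries i) * coeff p.2 (divisorSeries j) =
      ∑ a ∈ Icc 1 n, ∑ b ∈ Icc 1 n, ((a : ℤ) ^ i * coeff p.1 (lambert a)) *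
        ((b : ℤ) ^ j * coeff p.2 (lambert b)) := fun p hp => by
    rw [coeff_divisorSeries (fst_le_of_mem_antidiagonal hp),
      coeff_divisorSeries (snd_le_of_mem_antidiagonal hp), sum_mul_sum]
  rw [sum_congr rfl h, sum_comm]
  refine sum_congr rfl fun a _ => ?_
  rw [sum_comm]
  refine sum_congr rfl fun b _ => sum_congr rfl fun p _ => ?_
  ring

/-! ### The operator θ and Ramanujan's identities for divisor series -/

/-- The operator `X d/dX`. -/
noncomputable def theta {R : Type*} [CommRing R] : Derivation R R⟦X⟧ R⟦X⟧ := (X : R⟦X⟧) • d⁄dX R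

theorem coeff_theta {R : Type*} [CommRing R] (n : ℕ) (f : R⟦X⟧) :
    coeff n (theta f) = n * coeff n f := by
  rcases n with _ | n
  · simp [theta]
  · rw [theta, Derivation.smul_apply, smul_eq_mul, coeff_succ_X_mul, coeff_derivative]
    push_cast
    ring

theorem coeff_natCast_mul {R : Type*} [CommRing R] (n c : ℕ) (f : R⟦X⟧) :
    coeff n ((c : R⟦X⟧) * f) = c * coeff n f := by
  rw [← nsmul_eq_mul, map_nsmul, nsmul_eq_mul]

theorem coeff_ofNat_mul {R : Type*} [CommRing R] (n c : ℕ) [c.AtLeastTwo] (f : R⟦X⟧) :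
    coeff n ((ofNat(c) : R⟦X⟧) * f) = ofNat(c) * coeff n f :=
  coeff_natCast_mul n c f

/-- Applying θ to (1 - X^a) L = X^a gives θL = a(L + L²). This turns the diagonal terms of the
convolution identity into derivatives. -/
theorem coeff_lambert_sq {a : ℕ} (ha : 1 ≤ a) (n : ℕ) :
    (a : ℤ) * coeff n (lambert a * lambert a) =
      n * coeff n (lambert a) - a * coeff n (lambert a) := by
  have h1 := one_sub_mul_lambert ha
  have h2 : theta (R := ℤ) (X ^ a) = (a : ℤ⟦X⟧) * X ^ a := by
    ext m
    rw [coeff_theta, coeff_natCast_mul, coeff_X_pow]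
    split_ifs with h <;> simp [h]
  have h3 : theta (lambert a) = (a : ℤ⟦X⟧) * (lambert a + lambert a * lambert a) := by
    have h4 := congrArg theta h1
    rw [Derivation.leibniz, map_sub, h2, Derivation.map_one_eq_zero] at h4
    simp only [smul_eq_mul] at h4
    apply mul_left_cancel₀ (one_sub_X_pow_ne_zero ha)
    linear_combination h4 - (a : ℤ⟦X⟧) * (1 + lambert a) * h1
  have h5 := congrArg (coeff n) h3
  rw [coeff_theta, coeff_natCast_mul, map_add] at h5
  linear_combination -h5

set_option linter.unusedSimpArgs false

theorem coeff_divisorSeries_eq_sum (n k : ℕ) :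
    coeff n (divisorSeries k) = ∑ m ∈ Icc 1 n, (m : ℤ) ^ k * coeff n (lambert m) :=
  coeff_divisorSeries le_rfl k

theorem coeff_theta_divisorSeries (n k : ℕ) :
    coeff n (theta (divisorSeries k)) =
      ∑ m ∈ Icc 1 n, (m : ℤ) ^ k * (n * coeff n (lambert m)) := by
  rw [coeff_theta, coeff_divisorSeries_eq_sum, mul_sum]
  exact sum_congr rfl fun _ _ => by ring

/-- Faulhaber's formulas up to exponent 8; 2520 is the least common multiple of their denominators.
-/
theorem sum_range_polynomial (c₀ c₁ c₂ c₃ c₄ c₅ c₆ c₇ c₈ : ℤ) (m : ℕ) :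
    2520 * ∑ a ∈ range m, (c₀ + c₁ * (a : ℤ) + c₂ * (a : ℤ) ^ 2 + c₃ * (a : ℤ) ^ 3
        + c₄ * (a : ℤ) ^ 4 + c₅ * (a : ℤ) ^ 5 + c₆ * (a : ℤ) ^ 6 + c₇ * (a : ℤ) ^ 7
        + c₈ * (a : ℤ) ^ 8) =
      2520 * c₀ * m + 1260 * c₁ * (m ^ 2 - m) + 420 * c₂ * (2 * m ^ 3 - 3 * m ^ 2 + m)
        + 630 * c₃ * (m ^ 4 - 2 * m ^ 3 + m ^ 2)
        + 84 * c₄ * (6 * m ^ 5 - 15 * m ^ 4 + 10 * m ^ 3 - m)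
        + 210 * c₅ * (2 * m ^ 6 - 6 * m ^ 5 + 5 * m ^ 4 - m ^ 2)
        + 60 * c₆ * (6 * m ^ 7 - 21 * m ^ 6 + 21 * m ^ 5 - 7 * m ^ 3 + m)
        + 105 * c₇ * (3 * m ^ 8 - 12 * m ^ 7 + 14 * m ^ 6 - 7 * m ^ 4 + 2 * m ^ 2)
        + 28 * c₈ * (10 * m ^ 9 - 45 * m ^ 8 + 60 * m ^ 7 - 42 * m ^ 5 + 20 * m ^ 3 - 3 * m) := by
  induction m with
  | zero => simp
  | succ m ih =>
    rw [sum_range_succ, mul_add, ih]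
    push_cast
    ring

/-- The convolution identity for polynomial f, with the inner power sums evaluated: `g m` is 2520
times the sum of f(a, m) over 0 < a < m. -/
theorem sum_coeff_lambert_mul_lambert_of_eq (n : ℕ) (f : ℕ → ℕ → ℤ) (hf : ∀ a b, f a b = f b a)
    (hf' : ∀ a b, f a (a + b) = f b (a + b)) (c₀ c₁ c₂ c₃ c₄ c₅ c₆ c₇ c₈ : ℤ → ℤ) (g : ℤ → ℤ)
    (hc : ∀ a m : ℕ, f a m = c₀ m + c₁ m * (a : ℤ) + c₂ m * (a : ℤ) ^ 2 + c₃ m * (a : ℤ) ^ 3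
        + c₄ m * (a : ℤ) ^ 4 + c₅ m * (a : ℤ) ^ 5 + c₆ m * (a : ℤ) ^ 6 + c₇ m * (a : ℤ) ^ 7
        + c₈ m * (a : ℤ) ^ 8)
    (hg : ∀ m : ℤ, g m = 2520 * c₀ m * m - 2520 * c₀ m + 1260 * c₁ m * (m ^ 2 - m)
        + 420 * c₂ m * (2 * m ^ 3 - 3 * m ^ 2 + m) + 630 * c₃ m * (m ^ 4 - 2 * m ^ 3 + m ^ 2)
        + 84 * c₄ m * (6 * m ^ 5 - 15 * m ^ 4 + 10 * m ^ 3 - m)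
        + 210 * c₅ m * (2 * m ^ 6 - 6 * m ^ 5 + 5 * m ^ 4 - m ^ 2)
        + 60 * c₆ m * (6 * m ^ 7 - 21 * m ^ 6 + 21 * m ^ 5 - 7 * m ^ 3 + m)
        + 105 * c₇ m * (3 * m ^ 8 - 12 * m ^ 7 + 14 * m ^ 6 - 7 * m ^ 4 + 2 * m ^ 2)
        + 28 * c₈ m * (10 * m ^ 9 - 45 * m ^ 8 + 60 * m ^ 7 - 42 * m ^ 5 + 20 * m ^ 3 - 3 * m)) :
    2520 * ∑ a ∈ Icc 1 n, ∑ b ∈ Icc 1 n,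
        (f a (a + b) - f a b) * coeff n (lambert a * lambert b) =
      ∑ m ∈ Icc 1 n, g m * coeff n (lambert m)
        - 2520 * ∑ m ∈ Icc 1 n, f m m * coeff n (lambert m * lambert m) := by
  rw [sum_coeff_lambert_mul_lambert n f hf hf', mul_sub, mul_sum]
  congr 1
  refine sum_congr rfl fun m _ => ?_
  rw [← mul_assoc, mul_sub, hg, sum_congr rfl fun a _ => hc a m, sum_range_polynomial, hc 0 m]
  push_cast
  ring

theorem sum_even_pow_mul_coeff_lambert_sq (n k : ℕ) :
    ∑ m ∈ Icc 1 n, 2 * (m : ℤ) ^ (k + 1) * coeff n (lambert m * lambert m) =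
      2 * coeff n (theta (divisorSeries k)) - 2 * coeff n (divisorSeries (k + 1)) := by
  rw [coeff_theta_divisorSeries, coeff_divisorSeries_eq_sum, mul_sum, mul_sum, ← sum_sub_distrib]
  refine sum_congr rfl fun m hm => ?_
  linear_combination 2 * (m : ℤ) ^ k * coeff_lambert_sq (mem_Icc.1 hm).1 n

/-- Equivalent to θE₂ = (E₂² - E₄)/12. An even power sum of a, b and a - b is admissible as f,
because replacing (a, a + b) by (b, a + b) permutes these three numbers up to sign. -/
theorem theta_divisorSeries_one :
    12 * (divisorSeries 1 * divisorSeries 1) =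
      5 * divisorSeries 3 + divisorSeries 1 - 6 * theta (divisorSeries 1) := by
  ext n
  have h := sum_coeff_lambert_mul_lambert_of_eq n
    (fun a b => (a : ℤ) ^ 2 + (b : ℤ) ^ 2 + ((a : ℤ) - b) ^ 2)
    (fun a b => by ring) (fun a b => by push_cast; ring)
    (fun m => 2 * m ^ 2)
    (fun m => -2 * m ^ 1)
    (fun m => 2 * m ^ 0)
    (fun _ => 0)
    (fun _ => 0)
    (fun _ => 0)
    (fun _ => 0)
    (fun _ => 0)
    (fun _ => 0)
    (fun m => 840 * m ^ 1 - 5040 * m ^ 2 + 4200 * m ^ 3)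
    (fun a m => by ring) (fun m => by ring)
  have hl : ∑ a ∈ Icc 1 n, ∑ b ∈ Icc 1 n,
      ((fun a b : ℕ => (a : ℤ) ^ 2 + (b : ℤ) ^ 2 + ((a : ℤ) - b) ^ 2) a (a +
          b) - (fun a b : ℕ => (a : ℤ) ^ 2 + (b : ℤ) ^ 2 + ((a : ℤ) - b) ^ 2) a b)
        * coeff n (lambert a * lambert b) =
      4 * coeff n (divisorSeries 1 * divisorSeries 1) := by
    simp only [coeff_divisorSeries_mul, mul_sum, ← sum_add_distrib]
    exact sum_congr rfl fun a _ => sum_congr rfl fun b _ => by push_cast; ring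
  have hr : ∑ m ∈ Icc 1 n, (fun m : ℤ => 840 * m ^ 1 - 5040 * m ^ 2 +
      4200 * m ^ 3) m * coeff n (lambert m) =
      840 * coeff n (divisorSeries 1) - 5040 * coeff n (divisorSeries 2) +
          4200 * coeff n (divisorSeries 3) := by
    simp only [coeff_divisorSeries_eq_sum, mul_sum, ← sum_add_distrib, ← sum_sub_distrib,
        ← sum_neg_distrib]
    exact sum_congr rfl fun m _ => by ring
  have hd : ∑ m ∈ Icc 1 n, (fun a b : ℕ => (a : ℤ) ^ 2 + (b : ℤ) ^ 2 + ((a : ℤ) - b) ^ 2) m m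
      * coeff n (lambert m * lambert m) =
      2 * coeff n (theta (divisorSeries 1)) - 2 * coeff n (divisorSeries 2) := by
    rw [← sum_even_pow_mul_coeff_lambert_sq]
    exact sum_congr rfl fun m _ => by ring
  rw [hl, hr, hd] at h
  simp only [map_add, map_sub, map_neg, neg_mul, coeff_ofNat_mul]
  linarith

/-- Equivalent to θE₄ = (E₂E₄ - E₆)/3. -/
theorem theta_divisorSeries_three :
    240 * (divisorSeries 1 * divisorSeries 3) =
      21 * divisorSeries 5 + 10 * divisorSeries 3 - divisorSeries 1 - 30 * theta (divisorSeries 3)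
          := by
  ext n
  have h := sum_coeff_lambert_mul_lambert_of_eq n
    (fun a b => (a : ℤ) ^ 4 + (b : ℤ) ^ 4 + ((a : ℤ) - b) ^ 4)
    (fun a b => by ring) (fun a b => by push_cast; ring)
    (fun m => 2 * m ^ 4)
    (fun m => -4 * m ^ 3)
    (fun m => 6 * m ^ 2)
    (fun m => -4 * m ^ 1)
    (fun m => 2 * m ^ 0)
    (fun _ => 0)
    (fun _ => 0)
    (fun _ => 0)
    (fun _ => 0)
    (fun m => -168 * m ^ 1 + 1680 * m ^ 3 - 5040 * m ^ 4 + 3528 * m ^ 5)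
    (fun a m => by ring) (fun m => by ring)
  have hl : ∑ a ∈ Icc 1 n, ∑ b ∈ Icc 1 n,
      ((fun a b : ℕ => (a : ℤ) ^ 4 + (b : ℤ) ^ 4 + ((a : ℤ) - b) ^ 4) a (a +
          b) - (fun a b : ℕ => (a : ℤ) ^ 4 + (b : ℤ) ^ 4 + ((a : ℤ) - b) ^ 4) a b)
        * coeff n (lambert a * lambert b) =
      16 * coeff n (divisorSeries 1 * divisorSeries 3) := by
    -- The monomials ab³ and a³b of f(a, a + b) - f(a, b) occur separately, so the product is
    -- written in both orders before comparing term by term.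
    rw [show 16 * coeff n (divisorSeries 1 * divisorSeries 3) =
        8 * coeff n (divisorSeries 1 * divisorSeries 3) +
        8 * coeff n (divisorSeries 3 * divisorSeries 1) by
      rw [mul_comm (divisorSeries 3)]; ring]
    simp only [coeff_divisorSeries_mul, mul_sum, ← sum_add_distrib]
    exact sum_congr rfl fun a _ => sum_congr rfl fun b _ => by push_cast; ring
  have hr : ∑ m ∈ Icc 1 n, (fun m : ℤ => -168 * m ^ 1 + 1680 * m ^ 3 - 5040 * m ^ 4 +
      3528 * m ^ 5) m * coeff n (lambert m) =
      -168 * coeff n (divisorSeries 1) + 1680 * coeff n (divisorSeries 3) -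
          5040 * coeff n (divisorSeries 4) + 3528 * coeff n (divisorSeries 5) := by
    simp only [coeff_divisorSeries_eq_sum, mul_sum, ← sum_add_distrib, ← sum_sub_distrib,
        ← sum_neg_distrib]
    exact sum_congr rfl fun m _ => by ring
  have hd : ∑ m ∈ Icc 1 n, (fun a b : ℕ => (a : ℤ) ^ 4 + (b : ℤ) ^ 4 + ((a : ℤ) - b) ^ 4) m m
      * coeff n (lambert m * lambert m) =
      2 * coeff n (theta (divisorSeries 3)) - 2 * coeff n (divisorSeries 4) := by
    rw [← sum_even_pow_mul_coeff_lambert_sq]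
    exact sum_congr rfl fun m _ => by ring
  rw [hl, hr, hd] at h
  simp only [map_add, map_sub, map_neg, neg_mul, coeff_ofNat_mul]
  linarith

/-- Together with `divisorSeries_three_sq`, which removes Φ₇, this is θE₆ = (E₂E₆ - E₈)/2. -/
theorem theta_divisorSeries_five :
    504 * (divisorSeries 1 * divisorSeries 5) + 840 * (divisorSeries 3 * divisorSeries 3) =
      27 * divisorSeries 7 + 21 * divisorSeries 5 + divisorSeries 1 - 7 * divisorSeries 3 -
          42 * theta (divisorSeries 5) := by
  ext n
  have h := sum_coeff_lambert_mul_lambert_of_eq n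
    (fun a b => (a : ℤ) ^ 6 + (b : ℤ) ^ 6 + ((a : ℤ) - b) ^ 6)
    (fun a b => by ring) (fun a b => by push_cast; ring)
    (fun m => 2 * m ^ 6)
    (fun m => -6 * m ^ 5)
    (fun m => 15 * m ^ 4)
    (fun m => -20 * m ^ 3)
    (fun m => 15 * m ^ 2)
    (fun m => -6 * m ^ 1)
    (fun m => 2 * m ^ 0)
    (fun _ => 0)
    (fun _ => 0)
    (fun m => 120 * m ^ 1 - 840 * m ^ 3 + 2520 * m ^ 5 - 5040 * m ^ 6 + 3240 * m ^ 7)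
    (fun a m => by ring) (fun m => by ring)
  have hl : ∑ a ∈ Icc 1 n, ∑ b ∈ Icc 1 n,
      ((fun a b : ℕ => (a : ℤ) ^ 6 + (b : ℤ) ^ 6 + ((a : ℤ) - b) ^ 6) a (a +
          b) - (fun a b : ℕ => (a : ℤ) ^ 6 + (b : ℤ) ^ 6 + ((a : ℤ) - b) ^ 6) a b)
        * coeff n (lambert a * lambert b) =
      24 * coeff n (divisorSeries 1 * divisorSeries 5) +
          40 * coeff n (divisorSeries 3 * divisorSeries 3) := by
    rw [show 24 * coeff n (divisorSeries 1 * divisorSeries 5) =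
        12 * coeff n (divisorSeries 1 * divisorSeries 5) +
        12 * coeff n (divisorSeries 5 * divisorSeries 1) by
      rw [mul_comm (divisorSeries 5)]; ring]
    simp only [coeff_divisorSeries_mul, mul_sum, ← sum_add_distrib]
    exact sum_congr rfl fun a _ => sum_congr rfl fun b _ => by push_cast; ring
  have hr : ∑ m ∈ Icc 1 n, (fun m : ℤ => 120 * m ^ 1 - 840 * m ^ 3 + 2520 * m ^ 5 - 5040 * m ^ 6 +
      3240 * m ^ 7) m * coeff n (lambert m) =
      120 * coeff n (divisorSeries 1) - 840 * coeff n (divisorSeries 3) +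
          2520 * coeff n (divisorSeries 5) - 5040 * coeff n (divisorSeries 6) +
          3240 * coeff n (divisorSeries 7) := by
    simp only [coeff_divisorSeries_eq_sum, mul_sum, ← sum_add_distrib, ← sum_sub_distrib,
        ← sum_neg_distrib]
    exact sum_congr rfl fun m _ => by ring
  have hd : ∑ m ∈ Icc 1 n, (fun a b : ℕ => (a : ℤ) ^ 6 + (b : ℤ) ^ 6 + ((a : ℤ) - b) ^ 6) m m
      * coeff n (lambert m * lambert m) =
      2 * coeff n (theta (divisorSeries 5)) - 2 * coeff n (divisorSeries 6) := by
    rw [← sum_even_pow_mul_coeff_lambert_sq]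
    exact sum_congr rfl fun m _ => by ring
  rw [hl, hr, hd] at h
  simp only [map_add, map_sub, map_neg, neg_mul, coeff_ofNat_mul]
  linarith

/-- Equivalent to E₄² = E₈. Here f contains the factor (ab(a - b))² and so vanishes on the diagonal;
hence no derivative appears. The same holds for the next three identities. -/
theorem divisorSeries_three_sq :
    120 * (divisorSeries 3 * divisorSeries 3) =
      divisorSeries 7 - divisorSeries 3 := by
  ext n
  have h := sum_coeff_lambert_mul_lambert_of_eq n
    (fun a b => ((a : ℤ) * b * (a - b)) ^ 2)
    (fun a b => by ring) (fun a b => by push_cast; ring)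
    (fun _ => 0)
    (fun _ => 0)
    (fun m => m ^ 4)
    (fun m => -2 * m ^ 3)
    (fun m => m ^ 2)
    (fun _ => 0)
    (fun _ => 0)
    (fun _ => 0)
    (fun _ => 0)
    (fun m => -84 * m ^ 3 + 84 * m ^ 7)
    (fun a m => by ring) (fun m => by ring)
  have hl : ∑ a ∈ Icc 1 n, ∑ b ∈ Icc 1 n,
      ((fun a b : ℕ => ((a : ℤ) * b * (a - b)) ^ 2) a (a +
          b) - (fun a b : ℕ => ((a : ℤ) * b * (a - b)) ^ 2) a b)
        * coeff n (lambert a * lambert b) =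
      4 * coeff n (divisorSeries 3 * divisorSeries 3) := by
    simp only [coeff_divisorSeries_mul, mul_sum, ← sum_add_distrib]
    exact sum_congr rfl fun a _ => sum_congr rfl fun b _ => by push_cast; ring
  have hr : ∑ m ∈ Icc 1 n, (fun m : ℤ => -84 * m ^ 3 + 84 * m ^ 7) m * coeff n (lambert m) =
      -84 * coeff n (divisorSeries 3) + 84 * coeff n (divisorSeries 7) := by
    simp only [coeff_divisorSeries_eq_sum, mul_sum, ← sum_add_distrib, ← sum_sub_distrib,
        ← sum_neg_distrib]
    exact sum_congr rfl fun m _ => by ring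
  have hd : ∑ m ∈ Icc 1 n, (fun a b : ℕ => ((a : ℤ) * b * (a - b)) ^ 2) m m
      * coeff n (lambert m * lambert m) = 0 :=
    sum_eq_zero fun m _ => by ring
  rw [hl, hr, hd] at h
  simp only [map_add, map_sub, map_neg, neg_mul, coeff_ofNat_mul]
  linarith

/-- Equivalent to E₄E₆ = E₁₀. -/
theorem divisorSeries_three_mul_five :
    5040 * (divisorSeries 3 * divisorSeries 5) =
      11 * divisorSeries 9 + 10 * divisorSeries 3 - 21 * divisorSeries 5 := by
  ext n
  have h := sum_coeff_lambert_mul_lambert_of_eq n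
    (fun a b => ((a : ℤ) * b * (a - b)) ^ 2 * ((a : ℤ) ^ 2 - a * b + b ^ 2))
    (fun a b => by ring) (fun a b => by push_cast; ring)
    (fun _ => 0)
    (fun _ => 0)
    (fun m => m ^ 6)
    (fun m => -3 * m ^ 5)
    (fun m => 4 * m ^ 4)
    (fun m => -3 * m ^ 3)
    (fun m => m ^ 2)
    (fun _ => 0)
    (fun _ => 0)
    (fun m => 60 * m ^ 3 - 126 * m ^ 5 + 66 * m ^ 9)
    (fun a m => by ring) (fun m => by ring)
  have hl : ∑ a ∈ Icc 1 n, ∑ b ∈ Icc 1 n,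
      ((fun a b : ℕ => ((a : ℤ) * b * (a - b)) ^ 2 * ((a : ℤ) ^ 2 - a * b + b ^ 2)) a (a +
          b) - (fun a b : ℕ => ((a : ℤ) * b * (a - b)) ^ 2 * ((a : ℤ) ^ 2 - a * b + b ^ 2)) a b)
        * coeff n (lambert a * lambert b) =
      12 * coeff n (divisorSeries 3 * divisorSeries 5) := by
    rw [show 12 * coeff n (divisorSeries 3 * divisorSeries 5) =
        6 * coeff n (divisorSeries 3 * divisorSeries 5) +
        6 * coeff n (divisorSeries 5 * divisorSeries 3) by
      rw [mul_comm (divisorSeries 5)]; ring]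
    simp only [coeff_divisorSeries_mul, mul_sum, ← sum_add_distrib]
    exact sum_congr rfl fun a _ => sum_congr rfl fun b _ => by push_cast; ring
  have hr : ∑ m ∈ Icc 1 n, (fun m : ℤ => 60 * m ^ 3 - 126 * m ^ 5 +
      66 * m ^ 9) m * coeff n (lambert m) =
      60 * coeff n (divisorSeries 3) - 126 * coeff n (divisorSeries 5) +
          66 * coeff n (divisorSeries 9) := by
    simp only [coeff_divisorSeries_eq_sum, mul_sum, ← sum_add_distrib, ← sum_sub_distrib,
        ← sum_neg_distrib]
    exact sum_congr rfl fun m _ => by ring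
  have hd : ∑ m ∈ Icc 1 n, (fun a b : ℕ => ((a : ℤ) * b * (a - b)) ^ 2 * ((a : ℤ) ^ 2 - a * b +
      b ^ 2)) m m
      * coeff n (lambert m * lambert m) = 0 :=
    sum_eq_zero fun m _ => by ring
  rw [hl, hr, hd] at h
  simp only [map_add, map_sub, map_neg, neg_mul, coeff_ofNat_mul]
  linarith

/-- Equivalent to 441 E₄E₈ + 250 E₆² = 691 E₁₂. -/
theorem divisorSeries_three_mul_seven :
    10080 * (divisorSeries 3 * divisorSeries 7) + 12600 * (divisorSeries 5 * divisorSeries 5) =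
      50 * divisorSeries 5 + 13 * divisorSeries 11 - 21 * divisorSeries 3 -
          42 * divisorSeries 7 := by
  ext n
  have h := sum_coeff_lambert_mul_lambert_of_eq n
    (fun a b => ((a : ℤ) * b * (a - b)) ^ 2 * ((a : ℤ) ^ 2 - a * b + b ^ 2) ^ 2)
    (fun a b => by ring) (fun a b => by push_cast; ring)
    (fun _ => 0)
    (fun _ => 0)
    (fun m => m ^ 8)
    (fun m => -4 * m ^ 7)
    (fun m => 8 * m ^ 6)
    (fun m => -10 * m ^ 5)
    (fun m => 8 * m ^ 4)
    (fun m => -4 * m ^ 3)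
    (fun m => m ^ 2)
    (fun m => -84 * m ^ 3 + 200 * m ^ 5 - 168 * m ^ 7 + 52 * m ^ 11)
    (fun a m => by ring) (fun m => by ring)
  have hl : ∑ a ∈ Icc 1 n, ∑ b ∈ Icc 1 n,
      ((fun a b : ℕ => ((a : ℤ) * b * (a - b)) ^ 2 * ((a : ℤ) ^ 2 - a * b + b ^ 2) ^ 2) a (a +
          b) - (fun a b : ℕ => ((a : ℤ) * b * (a - b)) ^ 2 * ((a : ℤ) ^ 2 - a * b + b ^ 2) ^ 2) a b)
        * coeff n (lambert a * lambert b) =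
      16 * coeff n (divisorSeries 3 * divisorSeries 7) +
          20 * coeff n (divisorSeries 5 * divisorSeries 5) := by
    rw [show 16 * coeff n (divisorSeries 3 * divisorSeries 7) =
        8 * coeff n (divisorSeries 3 * divisorSeries 7) +
        8 * coeff n (divisorSeries 7 * divisorSeries 3) by
      rw [mul_comm (divisorSeries 7)]; ring]
    simp only [coeff_divisorSeries_mul, mul_sum, ← sum_add_distrib]
    exact sum_congr rfl fun a _ => sum_congr rfl fun b _ => by push_cast; ring
  have hr : ∑ m ∈ Icc 1 n, (fun m : ℤ => -84 * m ^ 3 + 200 * m ^ 5 - 168 * m ^ 7 +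
      52 * m ^ 11) m * coeff n (lambert m) =
      -84 * coeff n (divisorSeries 3) + 200 * coeff n (divisorSeries 5) -
          168 * coeff n (divisorSeries 7) + 52 * coeff n (divisorSeries 11) := by
    simp only [coeff_divisorSeries_eq_sum, mul_sum, ← sum_add_distrib, ← sum_sub_distrib,
        ← sum_neg_distrib]
    exact sum_congr rfl fun m _ => by ring
  have hd : ∑ m ∈ Icc 1 n, (fun a b : ℕ => ((a : ℤ) * b * (a - b)) ^ 2 * ((a : ℤ) ^ 2 - a * b +
      b ^ 2) ^ 2) m m
      * coeff n (lambert m * lambert m) = 0 :=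
    sum_eq_zero fun m _ => by ring
  rw [hl, hr, hd] at h
  simp only [map_add, map_sub, map_neg, neg_mul, coeff_ofNat_mul]
  linarith

/-- Equivalent to E₆E₈ = E₁₄. -/
theorem divisorSeries_five_mul_seven :
    10080 * (divisorSeries 5 * divisorSeries 7) =
      20 * divisorSeries 7 + divisorSeries 13 - 21 * divisorSeries 5 := by
  ext n
  have h := sum_coeff_lambert_mul_lambert_of_eq n
    (fun a b => ((a : ℤ) * b * (a - b)) ^ 4)
    (fun a b => by ring) (fun a b => by push_cast; ring)
    (fun _ => 0)
    (fun _ => 0)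
    (fun _ => 0)
    (fun _ => 0)
    (fun m => m ^ 8)
    (fun m => -4 * m ^ 7)
    (fun m => 6 * m ^ 6)
    (fun m => -4 * m ^ 5)
    (fun m => m ^ 4)
    (fun m => -84 * m ^ 5 + 80 * m ^ 7 + 4 * m ^ 13)
    (fun a m => by ring) (fun m => by ring)
  have hl : ∑ a ∈ Icc 1 n, ∑ b ∈ Icc 1 n,
      ((fun a b : ℕ => ((a : ℤ) * b * (a - b)) ^ 4) a (a +
          b) - (fun a b : ℕ => ((a : ℤ) * b * (a - b)) ^ 4) a b)
        * coeff n (lambert a * lambert b) =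
      16 * coeff n (divisorSeries 5 * divisorSeries 7) := by
    rw [show 16 * coeff n (divisorSeries 5 * divisorSeries 7) =
        8 * coeff n (divisorSeries 5 * divisorSeries 7) +
        8 * coeff n (divisorSeries 7 * divisorSeries 5) by
      rw [mul_comm (divisorSeries 7)]; ring]
    simp only [coeff_divisorSeries_mul, mul_sum, ← sum_add_distrib]
    exact sum_congr rfl fun a _ => sum_congr rfl fun b _ => by push_cast; ring
  have hr : ∑ m ∈ Icc 1 n, (fun m : ℤ => -84 * m ^ 5 + 80 * m ^ 7 +
      4 * m ^ 13) m * coeff n (lambert m) =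
      -84 * coeff n (divisorSeries 5) + 80 * coeff n (divisorSeries 7) +
          4 * coeff n (divisorSeries 13) := by
    simp only [coeff_divisorSeries_eq_sum, mul_sum, ← sum_add_distrib, ← sum_sub_distrib,
        ← sum_neg_distrib]
    exact sum_congr rfl fun m _ => by ring
  have hd : ∑ m ∈ Icc 1 n, (fun a b : ℕ => ((a : ℤ) * b * (a - b)) ^ 4) m m
      * coeff n (lambert m * lambert m) = 0 :=
    sum_eq_zero fun m _ => by ring
  rw [hl, hr, hd] at h
  simp only [map_add, map_sub, map_neg, neg_mul, coeff_ofNat_mul]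
  linarith

/-! ### Computable polynomials in three variables modulo p -/

/-- A sparse polynomial in three variables with natural coefficients, for calculations modulo some
`p`: the entry `(c, i, j, k)` stands for `c * x ^ i * y ^ j * z ^ k`. -/
abbrev TriPoly := List (ℕ × ℕ × ℕ × ℕ)

namespace TriPoly

/-- An injective (for exponents below `16`) encoding of the exponents, to keep lists sorted. -/
def key (m : ℕ × ℕ × ℕ × ℕ) : ℕ := m.2.1 + 16 * m.2.2.1 + 256 * m.2.2.2

/-- One step of merging two sorted lists: `m` is placed, and the continuation `k` merges the
remaining monomials into the tail behind it. In this form the merge in `add` is structurally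
recursive and can be evaluated by the kernel. -/
def insertThen (p : ℕ) (m : ℕ × ℕ × ℕ × ℕ) (k : TriPoly → TriPoly) : TriPoly → TriPoly
  | [] => m :: k []
  | m' :: g =>
    bif Nat.blt (key m) (key m') then m :: k (m' :: g)
    else bif Nat.beq m.2.1 m'.2.1 && (Nat.beq m.2.2.1 m'.2.2.1 && Nat.beq m.2.2.2 m'.2.2.2) then
      ((m.1 + m'.1) % p, m'.2) :: k g
    else m' :: insertThen p m k g

def add (p : ℕ) : TriPoly → TriPoly → TriPoly
  | [], g => g
  | m :: f, g => insertThen p m (add p f) g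

def mulMonomial (p : ℕ) (m : ℕ × ℕ × ℕ × ℕ) (f : TriPoly) : TriPoly :=
  f.map fun m' => (m.1 * m'.1 % p, m.2.1 + m'.2.1, m.2.2.1 + m'.2.2.1, m.2.2.2 + m'.2.2.2)

def mul (p : ℕ) : TriPoly → TriPoly → TriPoly
  | [], _ => []
  | m :: f, g => add p (mulMonomial p m g) (mul p f g)

def smul (p c : ℕ) (f : TriPoly) : TriPoly := mulMonomial p (c, 0, 0, 0) f

def consMonomial (m : ℕ × ℕ × ℕ × ℕ) (f : TriPoly) : TriPoly :=
  bif Nat.beq m.1 0 then f else m :: f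

/-- The truncated exponent at 0 is harmless, since the coefficient is then 0. -/
def pderivX (p : ℕ) : TriPoly → TriPoly
  | [] => []
  | m :: f => consMonomial (m.1 * m.2.1 % p, m.2.1 - 1, m.2.2.1, m.2.2.2) (pderivX p f)

def pderivY (p : ℕ) : TriPoly → TriPoly
  | [] => []
  | m :: f => consMonomial (m.1 * m.2.2.1 % p, m.2.1, m.2.2.1 - 1, m.2.2.2) (pderivY p f)

def pderivZ (p : ℕ) : TriPoly → TriPoly
  | [] => []
  | m :: f => consMonomial (m.1 * m.2.2.2 % p, m.2.1, m.2.2.1, m.2.2.2 - 1) (pderivZ p f)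

/-- The operator `f ↦ x * f + D f`, for the derivation `D` with values `dx`, `dy`, `dz` at the
variables. -/
def nabla (p : ℕ) (dx dy dz f : TriPoly) : TriPoly :=
  add p (mulMonomial p (1, 1, 0, 0) f) (add p (mul p dx (pderivX p f))
    (add p (mul p dy (pderivY p f)) (mul p dz (pderivZ p f))))

def isZero (p : ℕ) : TriPoly → Bool
  | [] => true
  | m :: f => Nat.beq (m.1 % p) 0 && isZero p f

def combo (p : ℕ) : List ℤ → List TriPoly → TriPoly
  | c :: cs, f :: fs => add p (smul p (c % p).toNat f) (combo p cs fs)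
  | _, _ => []

/-- Evaluation of a polynomial in `n` whose coefficients are linear combinations of `fs`, where `n`
acts as the operator `nabla`. -/
def horner (p : ℕ) (dx dy dz : TriPoly) (fs : List TriPoly) : List (List ℤ) → TriPoly
  | [] => []
  | cs :: css => add p (combo p cs fs) (nabla p dx dy dz (horner p dx dy dz fs css))

/-- The sum of `κ * (N choose (2 * i + 1)) * φᵢ * cᵢ`. -/
def convolve (p κ N : ℕ) : ℕ → List TriPoly → List TriPoly → TriPoly
  | i, φ :: φs, c :: cs =>
    add p (smul p (κ * N.choose (2 * i + 1) % p) (mul p φ c)) (convolve p κ N (i + 1) φs cs)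
  | _, _, _ => []

/-- The list of the moments of orders `2 * t`, …, `2`, `0`. -/
def moments (p κ : ℕ) (φs : List TriPoly) : ℕ → List TriPoly
  | 0 => [[(1, 0, 0, 0)]]
  | t + 1 => convolve p κ (2 * t + 1) 0 φs (moments p κ φs t) :: moments p κ φs t

section Eval

variable {A : Type*} [CommRing A]

def eval (x y z : A) : TriPoly → A
  | [] => 0
  | m :: f => m.1 * x ^ m.2.1 * y ^ m.2.2.1 * z ^ m.2.2.2 + eval x y z f

variable {p : ℕ}

theorem cast_mod_eq (hp : (p : A) = 0) (a : ℕ) : ((a % p : ℕ) : A) = a := by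
  conv_rhs => rw [← Nat.div_add_mod a p]
  push_cast
  rw [hp, zero_mul, zero_add]

/-- Valid for unsorted lists as well: `key` only decides the position of `m`, and coefficients are
merged only after a comparison of the exponents themselves. -/
theorem eval_insertThen (hp : (p : A) = 0) (x y z : A) (m : ℕ × ℕ × ℕ × ℕ) (k : TriPoly → TriPoly)
    (f : TriPoly)
    (hk : ∀ g, eval x y z (k g) = eval x y z f + eval x y z g) (g : TriPoly) :
    eval x y z (insertThen p m k g) = eval x y z (m :: f) + eval x y z g := by
  induction g with
  | nil => simp [insertThen, eval, hk]
  | cons m' g ih =>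
    simp only [insertThen, Bool.cond_eq_ite]
    split_ifs with h1 h2
    · simp only [eval, hk]
      ring
    · simp only [Bool.and_eq_true, Nat.beq_eq] at h2
      simp only [eval, hk, cast_mod_eq hp, h2]
      push_cast
      ring
    · rw [eval, ih, eval, eval]
      ring

theorem eval_add (hp : (p : A) = 0) (x y z : A) (f g : TriPoly)
    : eval x y z (add p f g) = eval x y z f + eval x y z g := by
  induction f generalizing g with
  | nil => simp [add, eval]
  | cons m f ih => exact eval_insertThen hp x y z m _ f ih g

theorem eval_mulMonomial (hp : (p : A) = 0) (x y z : A) (m : ℕ × ℕ × ℕ × ℕ) (f : TriPoly) :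
    eval x y z (mulMonomial p m f) =
      m.1 * x ^ m.2.1 * y ^ m.2.2.1 * z ^ m.2.2.2 * eval x y z f := by
  induction f with
  | nil => simp [mulMonomial, eval]
  | cons m' f ih =>
    rw [mulMonomial, List.map_cons, ← mulMonomial, eval, ih, eval, cast_mod_eq hp]
    push_cast
    ring

theorem eval_mul (hp : (p : A) = 0) (x y z : A) (f g : TriPoly)
    : eval x y z (mul p f g) = eval x y z f * eval x y z g := by
  induction f with
  | nil => simp [mul, eval]
  | cons m f ih => rw [mul, eval_add hp, eval_mulMonomial hp, ih, eval, add_mul]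

theorem eval_smul (hp : (p : A) = 0) (x y z : A) (c : ℕ) (f : TriPoly)
    : eval x y z (smul p c f) = c * eval x y z f := by
  simp [smul, eval_mulMonomial hp]

theorem eval_consMonomial (x y z : A) (m : ℕ × ℕ × ℕ × ℕ) (f : TriPoly) :
    eval x y z (consMonomial m f) = eval x y z (m :: f) := by
  rw [consMonomial, Bool.cond_eq_ite]
  split_ifs with h
  · rw [Nat.beq_eq] at h
    simp [eval, h]
  · rfl

theorem eval_eq_zero_of_isZero (hp : (p : A) = 0) (x y z : A) (f : TriPoly) (h : isZero p f =
    true) : eval x y z f = 0 := by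
  induction f with
  | nil => rfl
  | cons m f ih =>
    simp only [isZero, Bool.and_eq_true, Nat.beq_eq] at h
    rw [eval, ih h.2, ← cast_mod_eq hp, h.1]
    simp

theorem derivation_eval (hp : (p : A) = 0) (x y z : A) {R : Type*} [CommRing R] [Algebra R A]
    (D : Derivation R A A) (f : TriPoly) :
    D (eval x y z f) = D x * eval x y z (pderivX p f) + D y * eval x y z (pderivY p f)
      + D z * eval x y z (pderivZ p f) := by
  induction f with
  | nil => simp [eval, pderivX, pderivY, pderivZ]
  | cons m f ih =>
    rw [eval, map_add, ih, pderivX, pderivY, pderivZ, eval_consMonomial, eval_consMonomial,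
      eval_consMonomial]
    simp only [eval, cast_mod_eq hp, Derivation.leibniz, Derivation.leibniz_pow,
      Derivation.map_natCast, smul_eq_mul, nsmul_eq_mul]
    push_cast
    ring

theorem eval_nabla (hp : (p : A) = 0) {x y z : A} {R : Type*} [CommRing R] [Algebra R A]
    (D : Derivation R A A) {dx dy dz : TriPoly} (hx : D x = eval x y z dx) (hy : D y =
        eval x y z dy)
    (hz : D z = eval x y z dz) {P : A} (hP : D P = x * P) (f : TriPoly) :
    P * eval x y z (nabla p dx dy dz f) = D (P * eval x y z f) := by
  rw [Derivation.leibniz, derivation_eval hp x y z D f, hP, hx, hy, hz, nabla]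
  simp only [eval_add hp, eval_mul hp, eval_mulMonomial hp, smul_eq_mul]
  push_cast
  ring

end Eval

/-- The value of the combination that `horner` computes. -/
def hornerValue {F : Type*} [CommRing F] (n : F) (vs : List F) : List (List ℤ) → F
  | [] => 0
  | cs :: css => (List.zipWith (fun (c : ℤ) (v : F) => (c : F) * v) cs vs).sum +
      n * hornerValue n vs css

variable {F : Type*} [CommRing F] {p : ℕ}

theorem coeff_eval_combo [NeZero p] (hp : (p : F) = 0) (x y z P : F⟦X⟧) (n : ℕ) (cs : List ℤ)
    (fs : List TriPoly) :
    coeff n (P * eval x y z (combo p cs fs)) =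
      (List.zipWith (fun (c : ℤ) (v : F) => (c : F) * v) cs
        (fs.map fun f => coeff n (P * eval x y z f))).sum := by
  have hpA : (p : F⟦X⟧) = 0 := by rw [← map_natCast (C (R := F)), hp, map_zero]
  induction cs generalizing fs with
  | nil => simp [combo, eval]
  | cons c cs ih =>
    rcases fs with _ | ⟨f, fs⟩
    · simp [combo, eval]
    · have hc : (((c % p).toNat : ℕ) : F) = c := by
        have h1 : (((c % p).toNat : ℤ) : F) = ((c % p : ℤ) : F) := by
          rw [Int.toNat_of_nonneg (Int.emod_nonneg _ (by exact_mod_cast NeZero.ne p))]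
        rw [Int.cast_natCast] at h1
        rw [h1]
        conv_rhs => rw [← Int.mul_ediv_add_emod c p]
        push_cast
        rw [hp, zero_mul, zero_add]
      rw [combo, eval_add hpA, mul_add, map_add, ih, List.map_cons, List.zipWith_cons_cons,
        List.sum_cons, eval_smul hpA, mul_left_comm, coeff_natCast_mul, hc]

/-- The bridge from congruences to polynomials: θ multiplies the n-th coefficient by n, and θ(P f)
is P times `nabla` of f, so Horner's scheme in `nabla` computes a polynomial in n. -/
theorem coeff_eval_horner [NeZero p] (hp : (p : F) = 0) {x y z P : F⟦X⟧} {dx dy dz : TriPoly}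
    (hx : theta x = eval x y z dx) (hy : theta y = eval x y z dy) (hz : theta z = eval x y z dz)
    (hP : theta P = x * P) (n : ℕ) (fs : List TriPoly) (css : List (List ℤ)) :
    coeff n (P * eval x y z (horner p dx dy dz fs css)) =
      hornerValue (n : F) (fs.map fun f => coeff n (P * eval x y z f)) css := by
  have hpA : (p : F⟦X⟧) = 0 := by rw [← map_natCast (C (R := F)), hp, map_zero]
  induction css with
  | nil => simp [horner, hornerValue, eval]
  | cons cs css ih =>
    rw [horner, eval_add hpA, mul_add, map_add, coeff_eval_combo hp,
      eval_nabla hpA theta hx hy hz hP, coeff_theta, ih, hornerValue]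

theorem eval_convolve {A : Type*} [CommRing A] (hp : (p : A) = 0) (x y z : A) (κ N : ℕ)
    (φ c : ℕ → A) (φs cs : List TriPoly) (i : ℕ) (hl : cs.length ≤ φs.length)
    (hφ : ∀ j (h : j < φs.length), eval x y z φs[j] = φ (i + j))
    (hc : ∀ j (h : j < cs.length), eval x y z cs[j] = c (i + j)) :
    eval x y z (convolve p κ N i φs cs) =
      ∑ j ∈ range cs.length, (κ * N.choose (2 * (i + j) + 1) : ℕ) * (φ (i + j) * c (i + j)) := by
  induction φs generalizing cs i with
  | nil =>
    rw [List.length_nil, Nat.le_zero] at hl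
    simp [hl, convolve, eval]
  | cons f φs ih =>
    rcases cs with _ | ⟨g, cs⟩
    · simp [convolve, eval]
    · have h1 := hφ 0 (by simp)
      have h2 := hc 0 (by simp)
      simp only [List.getElem_cons_zero, add_zero] at h1 h2
      rw [convolve, eval_add hp, eval_smul hp, eval_mul hp, h1, h2, cast_mod_eq hp,
          List.length_cons,
        sum_range_succ', add_comm, ih cs (i + 1) (by simpa using hl)
          (fun j hj => by rw [add_assoc, add_comm 1]; exact hφ (j + 1) (by simpa using hj))
          (fun j hj => by rw [add_assoc, add_comm 1]; exact hc (j + 1) (by simpa using hj))]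
      simp [add_assoc, add_comm 1]

theorem length_moments (p κ : ℕ) (φs : List TriPoly) (t : ℕ) :
    (moments p κ φs t).length = t + 1 := by
  induction t with
  | zero => rfl
  | succ t ih => rw [moments, List.length_cons, ih]

/-- Any family M that starts at P and satisfies the recursion `hM'` is P times the computed
polynomials. It serves both the crank (κ = 2) and C³/P² (κ = 6). -/
theorem eval_moments {A : Type*} [CommRing A] (hp : (p : A) = 0) (x y z P : A) (κ : ℕ)
    (φ M : ℕ → A) (φs : List TriPoly)
    (hφ : ∀ j (h : j < φs.length), eval x y z φs[j] = φ j) (hM : M 0 = P)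
    (hM' : ∀ t, M (t + 1) =
      ∑ j ∈ range (t + 1), (κ * (2 * t + 1).choose (2 * j + 1) : ℕ) * (φ j * M (t - j)))
    (t : ℕ) (ht : t ≤ φs.length) :
    (moments p κ φs t).map (fun f => P * eval x y z f) =
      (List.range (t + 1)).map fun i => M (t - i) := by
  induction t with
  | zero => simp [moments, eval, hM]
  | succ t ih =>
    have ih := ih (by omega)
    have hlen := length_moments p κ φs t
    have hc : ∀ j (h : j < (moments p κ φs t).length),
        P * eval x y z (moments p κ φs t)[j] = M (t - j) := by
      intro j h
      have := congrArg (fun l => l[j]?) ih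
      simpa [h, hlen ▸ h] using this
    have h1 : P * eval x y z (convolve p κ (2 * t + 1) 0 φs (moments p κ φs t)) = M (t + 1) := by
      rw [eval_convolve hp x y z κ _ φ (fun j => eval x y z ((moments p κ φs t).getD j [])) φs _ 0
        (by omega) (fun j h => by rw [hφ, zero_add])
        (fun j h => by simp [h]), hM', hlen, mul_sum]
      refine sum_congr rfl fun j hj => ?_
      have h2 : j < (moments p κ φs t).length := by rw [hlen]; exact mem_range.1 hj
      rw [← hc j h2]
      simp only [zero_add, List.getD_eq_getElem _ _ h2]
      ring
    rw [moments, List.map_cons, h1, ih, List.range_succ_eq_map (n := t + 1)]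
    simp [List.map_map, Function.comp_def]

end TriPoly

/-! ### Generating functions of weighted partitions -/

/-- Sums over the partitions of `n` with a given part. -/
theorem sum_partition_with_part {M : Type*} [AddCommMonoid M] {n a : ℕ} (ha : 1 ≤ a)
    (F : Multiset ℕ → M) :
    ∑ p : n.Partition with a ∈ p.parts, F p.parts =
      if a ≤ n then ∑ p : (n - a).Partition, F (a ::ₘ p.parts) else 0 := by
  split_ifs with h
  · rw [← Equiv.sum_comp (Nat.Partition.partitionWithPartEquiv ha h)]
    rw [sum_subtype (p := fun p : n.Partition => a ∈ p.parts) _ (fun p => by simp)]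
    refine sum_congr rfl fun p _ => ?_
    rw [Nat.Partition.partitionWithPartEquiv_apply_parts, Multiset.cons_erase p.2]
  · refine sum_eq_zero fun p hp => ?_
    exact absurd (Nat.Partition.le_of_mem_parts (mem_filter.1 hp).2) h

section WeightSeries

variable {R : Type*} [CommRing R]

/-- The generating function of partitions, where every part `i` has weight `w i`. -/
noncomputable def weightSeries (w : ℕ → R) : R⟦X⟧ :=
  mk fun n => ∑ p : n.Partition, (p.parts.map w).prod

theorem coeff_weightSeries (w : ℕ → R) (n : ℕ) :
    coeff n (weightSeries w) = ∑ p : n.Partition, (p.parts.map w).prod := coeff_mk _ _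

theorem weightSeries_congr {w w' : ℕ → R} (h : ∀ i, 1 ≤ i → w i = w' i) :
    weightSeries w = weightSeries w' := by
  ext n
  simp only [coeff_weightSeries]
  refine sum_congr rfl fun p _ => congrArg _ (Multiset.map_congr rfl fun i hi => h i ?_)
  exact p.parts_pos hi

theorem map_weightSeries {S : Type*} [CommRing S] (f : R →+* S) (w : ℕ → R) :
    PowerSeries.map f (weightSeries w) = weightSeries fun i => f (w i) := by
  ext n
  simp [coeff_weightSeries, map_multiset_prod]

theorem coeff_weight_mul (n i : ℕ) (c : R) (f : R⟦X⟧) :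
    coeff n (C c * X ^ i * f) = if i ≤ n then c * coeff (n - i) f else 0 := by
  rw [mul_assoc, coeff_C_mul, coeff_X_pow_mul']
  split_ifs <;> simp

/-- Either i is not a part, or one copy of i can be removed, which costs a factor w(i) X^i. -/
theorem weightSeries_mul_one_sub (w : ℕ → R) {i : ℕ} (hi : 1 ≤ i) :
    weightSeries w * (1 - C (w i) * X ^ i) = weightSeries (Function.update w i 0) := by
  have key : weightSeries w =
      weightSeries (Function.update w i 0) + C (w i) * X ^ i * weightSeries w := by
    ext n
    rw [map_add, coeff_weight_mul, coeff_weightSeries, coeff_weightSeries, coeff_weightSeries,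
      ← sum_filter_add_sum_filter_not univ (fun p : n.Partition => i ∈ p.parts)
        (fun p => (p.parts.map w).prod), add_comm,
      sum_partition_with_part hi fun s => (s.map w).prod]
    congr 1
    · rw [sum_filter]
      refine sum_congr rfl fun p _ => ?_
      split_ifs with h
      · exact (Multiset.prod_eq_zero (Multiset.mem_map.2 ⟨i, h, by simp⟩)).symm
      · exact congrArg _ (Multiset.map_congr rfl fun j hj => by
          rw [Function.update_of_ne]; rintro rfl; exact h hj)
    · split_ifs
      · simp [mul_sum]
      · rfl
  linear_combination key

theorem weightSeries_mul_prod (w : ℕ → R) (s : Finset ℕ) (hs : ∀ i ∈ s, 1 ≤ i) :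
    weightSeries w * ∏ i ∈ s, (1 - C (w i) * X ^ i) =
      weightSeries fun i => if i ∈ s then 0 else w i := by
  induction s using Finset.induction_on with
  | empty => simp
  | insert i s his ih =>
    have h1 := weightSeries_mul_one_sub (fun j => if j ∈ s then 0 else w j)
      (hs i (mem_insert_self _ _))
    simp only [if_neg his] at h1
    rw [prod_insert his, mul_left_comm, ih fun j hj => hs j (mem_insert_of_mem hj), mul_comm, h1]
    congr 1
    ext j
    rcases eq_or_ne j i with rfl | hj
    · simp
    · simp [hj]

theorem X_pow_dvd_weightSeries_sub_one (w : ℕ → R) (N : ℕ) (hw : ∀ i, 1 ≤ i → i ≤ N → w i = 0) :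
    X ^ (N + 1) ∣ weightSeries w - 1 := by
  rw [X_pow_dvd_iff]
  intro n hn
  rw [map_sub, coeff_weightSeries, coeff_one]
  rcases eq_or_ne n 0 with rfl | h
  · simp
  · rw [if_neg h, sub_zero]
    refine sum_eq_zero fun p _ => ?_
    obtain ⟨i, hi⟩ : ∃ i, i ∈ p.parts := by
      refine Multiset.exists_mem_of_ne_zero fun h0 => h ?_
      rw [← p.parts_sum, h0, Multiset.sum_zero]
    refine Multiset.prod_eq_zero (Multiset.mem_map.2 ⟨i, hi, hw i (p.parts_pos hi) ?_⟩)
    have := Nat.Partition.le_of_mem_parts hi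
    omega

/-- The product formula Π 1/(1 - w(i) X^i), stated modulo a power of X so that no infinite product
is needed. -/
theorem X_pow_dvd_weightSeries_mul_prod_sub_one (w : ℕ → R) (N : ℕ) :
    X ^ (N + 1) ∣ weightSeries w * ∏ i ∈ Icc 1 N, (1 - C (w i) * X ^ i) - 1 := by
  rw [weightSeries_mul_prod w _ fun i hi => (mem_Icc.1 hi).1]
  refine X_pow_dvd_weightSeries_sub_one _ N fun i h1 h2 => ?_
  rw [if_pos (mem_Icc.2 ⟨h1, h2⟩)]

theorem weightSeries_zero : weightSeries (fun _ => (0 : R)) = 1 := by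
  ext n
  have h := X_pow_dvd_weightSeries_sub_one (fun _ => (0 : R)) n fun _ _ _ => rfl
  rw [X_pow_dvd_iff] at h
  have := h n (by omega)
  rwa [map_sub, sub_eq_zero] at this

end WeightSeries

theorem eq_of_forall_X_pow_dvd_sub {R : Type*} [CommRing R] {f g : R⟦X⟧}
    (h : ∀ N, X ^ N ∣ f - g) : f = g := by
  ext n
  have := X_pow_dvd_iff.1 (h (n + 1)) n (by omega)
  rwa [map_sub, sub_eq_zero] at this

/-! ### The q-binomial theorem -/

section QBinomial

variable {A : Type*} [CommRing A]

/-- For F(t) = Σ c_j t^j the recursion of the c_j means (1 - t) F(t) = (1 - αt) F(tq). This is that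
equation at tq^r for the truncated sum, with its boundary term. -/
theorem q_binomial_telescope {c : ℕ → A} {q α : A} (t : A)
    (hc : ∀ j, (1 - q ^ (j + 1)) * c (j + 1) = (1 - α * q ^ j) * c j) (r N : ℕ) :
    (1 - t * q ^ r) * ∑ j ∈ range N, c j * t ^ j * q ^ (r * j)
      - (1 - α * t * q ^ r) * ∑ j ∈ range N, c j * t ^ j * q ^ ((r + 1) * j) =
      - ((1 - q ^ N) * c N * t ^ N * q ^ (r * N)) := by
  induction N with
  | zero => simp
  | succ N ih =>
    rw [sum_range_succ, sum_range_succ, mul_add, mul_add, add_sub_add_comm, ih]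
    have e1 : q ^ ((r + 1) * N) = q ^ (r * N) * q ^ N := by ring
    have e2 : q ^ (r * (N + 1)) = q ^ (r * N) * q ^ r := by ring
    rw [e1, e2]
    linear_combination t ^ (N + 1) * q ^ (r * N) * q ^ r * hc N

/-- The `q`-binomial theorem, modulo `X ^ N`. -/
theorem q_binomial {R : Type*} [CommRing R] {c : ℕ → R⟦X⟧} {q α t : R⟦X⟧} (hc0 : c 0 = 1)
    (hc : ∀ j, (1 - q ^ (j + 1)) * c (j + 1) = (1 - α * q ^ j) * c j) (hq : X ∣ q) (ht : X ∣ t)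
    (N : ℕ) :
    X ^ N ∣ (∏ r ∈ range N, (1 - t * q ^ r)) * ∑ j ∈ range N, c j * t ^ j
      - ∏ r ∈ range N, (1 - α * t * q ^ r) := by
  rcases Nat.eq_zero_or_pos N with rfl | hN
  · simp
  -- The functional equation is iterated K times; every boundary term contains t^N and is divisible
  -- by X^N.
  have h1 : ∀ K, X ^ N ∣ (∏ r ∈ range K, (1 - t * q ^ r)) * ∑ j ∈ range N, c j * t ^ j
      - (∏ r ∈ range K, (1 - α * t * q ^ r)) * ∑ j ∈ range N, c j * t ^ j * q ^ (K * j) := by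
    intro K
    induction K with
    | zero => simp
    | succ K ih =>
      rw [prod_range_succ, prod_range_succ]
      have h2 := q_binomial_telescope t hc K N
      have h3 : X ^ N ∣ (∏ r ∈ range K, (1 - α * t * q ^ r)) *
          ((1 - q ^ N) * c N * t ^ N * q ^ (K * N)) :=
        Dvd.dvd.mul_left (Dvd.dvd.mul_right (Dvd.dvd.mul_left (pow_dvd_pow_of_dvd ht N) _) _) _
      have h4 := dvd_sub (Dvd.dvd.mul_left ih (1 - t * q ^ K)) h3
      convert h4 using 1
      linear_combination (∏ r ∈ range K, (1 - α * t * q ^ r)) * h2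
  -- After N iterations only c_0 = 1 survives modulo X^N, because X divides q.
  have h5 : X ^ N ∣ ∑ j ∈ range N, c j * t ^ j * q ^ (N * j) - 1 := by
    obtain ⟨M, rfl⟩ : ∃ M, N = M + 1 := ⟨N - 1, by omega⟩
    rw [sum_range_succ']
    simp only [hc0, pow_zero, mul_zero, mul_one, add_sub_cancel_right]
    refine dvd_sum fun j _ => Dvd.dvd.mul_left ?_ _
    exact (pow_dvd_pow_of_dvd hq _).trans (pow_dvd_pow _ (Nat.le_mul_of_pos_right _ (by omega)))
  have h6 := dvd_add (h1 N) (Dvd.dvd.mul_left h5 (∏ r ∈ range N, (1 - α * t * q ^ r)))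
  convert h6 using 1
  ring

end QBinomial

/-! ### The crank series as a sum over partitions -/

theorem largestPart_le {n : ℕ} (p : n.Partition) : largestPart p ≤ n :=
  Multiset.sup_le.2 fun _ h => Nat.Partition.le_of_mem_parts h

theorem le_largestPart {n : ℕ} {p : n.Partition} {i : ℕ} (h : i ∈ p.parts) : i ≤ largestPart p :=
  Multiset.le_sup h

theorem largestPart_mem {n : ℕ} (p : n.Partition) (hn : n ≠ 0) : largestPart p ∈ p.parts := by
  have h0 : p.parts ≠ 0 := fun h0 => hn (by rw [← p.parts_sum, h0, Multiset.sum_zero])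
  have : ∀ s : Multiset ℕ, s ≠ 0 → s.sup ∈ s := by
    intro s
    induction s using Multiset.induction_on with
    | empty => simp
    | cons a s ih =>
      intro _
      rcases eq_or_ne s 0 with rfl | hs
      · simp
      · rw [Multiset.sup_cons]
        rcases le_total a s.sup with h | h
        · rw [sup_eq_right.2 h]; exact Multiset.mem_cons_of_mem (ih hs)
        · rw [sup_eq_left.2 h]; exact Multiset.mem_cons_self a s
  exact this _ h0

theorem card_parts_le {n : ℕ} (p : n.Partition) : Multiset.card p.parts ≤ n := by
  conv_rhs => rw [← p.parts_sum]
  have := Multiset.card_nsmul_le_sum (s := p.parts) (a := 1) fun x hx => p.parts_pos hx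
  simpa using this

theorem abs_crank_le {n : ℕ} (p : n.Partition) : -(n : ℤ) ≤ crank p ∧ crank p ≤ n := by
  have h1 := largestPart_le p
  have h2 := card_parts_le p
  have h3 := Multiset.count_le_card 1 p.parts
  have h4 := Multiset.card_le_card (Multiset.filter_le (fun i => p.parts.count 1 < i) p.parts)
  unfold crank
  split_ifs <;> constructor <;> omega

section CrankSeries

variable {R : Type*} [CommRing R]

/-- The generating function `∑ M(k, n) a ^ (n + k) b ^ (n - k) X ^ n` of the crank. -/
noncomputable def crankSeries (a b : R) : R⟦X⟧ :=
  mk fun n => ∑ k ∈ Icc (-(n : ℤ)) n,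
    (crankCount k n : R) * (a ^ (n + k).toNat * b ^ (n - k).toNat)

/-- The correction at n = 1 arises because the only partition of 1 has crank -1 and contributes b²,
whereas the amended values contribute a² - ab + b². -/
theorem coeff_crankSeries (a b : R) (n : ℕ) :
    coeff n (crankSeries a b) = ∑ p : n.Partition,
      a ^ (n + crank p).toNat * b ^ (n - crank p).toNat + if n = 1 then a ^ 2 - a * b else 0 := by
  rw [crankSeries, coeff_mk]
  split_ifs with hn
  · subst hn
    have hI : Icc (-((1 : ℕ) : ℤ)) (1 : ℕ) = {-1, 0, 1} := by decide
    have hc : ∀ p : Nat.Partition 1, crank p = -1 := by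
      intro p
      simp [crank]
    rw [hI, sum_insert (by decide), sum_insert (by decide), sum_singleton]
    simp only [hc, sum_const, card_univ, Fintype.card_unique, one_smul]
    simp [crankCount]
    ring
  · rw [add_zero]
    rw [← sum_fiberwise_of_maps_to (s := univ) (t := Icc (-(n : ℤ)) n) (g := fun p => crank p)
      fun p _ => mem_Icc.2 (abs_crank_le p)]
    refine sum_congr rfl fun k _ => ?_
    rw [crankCount, if_neg hn, Int.cast_natCast, ← nsmul_eq_mul, ← sum_const]
    refine sum_congr rfl fun p hp => ?_
    rw [(mem_filter.1 hp).2]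

/-- The ones are removed one at a time, leaving a partition without ones. -/
theorem sum_partition_count_one_eq (w : ℕ → R) (j n : ℕ) :
    ∑ p : n.Partition with p.parts.count 1 = j, (p.parts.map w).prod =
      coeff n ((C (w 1) * X) ^ j * weightSeries (Function.update w 1 0)) := by
  induction j generalizing n with
  | zero =>
    rw [pow_zero, one_mul, coeff_weightSeries, sum_filter]
    refine sum_congr rfl fun p _ => ?_
    simp only [Multiset.count_eq_zero]
    split_ifs with h
    · exact (Multiset.prod_eq_zero (Multiset.mem_map.2 ⟨1, h, by simp⟩)).symm
    · exact congrArg _ (Multiset.map_congr rfl fun j hj => by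
        rw [Function.update_of_ne]; rintro rfl; exact h hj)
  | succ j ih =>
    have h1 := sum_partition_with_part (n := n) le_rfl
      fun s => if s.count 1 = j + 1 then (s.map w).prod else 0
    rw [← sum_filter, filter_filter] at h1
    have h2 : (univ.filter fun p : n.Partition => 1 ∈ p.parts ∧ p.parts.count 1 = j + 1) =
        univ.filter fun p : n.Partition => p.parts.count 1 = j + 1 := by
      refine filter_congr fun p _ => ⟨fun h => h.2, fun h => ⟨?_, h⟩⟩
      rw [← Multiset.count_pos]
      omega
    rw [h2] at h1
    rw [h1, pow_succ', mul_assoc, ← pow_one X, coeff_weight_mul, pow_one]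
    split_ifs
    · rw [← ih, mul_sum, sum_filter]
      refine sum_congr rfl fun p _ => ?_
      simp
    · rfl

theorem prod_map_pow_eq_pow_sum (c : R) (s : Multiset ℕ) :
    (s.map fun i => c ^ i).prod = c ^ s.sum := by
  induction s using Multiset.induction_on with
  | empty => simp
  | cons i s ih => rw [Multiset.map_cons, Multiset.prod_cons, ih, Multiset.sum_cons, pow_add]

/-- One part m is removed; what remains has parts between 2 and m. The exponents match since a^(n+m)
b^(n-m) = a^(2m) (ab)^(n-m). -/
theorem sum_partition_largestPart_eq (a b : R) (n : ℕ) {m : ℕ} (hm : 2 ≤ m) :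
    ∑ p : n.Partition with p.parts.count 1 = 0 ∧ largestPart p = m, a ^ (n + m) * b ^ (n - m) =
      coeff n ((C (a ^ 2) * X) ^ m *
        weightSeries fun i => if 2 ≤ i ∧ i ≤ m then (a * b) ^ i else 0) := by
  have h1 := sum_partition_with_part (n := n) (a := m) (by omega)
      fun s => if 1 ∉ s ∧ ∀ i ∈ s, i ≤ m then a ^ (s.sum + m) * b ^ (s.sum - m) else 0
  rw [← sum_filter, filter_filter] at h1
  have h2 : (univ.filter fun p : n.Partition => m ∈ p.parts ∧ 1 ∉ p.parts ∧ ∀ i ∈ p.parts, i ≤ m) =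
      univ.filter fun p : n.Partition => p.parts.count 1 = 0 ∧ largestPart p = m := by
    refine filter_congr fun p _ => ?_
    rw [Multiset.count_eq_zero]
    constructor
    · rintro ⟨h, h', h''⟩
      exact ⟨h', le_antisymm (Multiset.sup_le.2 h'') (le_largestPart h)⟩
    · rintro ⟨h, rfl⟩
      have hn : n ≠ 0 := by
        have := largestPart_le p
        omega
      exact ⟨largestPart_mem p hn, h, fun i hi => le_largestPart hi⟩
  rw [h2] at h1
  simp only [Nat.Partition.parts_sum] at h1
  rw [h1, mul_pow, ← map_pow, coeff_weight_mul, coeff_weightSeries]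
  split_ifs with h
  · rw [mul_sum]
    refine sum_congr rfl fun p _ => ?_
    have h3 : (1 ∉ m ::ₘ p.parts ∧ ∀ i ∈ m ::ₘ p.parts, i ≤ m) ↔
        ∀ i ∈ p.parts, 2 ≤ i ∧ i ≤ m := by
      simp only [Multiset.mem_cons, not_or, forall_eq_or_imp, le_refl, true_and]
      constructor
      · rintro ⟨⟨_, h4⟩, h5⟩ i hi
        have h6 := p.parts_pos hi
        have h7 : i ≠ 1 := by rintro rfl; exact h4 hi
        exact ⟨by omega, h5 i hi⟩
      · intro h4
        exact ⟨⟨by omega, fun h5 => absurd (h4 1 h5).1 (by omega)⟩, fun i hi => (h4 i hi).2⟩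
    rw [Multiset.sum_cons, p.parts_sum]
    by_cases h4 : ∀ i ∈ p.parts, 2 ≤ i ∧ i ≤ m
    · rw [if_pos (h3.2 h4), Multiset.map_congr rfl fun i hi => if_pos (h4 i hi)]
      have h5 : (p.parts.map fun i => (a * b) ^ i).prod = (a * b) ^ (n - m) := by
        conv_rhs => rw [← p.parts_sum]
        exact prod_map_pow_eq_pow_sum _ _
      rw [h5, Nat.add_sub_cancel_left, mul_pow, ← mul_assoc, ← pow_mul, ← pow_add]
      congr 2
      omega
    · rw [if_neg (h3.not.2 h4)]
      push Not at h4
      obtain ⟨i, hi, h5⟩ := h4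
      rw [Multiset.prod_eq_zero, mul_zero]
      exact Multiset.mem_map.2 ⟨i, hi, if_neg fun h6 => absurd h6.2 (by have := h5 h6.1; omega)⟩
  · rfl

/-- With z = a/b and q = abX, ones carry q/z, parts from 2 to j carry q^i, and parts above j carry z
q^i. If there are exactly j ones, the total power of z is the crank. -/
theorem prod_map_crank_weight (a b : R) {j : ℕ} (hj : 1 ≤ j) (s : Multiset ℕ) (hs : ∀ i ∈ s,
    1 ≤ i) :
    ∃ e f : ℕ, (s.map fun i => if i = 1 then b ^ 2 else if i ≤ j then (a * b) ^ i
        else a ^ (i + 1) * b ^ (i - 1)).prod = a ^ e * b ^ f ∧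
      (e : ℤ) = s.sum + Multiset.card (s.filter fun i => j < i) - s.count 1 ∧
      (f : ℤ) = s.sum - Multiset.card (s.filter fun i => j < i) + s.count 1 := by
  induction s using Multiset.induction_on with
  | empty => exact ⟨0, 0, by simp⟩
  | cons i s ih =>
    obtain ⟨e, f, h1, h2, h3⟩ := ih fun i hi => hs i (Multiset.mem_cons_of_mem hi)
    have hi := hs i (Multiset.mem_cons_self i s)
    rw [Multiset.map_cons, Multiset.prod_cons, h1]
    rcases eq_or_ne i 1 with rfl | h4
    · refine ⟨e, f + 2, by rw [if_pos rfl]; ring, ?_, ?_⟩ <;>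
        simp only [Multiset.sum_cons, Multiset.filter_cons, Multiset.count_cons_self,
          show ¬ j < 1 by omega, if_false, zero_add] <;> omega
    · have h5 : (1 : ℕ) ≠ i := h4.symm
      rw [if_neg h4]
      split_ifs with h6
      · refine ⟨e + i, f + i, by ring, ?_, ?_⟩ <;>
          simp only [Multiset.sum_cons, Multiset.filter_cons, Multiset.count_cons_of_ne h5,
            show ¬ j < i by omega, if_false, zero_add] <;> omega
      · refine ⟨e + (i + 1), f + (i - 1), by ring, ?_, ?_⟩ <;>
          simp only [Multiset.sum_cons, Multiset.filter_cons, Multiset.count_cons_of_ne h5,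
            show j < i by omega, if_true, Multiset.card_add, Multiset.card_singleton] <;>
          omega

theorem sum_partition_crank (a b : R) {j : ℕ} (hj : 1 ≤ j) (n : ℕ) :
    ∑ p : n.Partition with p.parts.count 1 = j,
        a ^ (n + crank p).toNat * b ^ (n - crank p).toNat =
      coeff n ((C (b ^ 2) * X) ^ j * weightSeries fun i =>
        if i = 1 then 0 else if i ≤ j then (a * b) ^ i else a ^ (i + 1) * b ^ (i - 1)) := by
  have h := sum_partition_count_one_eq (fun i => if i = 1 then b ^ 2 else
    if i ≤ j then (a * b) ^ i else a ^ (i + 1) * b ^ (i - 1)) j n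
  rw [if_pos rfl] at h
  have hw : Function.update (fun i => if i = 1 then b ^ 2 else
      if i ≤ j then (a * b) ^ i else a ^ (i + 1) * b ^ (i - 1)) 1 0 =
      fun i => if i = 1 then 0 else if i ≤ j then (a * b) ^ i else a ^ (i + 1) * b ^ (i - 1) := by
    ext i
    rcases eq_or_ne i 1 with rfl | hi
    · simp
    · simp [hi]
  rw [hw] at h
  rw [← h]
  refine sum_congr rfl fun p hp => ?_
  have hc : p.parts.count 1 = j := (mem_filter.1 hp).2
  obtain ⟨e, f, h1, h2, h3⟩ := prod_map_crank_weight a b hj p.parts fun i hi => p.parts_pos hi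
  rw [h1, crank, if_neg (by omega), hc]
  rw [p.parts_sum, hc] at h2 h3
  congr 2 <;> omega

end CrankSeries

/-! ### The product formula for the crank -/

section CrankProduct

variable {R : Type*} [CommRing R]

theorem X_pow_dvd_weightSeries_mul_prod_range_sub_one (w : ℕ → R) (N : ℕ) :
    X ^ N ∣ weightSeries w * ∏ r ∈ range N, (1 - C (w (r + 1)) * X ^ (r + 1)) - 1 := by
  have h := X_pow_dvd_weightSeries_mul_prod_sub_one w N
  have e : ∏ i ∈ Icc 1 N, (1 - C (w i) * X ^ i : R⟦X⟧) =
      ∏ r ∈ range N, (1 - C (w (r + 1)) * X ^ (r + 1)) := by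
    rw [range_eq_Ico, prod_Ico_add' (fun i => (1 - C (w i) * X ^ i : R⟦X⟧)) 0 N 1]
    rfl
  rw [← e]
  exact (pow_dvd_pow _ (Nat.le_succ N)).trans h

theorem isUnit_one_sub_of_X_dvd {f : R⟦X⟧} (h : X ∣ f) : IsUnit (1 - f) := by
  rw [isUnit_iff_constantCoeff]
  rw [X_dvd_iff] at h
  simp [h]

/-- The weight of a part `i` in the generating function of the number of parts, with
`z = a / b` and `q = a * b * X`. -/
def zWeight (a b : R) (i : ℕ) : R := a ^ (i + 1) * b ^ (i - 1)

theorem C_zWeight_mul_X_pow (a b : R) (r : ℕ) :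
    C (zWeight a b (r + 1)) * X ^ (r + 1) = (C (a ^ 2) * X) * (C (a * b) * X) ^ r := by
  simp only [zWeight, Nat.add_sub_cancel, map_mul, map_pow]
  ring

/-- The partition generating function `1 / ((1 - q) ⋯ (1 - q ^ j))`. -/
noncomputable def boundedSeries (a b : R) (j : ℕ) : R⟦X⟧ :=
  weightSeries fun i => if i ≤ j then (a * b) ^ i else 0

theorem boundedSeries_zero (a b : R) : boundedSeries a b 0 = 1 := by
  rw [← weightSeries_zero]
  exact weightSeries_congr fun i hi => by rw [if_neg (by omega)]

theorem one_sub_mul_boundedSeries_succ (a b : R) (j : ℕ) :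
    (1 - (C (a * b) * X) ^ (j + 1)) * boundedSeries a b (j + 1) = boundedSeries a b j := by
  have h := weightSeries_mul_one_sub (fun i => if i ≤ j + 1 then (a * b) ^ i else 0)
    (i := j + 1) (by omega)
  rw [if_pos le_rfl, map_pow, ← mul_pow, mul_comm] at h
  rw [boundedSeries, h]
  refine weightSeries_congr fun i hi => ?_
  rcases eq_or_ne i (j + 1) with rfl | h1
  · simp
  · rw [Function.update_of_ne h1]
    split_ifs <;> first | rfl | omega

theorem weightSeries_two_le (a b : R) {m : ℕ} (hm : 1 ≤ m) :
    (weightSeries fun i => if 2 ≤ i ∧ i ≤ m then (a * b) ^ i else 0) =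
      (1 - C (a * b) * X) * boundedSeries a b m := by
  have h := weightSeries_mul_one_sub (fun i => if i ≤ m then (a * b) ^ i else 0) le_rfl
  rw [if_pos hm, pow_one, pow_one, mul_comm] at h
  rw [boundedSeries, h]
  refine weightSeries_congr fun i hi => ?_
  rcases eq_or_ne i 1 with rfl | h1
  · simp
  · rw [Function.update_of_ne h1]
    split_ifs <;> first | rfl | omega

/-- `(z q; q)_j / (q; q)_j`. -/
noncomputable def crankCoeff (a b : R) (j : ℕ) : R⟦X⟧ :=
  boundedSeries a b j * ∏ r ∈ range j, (1 - C (zWeight a b (r + 1)) * X ^ (r + 1))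

theorem crankCoeff_succ (a b : R) (j : ℕ) :
    (1 - (C (a * b) * X) ^ (j + 1)) * crankCoeff a b (j + 1) =
      (1 - (C (a ^ 2) * X) * (C (a * b) * X) ^ j) * crankCoeff a b j := by
  have h := one_sub_mul_boundedSeries_succ a b j
  rw [crankCoeff, crankCoeff, prod_range_succ, C_zWeight_mul_X_pow a b j]
  linear_combination ((∏ r ∈ range j, (1 - C (zWeight a b (r + 1)) * X ^ (r + 1))) *
    (1 - (C (a ^ 2) * X) * (C (a * b) * X) ^ j)) * h

theorem X_dvd_C_mul_X (c : R) : X ∣ C c * X := Dvd.intro_left _ rfl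

/-- In product form: 1/((q)_j (zq^{j+1})_∞) = ((zq)_j/(q)_j) · 1/(zq)_∞. -/
theorem weightSeries_mixed (a b : R) (j : ℕ) :
    (weightSeries fun i => if i ≤ j then (a * b) ^ i else zWeight a b i) =
      crankCoeff a b j * weightSeries (zWeight a b) := by
  induction j with
  | zero =>
    rw [crankCoeff, boundedSeries_zero, range_zero, prod_empty, one_mul, one_mul]
    exact weightSeries_congr fun i hi => by rw [if_neg (by omega)]
  | succ j ih =>
    have h1 := weightSeries_mul_one_sub (fun i => if i ≤ j then (a * b) ^ i else zWeight a b i)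
      (i := j + 1) (by omega)
    have h2 := weightSeries_mul_one_sub (fun i => if i ≤ j + 1 then (a * b) ^ i else zWeight a b i)
      (i := j + 1) (by omega)
    have e : Function.update (fun i => if i ≤ j + 1 then (a * b) ^ i else zWeight a b i) (j + 1) 0 =
        Function.update (fun i => if i ≤ j then (a * b) ^ i else zWeight a b i) (j + 1) 0 := by
      ext i
      rcases eq_or_ne i (j + 1) with rfl | h1
      · simp
      · rw [Function.update_of_ne h1, Function.update_of_ne h1]
        split_ifs <;> first | rfl | omega
    rw [if_neg (by omega)] at h1
    rw [if_pos le_rfl, e, ← h1, ih, C_zWeight_mul_X_pow, map_pow, ← mul_pow] at h2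
    have hu : IsUnit (1 - (C (a * b) * X) ^ (j + 1) : R⟦X⟧) :=
      isUnit_one_sub_of_X_dvd ((X_dvd_C_mul_X _).trans (dvd_pow_self _ (by omega)))
    apply hu.mul_left_cancel
    linear_combination h2 - weightSeries (zWeight a b) * crankCoeff_succ a b j

theorem weightSeries_ones_removed (a b : R) {j : ℕ} (hj : 1 ≤ j) :
    (weightSeries fun i =>
      if i = 1 then 0 else if i ≤ j then (a * b) ^ i else a ^ (i + 1) * b ^ (i - 1)) =
      (1 - C (a * b) * X) * (crankCoeff a b j * weightSeries (zWeight a b)) := by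
  have h := weightSeries_mul_one_sub (fun i => if i ≤ j then (a * b) ^ i else zWeight a b i)
    le_rfl
  rw [if_pos hj, pow_one, pow_one, mul_comm, weightSeries_mixed] at h
  rw [h]
  refine weightSeries_congr fun i hi => ?_
  rcases eq_or_ne i 1 with rfl | h1
  · simp
  · rw [Function.update_of_ne h1, if_neg h1, zWeight]

/-- Partitions are sorted by the number j of ones and, if there are none, by the largest part m,
which is then at least 2 unless n = 0. The term in X is the correction at n = 1. -/
theorem coeff_crankSeries_eq (a b : R) {n N : ℕ} (hn : n < N) :
    coeff n (crankSeries a b) =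
      coeff n (1 + (C (a ^ 2) - C (a * b)) * X
        + ∑ m ∈ Ico 2 N, (C (a ^ 2) * X) ^ m * ((1 - C (a * b) * X) * boundedSeries a b m)
        + ∑ j ∈ Ico 1 N, (C (b ^ 2) * X) ^ j *
          ((1 - C (a * b) * X) * (crankCoeff a b j * weightSeries (zWeight a b)))) := by
  have h0 : coeff n (1 + (C (a ^ 2) - C (a * b)) * X : R⟦X⟧) =
      (if n = 0 then 1 else 0) + if n = 1 then a ^ 2 - a * b else 0 := by
    rw [map_add, coeff_one, ← map_sub, coeff_C_mul, coeff_X, mul_ite, mul_one, mul_zero]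
  rw [map_add, map_add, h0, coeff_crankSeries, map_sum, map_sum]
  have h1 : ∀ j ∈ Ico 1 N, coeff n ((C (b ^ 2) * X) ^ j *
      ((1 - C (a * b) * X) * (crankCoeff a b j * weightSeries (zWeight a b)))) =
      ∑ p : n.Partition with p.parts.count 1 = j,
        a ^ (n + crank p).toNat * b ^ (n - crank p).toNat := fun j hj => by
    rw [sum_partition_crank a b (mem_Ico.1 hj).1, weightSeries_ones_removed a b (mem_Ico.1 hj).1]
  have h2 : ∀ m ∈ Ico 2 N, coeff n ((C (a ^ 2) * X) ^ m *
      ((1 - C (a * b) * X) * boundedSeries a b m)) =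
      ∑ p : n.Partition with p.parts.count 1 = 0 ∧ largestPart p = m,
        a ^ (n + crank p).toNat * b ^ (n - crank p).toNat := fun m hm => by
    have hm' := (mem_Ico.1 hm).1
    rw [← weightSeries_two_le a b (by omega), ← sum_partition_largestPart_eq a b n hm']
    refine sum_congr rfl fun p hp => ?_
    obtain ⟨h3, h4⟩ := (mem_filter.1 hp).2
    have h5 := largestPart_le p
    rw [crank, if_pos h3, h4]
    congr 2
    omega
  rw [sum_congr rfl h1, sum_congr rfl h2]
  have h3 : ∑ p : n.Partition, a ^ (n + crank p).toNat * b ^ (n - crank p).toNat =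
      ∑ j ∈ range N, ∑ p : n.Partition with p.parts.count 1 = j,
        a ^ (n + crank p).toNat * b ^ (n - crank p).toNat := by
    refine (sum_fiberwise_of_maps_to (fun p _ => mem_range.2 ?_) _).symm
    have := Multiset.count_le_card 1 p.parts
    have := card_parts_le p
    omega
  have h4 : ∑ p : n.Partition with p.parts.count 1 = 0,
        a ^ (n + crank p).toNat * b ^ (n - crank p).toNat =
      (if n = 0 then 1 else 0) + ∑ m ∈ Ico 2 N,
        ∑ p : n.Partition with p.parts.count 1 = 0 ∧ largestPart p = m,
          a ^ (n + crank p).toNat * b ^ (n - crank p).toNat := by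
    rcases eq_or_ne n 0 with rfl | hn0
    · have h5 : ∑ m ∈ Ico 2 N, ∑ p : Nat.Partition 0 with p.parts.count 1 = 0 ∧ largestPart p = m,
          a ^ ((0 : ℕ) + crank p).toNat * b ^ ((0 : ℕ) - crank p).toNat = 0 := by
        refine sum_eq_zero fun m hm => sum_eq_zero fun p hp => ?_
        have h6 := largestPart_le p
        rw [(mem_filter.1 hp).2.2] at h6
        have := (mem_Ico.1 hm).1
        omega
      rw [h5]
      simp [crank, largestPart, filter_true_of_mem]
    · rw [if_neg hn0, zero_add]
      rw [← sum_fiberwise_of_maps_to (t := Ico 2 N) (g := fun p => largestPart p)]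
      · simp only [filter_filter]
      · intro p hp
        rw [mem_Ico]
        have h5 := largestPart_mem p hn0
        have h6 := largestPart_le p
        have h7 := p.parts_pos h5
        have h8 : largestPart p ≠ 1 := fun h8 => by
          rw [h8] at h5
          exact Multiset.count_eq_zero.1 (mem_filter.1 hp).2 h5
        omega
  rw [h3, range_eq_Ico, sum_eq_sum_Ico_succ_bot (by omega), h4]
  ring

/-- The generating function of the crank (Andrews and Garvan). -/
theorem crankSeries_mul (a b : R) :
    crankSeries a b * weightSeries (fun i => (a * b) ^ i) =
      weightSeries (zWeight a b) * weightSeries (zWeight b a) := by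
  refine eq_of_forall_X_pow_dvd_sub fun N' => ?_
  -- The terms m = 0 and m = 1 are split off below, which needs N ≥ 2.
  set N := N' + 2 with hN
  refine (pow_dvd_pow X (by omega : N' ≤ N)).trans ?_
  set q : R⟦X⟧ := C (a * b) * X with hq
  set s : R⟦X⟧ := C (a ^ 2) * X with hs
  set t : R⟦X⟧ := C (b ^ 2) * X with ht
  set E := weightSeries (zWeight a b)
  set E' := weightSeries (zWeight b a)
  set P := weightSeries (fun i => (a * b) ^ i)
  -- The amended values at n = 1 are what completes the first sum: its terms m = 0, 1 give (1 - q)(1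
  -- + s/(1 - q)) = 1 + s - q.
  have h1 : X ^ N ∣ crankSeries a b - (1 - q) * (∑ m ∈ range N, boundedSeries a b m * s ^ m
      + E * (∑ j ∈ range N, crankCoeff a b j * t ^ j - 1)) := by
    rw [X_pow_dvd_iff]
    intro n hn
    rw [map_sub, coeff_crankSeries_eq a b hn, ← map_sub]
    refine (congrArg (coeff n) ?_).trans (map_zero (coeff n))
    rw [range_eq_Ico, sum_eq_sum_Ico_succ_bot (a := 0) (by omega)
        (fun m => boundedSeries a b m * s ^ m),
      sum_eq_sum_Ico_succ_bot (a := 0 + 1) (by omega) (fun m => boundedSeries a b m * s ^ m),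
      sum_eq_sum_Ico_succ_bot (a := 0) (b := N) (by omega) (fun j => crankCoeff a b j * t ^ j)]
    have h2 := one_sub_mul_boundedSeries_succ a b 0
    rw [boundedSeries_zero, zero_add, pow_one] at h2
    have h3 : ∑ m ∈ Ico 2 N, s ^ m * ((1 - q) * boundedSeries a b m) =
        (1 - q) * ∑ m ∈ Ico 2 N, boundedSeries a b m * s ^ m := by
      rw [mul_sum]
      exact sum_congr rfl fun _ _ => by ring
    have h4 : ∑ j ∈ Ico 1 N, t ^ j * ((1 - q) * (crankCoeff a b j * E)) =
        (1 - q) * (E * ∑ j ∈ Ico 1 N, crankCoeff a b j * t ^ j) := by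
      rw [mul_sum, mul_sum]
      exact sum_congr rfl fun _ _ => by ring
    have h5 : crankCoeff a b 0 = 1 := by simp [crankCoeff, boundedSeries_zero]
    rw [← hs, ← hq, ← ht, h3, h4, h5, boundedSeries_zero]
    simp only [zero_add, pow_zero, mul_one, Nat.reduceAdd]
    linear_combination -s * h2
  -- Σ s^m/(q)_m = 1/(s)_∞, which is E and cancels the subtracted term j = 0 of the second sum.
  have h2 := q_binomial (α := 0) (boundedSeries_zero a b)
    (fun j => by rw [zero_mul, sub_zero, one_mul]; exact one_sub_mul_boundedSeries_succ a b j)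
    (X_dvd_C_mul_X (a * b)) (X_dvd_C_mul_X (a ^ 2)) N
  -- Here α = s = zq and st = q², so the sum is (q²; q)_∞/(t)_∞; the factor 1 - q completes the
  -- numerator to (q)_∞ = 1/P.
  have h3 := q_binomial (c := crankCoeff a b) (by simp [crankCoeff, boundedSeries_zero])
    (crankCoeff_succ a b) (X_dvd_C_mul_X (a * b)) (X_dvd_C_mul_X (b ^ 2)) N
  have h4 := X_pow_dvd_weightSeries_mul_prod_range_sub_one (zWeight a b) N
  have h5 := X_pow_dvd_weightSeries_mul_prod_range_sub_one (zWeight b a) N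
  have h6 := X_pow_dvd_weightSeries_mul_prod_range_sub_one (fun i => (a * b) ^ i) (N + 1)
  replace h6 := (pow_dvd_pow X (by omega : N ≤ N + 1)).trans h6
  simp only [C_zWeight_mul_X_pow] at h4 h5
  rw [mul_comm b a] at h5
  simp only [map_pow, ← mul_pow, prod_range_succ'] at h6
  simp only [zero_mul, sub_zero, prod_const_one] at h2
  have e : ∀ r, 1 - C (a ^ 2) * X * (C (b ^ 2) * X) * (C (a * b) * X) ^ r =
      1 - (C (a * b) * X) ^ (r + 1 + 1) := fun r => by
    simp only [map_mul, map_pow]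
    ring
  simp only [e] at h3
  simp only [map_pow] at h2 h3 h4 h5
  simp only [← map_pow, zero_add, pow_one, ← hq, ← hs, ← ht] at h2 h3 h4 h5 h6
  obtain ⟨k1, h1⟩ := h1
  obtain ⟨k2, h2⟩ := h2
  obtain ⟨k3, h3⟩ := h3
  obtain ⟨k4, h4⟩ := h4
  obtain ⟨k5, h5⟩ := h5
  obtain ⟨k6, h6⟩ := h6
  generalize (∏ r ∈ range N, (1 - s * q ^ r)) = A at *
  generalize (∏ r ∈ range N, (1 - t * q ^ r)) = B at *
  generalize (∏ r ∈ range N, (1 - q ^ (r + 1 + 1))) = Q at *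
  generalize (∑ m ∈ range N, boundedSeries a b m * s ^ m) = S at *
  generalize (∑ j ∈ range N, crankCoeff a b j * t ^ j) = T at *
  generalize crankSeries a b = K at *
  exact ⟨P * k1 + P * (1 - q) * (-S * k4 + E * k2) + P * (1 - q) * E * E' * k3
    - P * (1 - q) * E * T * k5 + E * E' * k6, by
      linear_combination P * h1 + P * (1 - q) * (-S * h4 + E * h2) + P * (1 - q) * E * E' * h3
        - P * (1 - q) * E * T * h5 + E * E' * h6⟩

end CrankProduct

/-! ### Logarithmic derivatives of partition series -/

section WeightedDerivation

variable {R : Type*} [CommRing R]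

/-- The derivation of `R⟦X⟧` that acts as `δ` on the coefficients and as `c` on `X`. -/
noncomputable def weightedDerivation (δ : R →+ R) (c : ℤ) : R⟦X⟧ →+ R⟦X⟧ :=
  AddMonoidHom.mk' (fun f => mk fun n => δ (coeff n f) + c * n * coeff n f) fun f g => by
    ext n; simp only [map_add, coeff_mk]; ring

theorem coeff_weightedDerivation (δ : R →+ R) (c : ℤ) (f : R⟦X⟧) (n : ℕ) :
    coeff n (weightedDerivation δ c f) = δ (coeff n f) + c * n * coeff n f :=
  coeff_mk n fun n => δ (coeff n f) + c * n * coeff n f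

theorem weightedDerivation_mul {δ : R →+ R} (hδ : ∀ a b, δ (a * b) = δ a * b + a * δ b)
    (c : ℤ) (f g : R⟦X⟧) : weightedDerivation δ c (f * g) =
      weightedDerivation δ c f * g + f * weightedDerivation δ c g := by
  ext n
  rw [map_add, coeff_weightedDerivation, coeff_mul, coeff_mul, coeff_mul, map_sum, mul_sum,
    ← sum_add_distrib, ← sum_add_distrib]
  refine sum_congr rfl fun x hx => ?_
  rw [coeff_weightedDerivation, coeff_weightedDerivation, hδ,
    ← mem_antidiagonal.1 hx]
  push_cast
  ring

theorem weightedDerivation_one {δ : R →+ R} (hδ : ∀ a b, δ (a * b) = δ a * b + a * δ b) (c : ℤ) :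
    weightedDerivation δ c 1 = 0 := by
  have h := weightedDerivation_mul hδ c 1 1
  rw [mul_one, mul_one, one_mul] at h
  linear_combination -h

theorem weightedDerivation_C_mul_X_pow (δ : R →+ R) (c : ℤ) {w e : R} {i : ℕ}
    (h : δ w + c * i * w = e * w) :
    weightedDerivation δ c (C w * X ^ i) = C e * (C w * X ^ i) := by
  ext n
  rw [coeff_weightedDerivation, coeff_C_mul, coeff_C_mul, coeff_C_mul, coeff_X_pow]
  split_ifs with hn
  · subst hn
    simpa using h
  · simp

/-- The series `∑ e i * w i ^ k * X ^ (i * k)`, over all `i, k ≥ 1`. -/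
noncomputable def logSeries (e w : ℕ → R) : R⟦X⟧ :=
  mk fun n => ∑ i ∈ n.divisors, e i * w i ^ (n / i)

theorem geometric_mul_one_sub (w : R) {i : ℕ} (hi : 1 ≤ i) :
    (mk fun n => if i ∈ n.divisors then w ^ (n / i) else 0) * (1 - C w * X ^ i) = C w * X ^ i := by
  ext n
  rw [mul_sub, mul_one, mul_comm _ (C w * X ^ i), map_sub, coeff_weight_mul, coeff_mk, coeff_C_mul,
    coeff_X_pow, coeff_mk]
  simp only [Nat.mem_divisors]
  rcases lt_trichotomy n i with h | rfl | h
  · have h1 : ¬ (i ∣ n ∧ n ≠ 0) := fun h1 => h1.2 (Nat.eq_zero_of_dvd_of_lt h1.1 h)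
    rw [if_neg (by omega : ¬ i ≤ n), if_neg (by omega : n ≠ i), if_neg h1]
    simp
  · simp [Nat.div_self hi, show n ≠ 0 by omega]
  · obtain ⟨m, rfl⟩ : ∃ m, n = m + i := ⟨n - i, by omega⟩
    rw [if_pos (by omega : i ≤ m + i), if_neg (by omega : m + i ≠ i), Nat.add_sub_cancel]
    have h1 : i ∣ m + i ↔ i ∣ m := Nat.dvd_add_self_right
    have h2 : m ≠ 0 := by omega
    simp only [h1, h2, ne_eq, not_false_eq_true, and_true, show m + i ≠ 0 by omega]
    split_ifs with h3
    · rw [Nat.add_div_right _ hi, pow_succ]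
      ring
    · simp

/-- Induction on the set of allowed parts: differentiate W · (1 - w X^i) = W₀, where W₀ omits the
part i, and cancel the unit 1 - w X^i. -/
theorem weightedDerivation_weightSeries_finset {δ : R →+ R}
    (hδ : ∀ a b, δ (a * b) = δ a * b + a * δ b) (c : ℤ) {w e : ℕ → R}
    (h : ∀ i, 1 ≤ i → δ (w i) + c * i * w i = e i * w i) (s : Finset ℕ) (hs : ∀ i ∈ s, 1 ≤ i) :
    weightedDerivation δ c (weightSeries fun i => if i ∈ s then w i else 0) =
      (∑ i ∈ s, C (e i) * mk fun n => if i ∈ n.divisors then w i ^ (n / i) else 0) *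
        weightSeries fun i => if i ∈ s then w i else 0 := by
  induction s using Finset.induction_on with
  | empty => simp [weightSeries_zero, weightedDerivation_one hδ]
  | insert i s his ih =>
    have hi := hs i (mem_insert_self _ _)
    have h1 := weightSeries_mul_one_sub (fun j => if j ∈ insert i s then w j else 0) hi
    have h2 : Function.update (fun j => if j ∈ insert i s then w j else 0) i 0 =
        fun j => if j ∈ s then w j else 0 := by
      ext j
      rcases eq_or_ne j i with rfl | hj
      · simp [his]
      · simp [hj]
    rw [h2] at h1
    simp only [mem_insert_self, if_true] at h1
    have h3 := congrArg (weightedDerivation δ c) h1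
    rw [ih fun j hj => hs j (mem_insert_of_mem hj), ← h1, weightedDerivation_mul hδ, map_sub,
      weightedDerivation_one hδ, weightedDerivation_C_mul_X_pow δ c (h i hi)] at h3
    have hu : IsUnit (1 - C (w i) * X ^ i : R⟦X⟧) :=
      isUnit_one_sub_of_X_dvd (Dvd.dvd.mul_left (dvd_pow_self _ (by omega)) _)
    apply hu.mul_right_cancel
    rw [sum_insert his]
    linear_combination h3 - (weightSeries fun j => if j ∈ insert i s then w j else 0) * C (e i) *
      geometric_mul_one_sub (w i) hi

theorem coeff_weightSeries_truncate (w : ℕ → R) {n N : ℕ} (h : n ≤ N) :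
    coeff n (weightSeries w) =
      coeff n (weightSeries fun i => if i ∈ Icc 1 N then w i else 0) := by
  rw [coeff_weightSeries, coeff_weightSeries]
  refine sum_congr rfl fun p _ => congrArg _ (Multiset.map_congr rfl fun i hi => ?_)
  rw [if_pos]
  exact mem_Icc.2 ⟨p.parts_pos hi, (Nat.Partition.le_of_mem_parts hi).trans h⟩

/-- The logarithmic derivative of a generating function of partitions. -/
theorem weightedDerivation_weightSeries {δ : R →+ R}
    (hδ : ∀ a b, δ (a * b) = δ a * b + a * δ b) (c : ℤ) {w e : ℕ → R}
    (h : ∀ i, 1 ≤ i → δ (w i) + c * i * w i = e i * w i) :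
    weightedDerivation δ c (weightSeries w) = logSeries e w * weightSeries w := by
  ext n
  have h1 := congrArg (coeff n)
    (weightedDerivation_weightSeries_finset hδ c h (Icc 1 n) fun i hi => (mem_Icc.1 hi).1)
  rw [coeff_weightedDerivation, ← coeff_weightSeries_truncate w le_rfl] at h1
  rw [coeff_weightedDerivation, h1, coeff_mul, coeff_mul]
  refine sum_congr rfl fun x hx => ?_
  have hx' := mem_antidiagonal.1 hx
  rw [← coeff_weightSeries_truncate w (by omega : x.2 ≤ n), map_sum, logSeries, coeff_mk]
  congr 1
  simp only [coeff_C_mul, coeff_mk, mul_ite, mul_zero]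
  rw [← sum_filter]
  refine sum_congr ?_ fun _ _ => rfl
  ext i
  rw [mem_filter, mem_Icc, and_iff_right_iff_imp]
  intro hi
  have h2 := Nat.divisor_le hi
  have h3 := Nat.pos_of_mem_divisors hi
  omega

theorem isUnit_weightSeries (w : ℕ → R) : IsUnit (weightSeries w) := by
  rw [isUnit_iff_constantCoeff, ← coeff_zero_eq_constantCoeff_apply, coeff_weightSeries]
  simp

theorem iterate_derivation_mul {A : Type*} [CommRing A] {D : A →+ A}
    (hD : ∀ f g, D (f * g) = D f * g + f * D g) (n : ℕ) (f g : A) :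
    D^[n] (f * g) = ∑ x ∈ antidiagonal n, n.choose x.1 • (D^[x.1] f * D^[x.2] g) := by
  induction n with
  | zero => simp
  | succ n ih =>
    rw [Function.iterate_succ_apply', ih,
      sum_antidiagonal_choose_succ_nsmul (fun i j => D^[i] f * D^[j] g), map_sum,
      ← sum_add_distrib]
    refine sum_congr rfl fun x hx => ?_
    rw [map_nsmul, hD, Function.iterate_succ_apply', Function.iterate_succ_apply', smul_add,
      add_comm, ← mem_antidiagonal.1 hx, Nat.choose_symm_add]

end WeightedDerivation

/-! ### Moments of the crank and of C³/P² -/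

section CrankMoments

/-- The derivation `u d/du` of polynomials in `u`. -/
noncomputable def eulerDerivation : Polynomial ℤ →+ Polynomial ℤ :=
  (AddMonoidHom.mulLeft Polynomial.X).comp Polynomial.derivative.toAddMonoidHom

theorem eulerDerivation_apply (f : Polynomial ℤ) :
    eulerDerivation f = Polynomial.X * Polynomial.derivative f := rfl

theorem eulerDerivation_mul (f g : Polynomial ℤ) :
    eulerDerivation (f * g) = eulerDerivation f * g + f * eulerDerivation g := by
  simp only [eulerDerivation_apply, Polynomial.derivative_mul]
  ring

theorem eulerDerivation_X_pow (k : ℕ) :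
    eulerDerivation (Polynomial.X ^ k) = (k : Polynomial ℤ) * Polynomial.X ^ k := by
  rw [eulerDerivation_apply, Polynomial.derivative_X_pow]
  rcases k with _ | k
  · simp
  · simp
    ring

/-- The derivation `z d/dz`, for series in `u = z` and `X = q / z`. -/
noncomputable def zDerivation : (Polynomial ℤ)⟦X⟧ →+ (Polynomial ℤ)⟦X⟧ :=
  weightedDerivation eulerDerivation (-1)

theorem coeff_zDerivation (f : (Polynomial ℤ)⟦X⟧) (n : ℕ) :
    coeff n (zDerivation f) =
      Polynomial.X * Polynomial.derivative (coeff n f) - (n : Polynomial ℤ) * coeff n f := by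
  rw [zDerivation, coeff_weightedDerivation, eulerDerivation_apply]
  push_cast
  ring

theorem zDerivation_mul (f g : (Polynomial ℤ)⟦X⟧) :
    zDerivation (f * g) = zDerivation f * g + f * zDerivation g :=
  weightedDerivation_mul eulerDerivation_mul _ f g

/-- The `a`-th moment in `z`, at `z = 1`. -/
noncomputable def zMoment (f : (Polynomial ℤ)⟦X⟧) (a : ℕ) : ℤ⟦X⟧ :=
  PowerSeries.map (Polynomial.evalRingHom 1) (zDerivation^[a] f)

/-- As u = z and X = q/z, the monomial u^m X^n is z^(m-n) q^n. -/
theorem coeff_iterate_zDerivation {ι : Type*} {f : (Polynomial ℤ)⟦X⟧} {n : ℕ} {s : Finset ι}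
    {c : ι → ℤ} {m : ι → ℕ}
    (h : coeff n f = ∑ x ∈ s, Polynomial.C (c x) * Polynomial.X ^ m x) (a : ℕ) :
    coeff n (zDerivation^[a] f) =
      ∑ x ∈ s, Polynomial.C (c x * ((m x : ℤ) - n) ^ a) * Polynomial.X ^ m x := by
  induction a with
  | zero => simpa using h
  | succ a ih =>
    rw [Function.iterate_succ_apply', coeff_zDerivation, ih, Polynomial.derivative_sum, mul_sum,
      mul_sum, ← sum_sub_distrib]
    refine sum_congr rfl fun x _ => ?_
    rw [Polynomial.derivative_C_mul_X_pow]
    rcases Nat.eq_zero_or_pos (m x) with h0 | h0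
    · rw [h0]
      simp
      ring
    · obtain ⟨k, hk⟩ : ∃ k, m x = k + 1 := ⟨m x - 1, by omega⟩
      rw [hk, Nat.add_sub_cancel]
      simp
      ring

theorem coeff_zMoment {ι : Type*} {f : (Polynomial ℤ)⟦X⟧} {n : ℕ} {s : Finset ι}
    {c : ι → ℤ} {m : ι → ℕ}
    (h : coeff n f = ∑ x ∈ s, Polynomial.C (c x) * Polynomial.X ^ m x) (a : ℕ) :
    coeff n (zMoment f a) = ∑ x ∈ s, c x * ((m x : ℤ) - n) ^ a := by
  rw [zMoment, coeff_map, coeff_iterate_zDerivation h, map_sum]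
  exact sum_congr rfl fun x _ => by simp

theorem zMoment_add (f g : (Polynomial ℤ)⟦X⟧) (a : ℕ) :
    zMoment (f + g) a = zMoment f a + zMoment g a := by
  rw [zMoment, iterate_map_add, map_add]; rfl

theorem zMoment_mul (f g : (Polynomial ℤ)⟦X⟧) (a : ℕ) :
    zMoment (f * g) a =
      ∑ x ∈ antidiagonal a, (a.choose x.1 : ℤ⟦X⟧) * (zMoment f x.1 * zMoment g x.2) := by
  rw [zMoment, iterate_derivation_mul zDerivation_mul, map_sum]
  exact sum_congr rfl fun x _ => by rw [map_nsmul, map_mul, nsmul_eq_mul]; rfl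

/-- The logarithmic derivative of the generating function of the crank. -/
noncomputable def crankLog : (Polynomial ℤ)⟦X⟧ :=
  logSeries (fun _ => 1) (zWeight Polynomial.X 1) + logSeries (fun _ => -1) (zWeight 1 Polynomial.X)

/-- The series is Σ (z^k - z^{-k}) q^{ik}; the two halves cancel in even order and agree in odd
order. -/
theorem zMoment_crankLog (a : ℕ) :
    zMoment crankLog a = if Even a then 0 else 2 * divisorSeries a := by
  have h1 : ∀ n, coeff n (logSeries (fun _ => 1) (zWeight (Polynomial.X : Polynomial ℤ) 1)) =
      ∑ i ∈ n.divisors, Polynomial.C 1 * Polynomial.X ^ (n + n / i) := fun n => by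
    rw [logSeries, coeff_mk]
    refine sum_congr rfl fun i hi => ?_
    rw [zWeight, one_pow, mul_one, ← pow_mul, add_mul,
      Nat.mul_div_cancel' (Nat.dvd_of_mem_divisors hi), Polynomial.C_1, one_mul, one_mul, one_mul]
  have h2 : ∀ n, coeff n (logSeries (fun _ => -1) (zWeight 1 (Polynomial.X : Polynomial ℤ))) =
      ∑ i ∈ n.divisors, Polynomial.C (-1) * Polynomial.X ^ (n - n / i) := fun n => by
    rw [logSeries, coeff_mk]
    refine sum_congr rfl fun i hi => ?_
    rw [zWeight, one_pow, one_mul, ← pow_mul, Nat.sub_mul, one_mul,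
      Nat.mul_div_cancel' (Nat.dvd_of_mem_divisors hi), Polynomial.C_neg, Polynomial.C_1]
  ext n
  rw [crankLog, zMoment_add, map_add, coeff_zMoment (h1 n), coeff_zMoment (h2 n),
    ← sum_add_distrib]
  have h3 : ∀ i ∈ n.divisors, (1 : ℤ) * (((n + n / i : ℕ) : ℤ) - n) ^ a
      + -1 * (((n - n / i : ℕ) : ℤ) - n) ^ a =
      (1 - (-1) ^ a) * ((n / i : ℕ) : ℤ) ^ a := fun i _ => by
    rw [Nat.cast_sub (Nat.div_le_self n i), sub_mul, ← mul_pow]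
    push_cast
    ring
  rw [sum_congr rfl h3, ← mul_sum, Nat.sum_div_divisors n fun d => (d : ℤ) ^ a]
  split_ifs with ha
  · simp [ha.neg_one_pow]
  · rw [Nat.not_even_iff_odd] at ha
    rw [ha.neg_one_pow, coeff_ofNat_mul, divisorSeries, coeff_mk]
    norm_num

theorem sum_range_two_mul {M : Type*} [AddCommMonoid M] (f : ℕ → M) (n : ℕ) :
    ∑ i ∈ range (2 * n), f i = ∑ j ∈ range n, (f (2 * j) + f (2 * j + 1)) := by
  induction n with
  | zero => simp
  | succ n ih => rw [mul_add, sum_range_succ, sum_range_succ, ih, sum_range_succ, add_assoc]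

/-- The recursion for the even moments of the powers of the generating function of the crank. -/
theorem zMoment_even_succ {f : (Polynomial ℤ)⟦X⟧} {κ : ℕ} (hf : zDerivation f = κ • (crankLog * f))
    (t : ℕ) :
    zMoment f (2 * (t + 1)) = ∑ j ∈ range (t + 1), ((2 * κ * (2 * t + 1).choose (2 * j + 1) : ℕ) :
      ℤ⟦X⟧) * (divisorSeries (2 * j + 1) * zMoment f (2 * (t - j))) := by
  have h1 : zMoment f (2 * (t + 1)) = κ • zMoment (crankLog * f) (2 * t + 1) := by
    rw [zMoment, show 2 * (t + 1) = 2 * t + 1 + 1 by ring, Function.iterate_succ_apply, hf,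
      iterate_map_nsmul, map_nsmul]
    rfl
  -- Only odd moments of `crankLog` survive in Leibniz's formula, so the indices are paired as 2j,
  -- 2j + 1.
  rw [h1, zMoment_mul, Nat.sum_antidiagonal_eq_sum_range_succ_mk,
    show (2 * t + 1).succ = 2 * (t + 1) by omega, sum_range_two_mul, nsmul_eq_mul, mul_sum]
  refine sum_congr rfl fun j _ => ?_
  rw [zMoment_crankLog, zMoment_crankLog, if_pos (even_two_mul j),
    if_neg (Nat.not_even_iff_odd.2 (odd_two_mul_add_one j)),
    show 2 * t + 1 - (2 * j + 1) = 2 * (t - j) by omega]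
  push_cast
  ring

/-- The generating function of the number of partitions. -/
noncomputable def partitionSeries : ℤ⟦X⟧ := weightSeries fun _ => 1

theorem theta_partitionSeries : theta partitionSeries = divisorSeries 1 * partitionSeries := by
  have h := weightedDerivation_weightSeries (δ := (0 : ℤ →+ ℤ)) (by simp) 1 (w := fun _ => 1)
    (e := fun i => i) fun i _ => by simp
  have h1 : logSeries (fun i => (i : ℤ)) (fun _ => 1) = divisorSeries 1 := by
    ext n
    simp [logSeries, divisorSeries]
  rw [partitionSeries, ← h1, ← h]
  ext n
  rw [coeff_theta, coeff_weightedDerivation]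
  simp

theorem map_weightSeries_eq_partitionSeries {w : ℕ → Polynomial ℤ} (h : ∀ i, (w i).eval 1 = 1) :
    PowerSeries.map (Polynomial.evalRingHom 1) (weightSeries w) = partitionSeries := by
  rw [map_weightSeries, partitionSeries]
  exact weightSeries_congr fun i _ => h i

/-- The generating function `∑ M(k, n) z ^ k q ^ n` in terms of `z` and `X = q / z`. -/
noncomputable def crankGF : (Polynomial ℤ)⟦X⟧ := crankSeries Polynomial.X 1

/-- The generating function `∑ p(n) q ^ n` in terms of `z` and `X = q / z`. -/
noncomputable def partitionGF : (Polynomial ℤ)⟦X⟧ := weightSeries fun i => Polynomial.X ^ i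

theorem crankGF_mul_partitionGF : crankGF * partitionGF =
    weightSeries (zWeight Polynomial.X 1) * weightSeries (zWeight 1 Polynomial.X) := by
  have h := crankSeries_mul (Polynomial.X : Polynomial ℤ) 1
  rwa [mul_one] at h

/-- A part i carries (uX)^i = q^i, which does not involve z. -/
theorem zDerivation_partitionGF : zDerivation partitionGF = 0 := by
  have h := weightedDerivation_weightSeries eulerDerivation_mul (-1) (w :=
      fun i => Polynomial.X ^ i) (e := fun _ => 0) fun i _ => by
      simp [eulerDerivation_X_pow]
  rw [zDerivation, partitionGF, h]
  have h1 : logSeries (fun _ => 0) (fun i => (Polynomial.X ^ i : Polynomial ℤ)) = 0 := by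
    ext n
    simp [logSeries]
  rw [h1, zero_mul]

theorem zDerivation_crankGF : zDerivation crankGF = 1 • (crankLog * crankGF) := by
  have h1 := weightedDerivation_weightSeries eulerDerivation_mul (-1) (w :=
      zWeight Polynomial.X 1) (e := fun _ => 1) fun i _ => by
      simp [zWeight, eulerDerivation_X_pow]
      ring
  have h2 := weightedDerivation_weightSeries eulerDerivation_mul (-1) (w :=
      zWeight 1 Polynomial.X) (e := fun _ => -1) fun i hi => by
      obtain ⟨k, rfl⟩ : ∃ k, i = k + 1 := ⟨i - 1, by omega⟩
      simp [zWeight, eulerDerivation_X_pow]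
      ring
  have h3 := congrArg zDerivation crankGF_mul_partitionGF
  rw [zDerivation_mul, zDerivation_mul, zDerivation_partitionGF] at h3
  change weightedDerivation _ _ _ * _ + _ =
    weightedDerivation _ _ _ * _ + _ * weightedDerivation _ _ _ at h3
  rw [h1, h2] at h3
  apply (isUnit_weightSeries fun i => (Polynomial.X ^ i : Polynomial ℤ)).mul_right_cancel
  change zDerivation crankGF * partitionGF = _ * partitionGF
  change zDerivation crankGF * partitionGF + _ = _ at h3
  rw [one_smul, crankLog]
  linear_combination h3 - (logSeries (fun _ => 1) (zWeight Polynomial.X 1)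
    + logSeries (fun _ => -1) (zWeight 1 Polynomial.X)) * crankGF_mul_partitionGF

/-- The cube of the generating function of the crank over the square of that of the partitions. -/
noncomputable def crankCubeGF : (Polynomial ℤ)⟦X⟧ := crankGF ^ 3 * Ring.inverse partitionGF ^ 2

theorem crankCubeGF_mul : crankCubeGF * partitionGF ^ 2 = crankGF ^ 3 := by
  have h := Ring.inverse_mul_cancel partitionGF (isUnit_weightSeries _)
  rw [crankCubeGF]
  linear_combination crankGF ^ 3 * (Ring.inverse partitionGF * partitionGF + 1) * h

theorem zDerivation_crankCubeGF : zDerivation crankCubeGF = 3 • (crankLog * crankCubeGF) := by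
  have h := congrArg zDerivation crankCubeGF_mul
  simp only [pow_succ, pow_zero, one_mul, zDerivation_mul, zDerivation_partitionGF,
    zDerivation_crankGF] at h
  apply ((isUnit_weightSeries fun i => (Polynomial.X ^ i : Polynomial ℤ)).pow 2).mul_right_cancel
  change _ * partitionGF ^ 2 = _ * partitionGF ^ 2
  rw [one_smul] at h
  rw [nsmul_eq_mul]
  push_cast
  linear_combination h - 3 * crankLog * crankCubeGF_mul

theorem isUnit_partitionSeries : IsUnit partitionSeries := isUnit_weightSeries _

theorem zMoment_crankGF_zero : zMoment crankGF 0 = partitionSeries := by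
  have h := congrArg (PowerSeries.map (Polynomial.evalRingHom 1)) crankGF_mul_partitionGF
  rw [map_mul, map_mul, partitionGF, map_weightSeries_eq_partitionSeries fun i => by simp,
    map_weightSeries_eq_partitionSeries fun i => by simp [zWeight],
    map_weightSeries_eq_partitionSeries fun i => by simp [zWeight]] at h
  exact isUnit_partitionSeries.mul_right_cancel h

theorem zMoment_crankCubeGF_zero : zMoment crankCubeGF 0 = partitionSeries := by
  have h := congrArg (PowerSeries.map (Polynomial.evalRingHom 1)) crankCubeGF_mul
  rw [map_mul, map_pow, map_pow, partitionGF,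
    map_weightSeries_eq_partitionSeries fun i => by simp] at h
  change zMoment crankCubeGF 0 * _ = zMoment crankGF 0 ^ 3 at h
  rw [zMoment_crankGF_zero] at h
  refine (isUnit_partitionSeries.pow 2).mul_right_cancel (h.trans (by ring))

theorem crankCount_eq_zero {k : ℤ} {n : ℕ} (h : k ∉ Icc (-(n : ℤ)) n) : crankCount k n = 0 := by
  rw [mem_Icc] at h
  rw [crankCount]
  split_ifs with h1 h2 h3
  · omega
  · omega
  · rfl
  · rw [Int.natCast_eq_zero, card_eq_zero, filter_eq_empty_iff]
    rintro p - rfl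
    exact h (abs_crank_le p)

theorem coeff_crankGF (n : ℕ) : coeff n crankGF = ∑ k ∈ Icc (-(n : ℤ)) n,
    Polynomial.C (crankCount k n) * Polynomial.X ^ (n + k).toNat := by
  rw [crankGF, crankSeries, coeff_mk]
  exact sum_congr rfl fun k _ => by simp

theorem zMoment_crankGF (a : ℕ) : zMoment crankGF a = mk (crankMoment a) := by
  ext n
  rw [coeff_zMoment (coeff_crankGF n), coeff_mk, crankMoment,
    finsum_eq_sum_of_support_subset (s := Icc (-(n : ℤ)) n)]
  · refine sum_congr rfl fun k hk => ?_
    rw [mem_Icc] at hk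
    rw [Int.toNat_of_nonneg (by omega), mul_comm]
    congr 2
    ring
  · intro k hk
    by_contra h
    exact hk (by simp [crankCount_eq_zero h])

/-- The coefficient of `X ^ n` is invariant under `u ^ i ↦ u ^ (2 * n - i)`. -/
def IsPalindromic (f : (Polynomial ℤ)⟦X⟧) : Prop :=
  ∀ n, (coeff n f).natDegree ≤ 2 * n ∧ (coeff n f).reflect (2 * n) = coeff n f

theorem Polynomial.reflect_sum {R ι : Type*} [Semiring R] (N : ℕ) (s : Finset ι)
    (f : ι → Polynomial R) : (∑ i ∈ s, f i).reflect N = ∑ i ∈ s, (f i).reflect N := by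
  ext i
  simp [Polynomial.coeff_reflect]

theorem IsPalindromic.mul {f g : (Polynomial ℤ)⟦X⟧} (hf : IsPalindromic f) (hg : IsPalindromic g) :
    IsPalindromic (f * g) := by
  intro n
  rw [coeff_mul]
  refine ⟨Polynomial.natDegree_sum_le_of_forall_le _ _ fun x hx => ?_, ?_⟩
  · have := (hf x.1).1
    have := (hg x.2).1
    have := mem_antidiagonal.1 hx
    exact Polynomial.natDegree_mul_le.trans (by omega)
  · rw [Polynomial.reflect_sum]
    refine sum_congr rfl fun x hx => ?_
    rw [← mem_antidiagonal.1 hx, mul_add, Polynomial.reflect_mul _ _ (hf x.1).1 (hg x.2).1,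
      (hf x.1).2, (hg x.2).2]

/-- Division by a symmetric series with constant term 1: the n-th coefficient of f is computed from
symmetric data of lower index. -/
theorem IsPalindromic.of_mul {f g : (Polynomial ℤ)⟦X⟧} (hfg : IsPalindromic (f * g))
    (hg : IsPalindromic g) (hg0 : coeff 0 g = 1) : IsPalindromic f := by
  intro n
  induction n using Nat.strong_induction_on with
  | h n ih =>
    have h1 := hfg n
    have h2 : coeff n f = coeff n (f * g) -
        ∑ i ∈ range n, coeff i f * coeff (n - i) g := by
      rw [coeff_mul, Nat.sum_antidiagonal_eq_sum_range_succ_mk, sum_range_succ, Nat.sub_self, hg0]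
      ring
    rw [h2]
    constructor
    · refine (Polynomial.natDegree_sub_le _ _).trans (max_le h1.1 ?_)
      refine Polynomial.natDegree_sum_le_of_forall_le _ _ fun i hi => ?_
      have := (ih i (mem_range.1 hi)).1
      have := (hg (n - i)).1
      have := mem_range.1 hi
      exact Polynomial.natDegree_mul_le.trans (by omega)
    · rw [Polynomial.reflect_sub, h1.2, Polynomial.reflect_sum]
      congr 1
      refine sum_congr rfl fun i hi => ?_
      have h3 := mem_range.1 hi
      have h4 := Polynomial.reflect_mul _ _ (ih i h3).1 (hg (n - i)).1
      rw [show 2 * i + 2 * (n - i) = 2 * n by omega, (ih i h3).2, (hg (n - i)).2] at h4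
      exact h4

theorem isPalindromic_partitionGF : IsPalindromic partitionGF := by
  intro n
  have h : coeff n partitionGF =
      Polynomial.C ((Fintype.card n.Partition : ℕ) : ℤ) * Polynomial.X ^ n := by
    rw [partitionGF, coeff_weightSeries]
    simp only [prod_map_pow_eq_pow_sum, Nat.Partition.parts_sum, sum_const, card_univ]
    simp
  rw [h]
  refine ⟨(Polynomial.natDegree_C_mul_X_pow_le _ _).trans (by omega), ?_⟩
  rw [Polynomial.reflect_C_mul_X_pow, Polynomial.revAt_le (by omega)]
  congr 2
  omega

/-- This is C(z) = C(1/z). The product formula is symmetric in a and b, and exchanging them reverses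
each coefficient. -/
theorem isPalindromic_crankGF : IsPalindromic crankGF := by
  have h : crankSeries (Polynomial.X : Polynomial ℤ) 1 = crankSeries 1 Polynomial.X := by
    have h1 := crankSeries_mul (Polynomial.X : Polynomial ℤ) 1
    have h2 := crankSeries_mul 1 (Polynomial.X : Polynomial ℤ)
    rw [mul_comm 1 Polynomial.X] at h2
    exact (isUnit_weightSeries _).mul_right_cancel (h1.trans (by rw [h2, mul_comm]))
  intro n
  constructor
  · rw [coeff_crankGF]
    refine Polynomial.natDegree_sum_le_of_forall_le _ _ fun k hk => ?_
    have := mem_Icc.1 hk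
    exact (Polynomial.natDegree_C_mul_X_pow_le _ _).trans (by omega)
  · conv_rhs => rw [crankGF, h, crankSeries, coeff_mk]
    rw [coeff_crankGF, Polynomial.reflect_sum]
    refine sum_congr rfl fun k hk => ?_
    have := mem_Icc.1 hk
    rw [Polynomial.reflect_C_mul_X_pow, Polynomial.revAt_le (by omega), one_pow, one_mul]
    simp only [eq_intCast]
    congr 2
    omega

theorem isPalindromic_crankCubeGF : IsPalindromic crankCubeGF := by
  have h0 : coeff 0 (partitionGF ^ 2) = 1 := by
    rw [coeff_zero_eq_constantCoeff_apply, map_pow, ← coeff_zero_eq_constantCoeff_apply,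
      partitionGF, coeff_weightSeries]
    simp
  refine IsPalindromic.of_mul (g := partitionGF ^ 2) ?_ ?_ h0
  · rw [crankCubeGF_mul, pow_succ, pow_two]
    exact (isPalindromic_crankGF.mul isPalindromic_crankGF).mul isPalindromic_crankGF
  · rw [pow_two]
    exact isPalindromic_partitionGF.mul isPalindromic_partitionGF

end CrankMoments

/-! ### Conjugate partitions -/

section Conjugation

/-- The number of elements of `s` greater than `i`. -/
def countGT (s : Multiset ℕ) (i : ℕ) : ℕ := s.countP (i < ·)

theorem countGT_cons (a : ℕ) (s : Multiset ℕ) (i : ℕ) :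
    countGT (a ::ₘ s) i = countGT s i + if i < a then 1 else 0 := by
  rw [countGT, Multiset.countP_cons]; rfl

theorem countGT_antitone (s : Multiset ℕ) : Antitone (countGT s) := by
  intro i j hij
  induction s using Multiset.induction_on with
  | empty => simp [countGT]
  | cons a s ih =>
    rw [countGT_cons, countGT_cons]
    split_ifs <;> omega

theorem countGT_zero {s : Multiset ℕ} (hs : ∀ i ∈ s, 0 < i) : countGT s 0 = Multiset.card s :=
  Multiset.countP_eq_card.2 hs

theorem countGT_eq_zero {s : Multiset ℕ} {N : ℕ} (h : s.sup ≤ N) : countGT s N = 0 := by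
  rw [countGT, Multiset.countP_eq_zero]
  intro i hi
  have := Multiset.le_sup hi
  omega

theorem sum_countGT {s : Multiset ℕ} {N : ℕ} (h : s.sup ≤ N) :
    ∑ i ∈ range N, countGT s i = s.sum := by
  induction s using Multiset.induction_on with
  | empty => simp [countGT]
  | cons a s ih =>
    rw [Multiset.sup_cons, sup_le_iff] at h
    simp only [countGT_cons, sum_add_distrib, ih h.2, Multiset.sum_cons]
    rw [← sum_filter, sum_const, smul_eq_mul, mul_one, add_comm]
    congr 1
    have : (range N).filter (fun i => i < a) = range a := by
      ext i
      simp only [mem_filter, mem_range]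
      omega
    rw [this, card_range]

theorem count_add_countGT (s : Multiset ℕ) (a : ℕ) :
    s.count (a + 1) + countGT s (a + 1) = countGT s a := by
  induction s using Multiset.induction_on with
  | empty => simp [countGT]
  | cons b s ih =>
    rw [countGT_cons, countGT_cons, Multiset.count_cons]
    split_ifs <;> omega

/-- The conjugate of a multiset of positive integers. -/
def conjugateMultiset (s : Multiset ℕ) : Multiset ℕ := (Multiset.range s.sup).map (countGT s)

/-- Both sides say that one and the same cell lies in the Young diagram; `countGT s` lists the
column lengths in decreasing order. -/
theorem lt_countGT_conjugateMultiset (s : Multiset ℕ) (i j : ℕ) :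
    i < countGT (conjugateMultiset s) j ↔ j < countGT s i := by
  have h : countGT (conjugateMultiset s) j =
      ((range s.sup).filter fun i => j < countGT s i).card := by
    rw [countGT, conjugateMultiset, Multiset.countP_map]
    rfl
  rw [h]
  constructor
  · intro h1
    by_contra h2
    have h4 : ((range s.sup).filter fun i => j < countGT s i) ⊆ range i := by
      intro k hk
      rw [mem_filter] at hk
      rw [mem_range]
      by_contra h3
      have := countGT_antitone s (not_lt.1 h3)
      omega
    have := card_le_card h4
    rw [card_range] at this
    omega
  · intro h1
    have h2 : range (i + 1) ⊆ (range s.sup).filter fun i => j < countGT s i := by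
      intro k hk
      have h3 := countGT_antitone s (Nat.le_of_lt_succ (mem_range.1 hk))
      rw [mem_filter, mem_range]
      refine ⟨?_, by omega⟩
      by_contra h4
      have := countGT_eq_zero (not_lt.1 h4)
      omega
    have := card_le_card h2
    rw [card_range] at this
    omega

theorem conjugateMultiset_injective {s t : Multiset ℕ} (hs : ∀ i ∈ s, 0 < i) (ht : ∀ i ∈ t, 0 < i)
    (h : conjugateMultiset s = conjugateMultiset t) : s = t := by
  have h1 : ∀ i, countGT s i = countGT t i := fun i => by
    apply eq_of_forall_lt_iff
    intro j
    rw [← lt_countGT_conjugateMultiset s, ← lt_countGT_conjugateMultiset t, h]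
  ext a
  rcases a with _ | a
  · rw [Multiset.count_eq_zero_of_notMem fun h => lt_irrefl _ (hs 0 h),
      Multiset.count_eq_zero_of_notMem fun h => lt_irrefl _ (ht 0 h)]
  · have h2 := count_add_countGT s a
    have h3 := count_add_countGT t a
    have h4 := h1 a
    have h5 := h1 (a + 1)
    omega

/-- The conjugate of a partition. -/
def conjugatePartition {n : ℕ} (p : n.Partition) : n.Partition where
  parts := conjugateMultiset p.parts
  parts_pos := by
    intro i hi
    obtain ⟨k, hk, rfl⟩ := Multiset.mem_map.1 hi
    rw [Multiset.mem_range] at hk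
    have hn : n ≠ 0 := by
      have : p.parts.sup ≤ n := largestPart_le p
      omega
    exact Multiset.countP_pos.2 ⟨_, largestPart_mem p hn, hk⟩
  parts_sum := by
    refine Eq.trans ?_ p.parts_sum
    rw [← sum_countGT (s := p.parts) le_rfl]
    rfl

theorem card_conjugatePartition {n : ℕ} (p : n.Partition) :
    Multiset.card (conjugatePartition p).parts = largestPart p := by
  simp [conjugatePartition, conjugateMultiset, largestPart]

theorem largestPart_conjugatePartition {n : ℕ} (p : n.Partition) :
    largestPart (conjugatePartition p) = Multiset.card p.parts := by
  rw [← countGT_zero fun i hi => p.parts_pos hi]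
  apply le_antisymm
  · refine Multiset.sup_le.2 fun i hi => ?_
    obtain ⟨k, -, rfl⟩ : ∃ k ∈ Multiset.range p.parts.sup, countGT p.parts k = i :=
      Multiset.mem_map.1 hi
    exact countGT_antitone _ (Nat.zero_le k)
  · rcases Nat.eq_zero_or_pos (countGT p.parts 0) with h | h
    · omega
    · refine le_largestPart (Multiset.mem_map_of_mem _ (Multiset.mem_range.2 ?_))
      by_contra h1
      have := countGT_eq_zero (not_lt.1 h1)
      omega

theorem sum_conjugatePartition {M : Type*} [AddCommMonoid M] (n : ℕ) (φ : ℕ → ℕ → M) :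
    ∑ p : n.Partition, φ (largestPart p) (Multiset.card p.parts) =
      ∑ p : n.Partition, φ (Multiset.card p.parts) (largestPart p) := by
  have h : Function.Injective (conjugatePartition (n := n)) := fun p p' h =>
    Nat.Partition.ext (conjugateMultiset_injective (fun i hi => p.parts_pos hi)
      (fun i hi => p'.parts_pos hi) (congrArg Nat.Partition.parts h))
  rw [← Function.Bijective.sum_comp (Finite.injective_iff_bijective.1 h)]
  simp only [card_conjugatePartition, largestPart_conjugatePartition]

end Conjugation

/-! ### Two symmetries of the partial sums of the rank counts -/

section RankSymmetry

/-- The number of partitions of `n` with rank at most `m`. -/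
def rankLE (m : ℤ) (n : ℕ) : ℤ := ∑ p : n.Partition, if rank p ≤ m then 1 else 0

theorem rankLE_eq_sum_conjugate (m : ℤ) (n : ℕ) :
    rankLE m n = ∑ p : n.Partition,
      if (Multiset.card p.parts : ℤ) - (largestPart p : ℤ) ≤ m then 1 else 0 :=
  sum_conjugatePartition n fun l k => if (l : ℤ) - (k : ℤ) ≤ m then (1 : ℤ) else 0

/-- Conjugation negates the rank, so the second summand counts the partitions of rank above m. -/
theorem rankLE_add_rankLE (m : ℤ) (n : ℕ) :
    rankLE m n + rankLE (-1 - m) n = Fintype.card n.Partition := by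
  rw [rankLE_eq_sum_conjugate (-1 - m), rankLE, ← sum_add_distrib, Fintype.card,
    ← nsmul_one, ← sum_const]
  refine sum_congr rfl fun p _ => ?_
  unfold rank
  split_ifs <;> omega

/-- The number of pairs of a number `k` and a partition of `k` with largest part at most `j - k`
and at most `i - k` parts. -/
def boxCount (i j : ℕ) : ℤ := ∑ k ∈ range (i + j + 1), ∑ p : k.Partition,
  if largestPart p + k ≤ j ∧ Multiset.card p.parts + k ≤ i then 1 else 0

theorem boxCount_comm (i j : ℕ) : boxCount i j = boxCount j i := by
  rw [boxCount, boxCount, add_comm i j]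
  refine sum_congr rfl fun k _ => ?_
  rw [sum_conjugatePartition k fun l c => if l + k ≤ j ∧ c + k ≤ i then (1 : ℤ) else 0]
  exact sum_congr rfl fun p _ => if_congr and_comm rfl rfl

/-- After conjugation the largest part j - k is removed. The remaining partition of k has parts at
most j - k, and the bound on the rank becomes the bound i - k on its number of parts. -/
theorem rankLE_eq_boxCount (i j : ℕ) : rankLE (i + 1 - j) j = boxCount i j := by
  rw [rankLE_eq_sum_conjugate, boxCount, ← sum_fiberwise_of_maps_to (t := range (i + j + 1))
    (g := fun p : j.Partition => j - largestPart p) fun p _ => mem_range.2 (by omega)]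
  refine sum_congr rfl fun k _ => ?_
  -- The empty partition has no largest part to remove and is treated separately.
  rcases Nat.eq_zero_or_pos j with rfl | hj
  · rcases Nat.eq_zero_or_pos k with rfl | hk
    · have : ∀ p : Nat.Partition 0, largestPart p = 0 ∧ Multiset.card p.parts = 0 := fun p =>
        ⟨Nat.le_zero.1 (largestPart_le p), Nat.le_zero.1 (card_parts_le p)⟩
      rw [filter_true_of_mem fun p _ => by simp]
      refine sum_congr rfl fun p _ => if_congr ?_ rfl rfl
      rw [(this p).1, (this p).2]
      omega
    · rw [filter_false_of_mem fun p _ => by omega, sum_empty]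
      exact (sum_eq_zero fun p _ => if_neg (by omega)).symm
  rcases lt_trichotomy k j with hk | rfl | hk
  · have h1 := sum_partition_with_part (n := j) (a := j - k) (by omega) fun s =>
      if (∀ i ∈ s, i ≤ j - k) ∧ Multiset.card s + k ≤ i + 1 then (1 : ℤ) else 0
    rw [if_pos (Nat.sub_le j k), Nat.sub_sub_self hk.le, ← sum_filter, filter_filter] at h1
    rw [← sum_filter, filter_filter]
    have h2 : (univ.filter fun p : j.Partition => j - largestPart p = k ∧
        (Multiset.card p.parts : ℤ) - (largestPart p : ℤ) ≤ i + 1 - j) =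
        univ.filter fun p : j.Partition => j - k ∈ p.parts ∧
          (∀ i ∈ p.parts, i ≤ j - k) ∧ Multiset.card p.parts + k ≤ i + 1 := by
      refine filter_congr fun p _ => ?_
      have h3 := largestPart_le p
      constructor
      · rintro ⟨h4, h5⟩
        have h6 : j - k = largestPart p := by omega
        rw [h6]
        exact ⟨largestPart_mem p (by omega), fun i hi => le_largestPart hi, by omega⟩
      · rintro ⟨h4, h5, h6⟩
        have h7 : largestPart p = j - k := le_antisymm (Multiset.sup_le.2 h5) (le_largestPart h4)
        omega
    rw [h2, h1]
    refine sum_congr rfl fun p _ => if_congr ?_ rfl rfl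
    rw [Multiset.card_cons]
    constructor
    · rintro ⟨h3, h4⟩
      have : largestPart p ≤ j - k :=
        Multiset.sup_le.2 fun i hi => h3 i (Multiset.mem_cons_of_mem hi)
      omega
    · rintro ⟨h3, h4⟩
      refine ⟨fun i hi => ?_, by omega⟩
      rcases Multiset.mem_cons.1 hi with rfl | hi
      · exact le_rfl
      · have := le_largestPart hi
        omega
  · have h1 : ∀ p : k.Partition, 1 ≤ largestPart p := fun p =>
      p.parts_pos (largestPart_mem p (by omega))
    rw [filter_false_of_mem fun p _ => by have := h1 p; omega, sum_empty]
    exact (sum_eq_zero fun p _ => if_neg (by have := h1 p; omega)).symm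
  · rw [filter_false_of_mem fun p _ => by omega, sum_empty]
    exact (sum_eq_zero fun p _ => if_neg (by omega)).symm

/-- In generating functions this is the symmetry u ↔ X, that is z ↔ q/z. -/
theorem rankLE_comm (i j : ℕ) : rankLE (i + 1 - j) j = rankLE (j + 1 - i) i := by
  rw [rankLE_eq_boxCount, rankLE_eq_boxCount, boxCount_comm]

theorem abs_rank_le {n : ℕ} (p : n.Partition) : -(n : ℤ) ≤ rank p ∧ rank p ≤ n := by
  have h1 := largestPart_le p
  have h2 := card_parts_le p
  unfold rank
  constructor <;> omega

theorem rankLE_eq_zero {m : ℤ} {n : ℕ} (h : m < -(n : ℤ)) : rankLE m n = 0 :=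
  sum_eq_zero fun p _ => if_neg (by have := (abs_rank_le p).1; omega)

theorem rankLE_neg {n : ℕ} (hn : n ≠ 0) : rankLE (-n) n = 0 := by
  refine sum_eq_zero fun p _ => if_neg ?_
  have h1 := p.parts_pos (largestPart_mem p hn)
  have h2 := card_parts_le p
  unfold rank
  omega

end RankSymmetry

/-! ### The symmetry z ↔ q/z for the crank -/

section Swap

/-- The exchange of the two variables of a power series in two variables. -/
noncomputable def swapVariables : ℤ⟦X⟧⟦X⟧ →+* ℤ⟦X⟧⟦X⟧ where
  toFun f := mk fun j => mk fun i => coeff j (coeff i f)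
  map_one' := by
    ext j i
    simp only [coeff_mk, coeff_one]
    by_cases h : i = 0 <;> by_cases h' : j = 0 <;> simp [h, h', coeff_one]
  map_zero' := by ext j i; simp
  map_add' f g := by ext j i; simp
  map_mul' f g := by
    ext j i
    simp only [coeff_mk, coeff_mul, map_sum]
    exact sum_comm

theorem coeff_coeff_swapVariables (f : ℤ⟦X⟧⟦X⟧) (i j : ℕ) :
    coeff i (coeff j (swapVariables f)) = coeff j (coeff i f) := by
  change coeff i (coeff j (mk fun j => mk fun i => coeff j (coeff i f))) = _
  rw [coeff_mk, coeff_mk]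

theorem swapVariables_X : swapVariables X = C X := by
  ext j i
  rw [coeff_coeff_swapVariables, coeff_X, coeff_C]
  by_cases h : i = 1 <;> by_cases h' : j = 0 <;> simp [h, h', coeff_one, coeff_X]

theorem swapVariables_C_X : swapVariables (C X) = X := by
  ext j i
  rw [← swapVariables_X, coeff_coeff_swapVariables, coeff_coeff_swapVariables]

theorem eq_swapVariables_of_mul {f g : ℤ⟦X⟧⟦X⟧} (hg : IsUnit g) (h : swapVariables g = g)
    (hfg : swapVariables (f * g) = f * g) : swapVariables f = f := by
  rw [map_mul, h] at hfg
  exact hg.mul_right_cancel hfg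

/-- The inclusion of the series in `X` with coefficients polynomial in `u` into the power series
in `u` and `X`. -/
noncomputable def toBivariate : (Polynomial ℤ)⟦X⟧ →+* ℤ⟦X⟧⟦X⟧ :=
  PowerSeries.map Polynomial.coeToPowerSeries.ringHom

theorem toBivariate_weightSeries (w : ℕ → Polynomial ℤ) :
    toBivariate (weightSeries w) = weightSeries fun i => (w i : ℤ⟦X⟧) :=
  map_weightSeries _ w

theorem swapVariables_partitionGF :
    swapVariables (toBivariate partitionGF) = toBivariate partitionGF := by
  have h : ∀ i j, coeff i (coeff j (toBivariate partitionGF)) =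
      if i = j then (Fintype.card j.Partition : ℤ) else 0 := fun i j => by
    rw [partitionGF, toBivariate_weightSeries, coeff_weightSeries]
    simp only [Polynomial.coe_pow, Polynomial.coe_X, prod_map_pow_eq_pow_sum,
      Nat.Partition.parts_sum, sum_const, card_univ]
    rw [map_nsmul, coeff_X_pow]
    simp
  ext j i
  rw [coeff_coeff_swapVariables, h, h]
  rcases eq_or_ne i j with rfl | hij
  · rfl
  · rw [if_neg hij, if_neg hij.symm]

/-- `1 / (1 - u)`. -/
noncomputable def geometricU : ℤ⟦X⟧⟦X⟧ := C (mk 1)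

theorem geometricU_mul : geometricU * (1 - C X) = 1 := by
  rw [geometricU, ← map_one C, ← map_sub, ← map_mul, mk_one_mul_one_sub_eq_one]

theorem isUnit_toBivariate_partitionGF : IsUnit (toBivariate partitionGF) :=
  (isUnit_weightSeries _).map _

/-- Up to the symmetric factor 1/P, C/(1 - z) is the inverse of the product of all 1 - u^(r+1) X^r
and 1 - u^r X^(r+1) with r ≥ 0. The exchange of u and X permutes these factors; the factor 1 - u is
the one that C alone lacks. -/
theorem swapVariables_crankGF :
    swapVariables (geometricU * toBivariate crankGF) = geometricU * toBivariate crankGF := by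
  refine eq_swapVariables_of_mul isUnit_toBivariate_partitionGF swapVariables_partitionGF ?_
  set W := geometricU * toBivariate crankGF * toBivariate partitionGF with hW
  have hW' : W = geometricU * ((weightSeries fun i => X ^ (i + 1)) *
      weightSeries fun i => X ^ (i - 1)) := by
    rw [hW, mul_assoc, ← map_mul, crankGF_mul_partitionGF, map_mul, toBivariate_weightSeries,
      toBivariate_weightSeries]
    simp [zWeight]
  -- A finite symmetric product S inverts W modulo X^N, hence inverts the swapped series modulo u^N.
  have key : ∀ N, ∃ S a : ℤ⟦X⟧⟦X⟧, IsUnit S ∧ swapVariables S = S ∧ W * S = 1 + X ^ N * a := by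
    intro N
    refine ⟨(∏ r ∈ range (N + 1), (1 - C X ^ (r + 1) * X ^ r)) *
      ∏ r ∈ range (N + 1), (1 - C X ^ r * X ^ (r + 1)), ?_⟩
    have h1 := X_pow_dvd_weightSeries_mul_prod_range_sub_one
      (fun i => (X ^ (i + 1) : ℤ⟦X⟧)) N
    have h2 := (pow_dvd_pow X N.le_succ).trans (X_pow_dvd_weightSeries_mul_prod_range_sub_one
      (fun i => (X ^ (i - 1) : ℤ⟦X⟧)) (N + 1))
    simp only [map_pow, Nat.add_sub_cancel] at h1 h2
    obtain ⟨a, h1⟩ := h1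
    obtain ⟨b, h2⟩ := h2
    refine ⟨a + b + X ^ N * a * b, ?_, ?_, ?_⟩
    · refine IsUnit.mul ?_ ?_
      · rw [prod_range_succ', pow_zero, mul_one, zero_add, pow_one]
        refine IsUnit.mul ?_ (IsUnit.of_mul_eq_one geometricU (by rw [mul_comm, geometricU_mul]))
        refine IsUnit.prod_iff.2 fun r _ => isUnit_one_sub_of_X_dvd ?_
        exact Dvd.dvd.mul_left (dvd_pow_self _ (by omega)) _
      · refine IsUnit.prod_iff.2 fun r _ => isUnit_one_sub_of_X_dvd ?_
        exact Dvd.dvd.mul_left (dvd_pow_self _ (by omega)) _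
    · simp only [map_mul, map_prod, map_sub, map_one, map_pow, swapVariables_X, swapVariables_C_X]
      rw [mul_comm]
      congr 1 <;> exact prod_congr rfl fun r _ => by ring
    · rw [hW', prod_range_succ' (fun r => (1 - C X ^ (r + 1) * X ^ r : ℤ⟦X⟧⟦X⟧)), pow_zero, mul_one,
        zero_add, pow_one]
      have h3 := geometricU_mul
      generalize (weightSeries fun i => (X ^ (i + 1) : ℤ⟦X⟧)) = E at *
      generalize (weightSeries fun i => (X ^ (i - 1) : ℤ⟦X⟧)) = E' at *
      generalize (∏ r ∈ range N, (1 - C X ^ (r + 1 + 1) * X ^ (r + 1) : ℤ⟦X⟧⟦X⟧)) = A at *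
      generalize (∏ r ∈ range (N + 1), (1 - C X ^ r * X ^ (r + 1) : ℤ⟦X⟧⟦X⟧)) = B at *
      linear_combination E * E' * A * B * h3 + E' * B * h1 + (1 + X ^ N * a) * h2
  clear_value W
  ext j i
  -- The power exceeds both i and j, so neither error term reaches the coefficient of u^i X^j.
  obtain ⟨S, a, hS, hSs, h⟩ := key (i + j + 1)
  obtain ⟨T, hT⟩ := hS.exists_right_inv
  have h' := congrArg swapVariables h
  rw [map_mul, hSs, map_add, map_one, map_mul, map_pow, swapVariables_X] at h'
  have h1 : swapVariables W = W + C X ^ (i + j + 1) * (swapVariables a * T)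
      - X ^ (i + j + 1) * (a * T) := by
    linear_combination T * h' - T * h - (swapVariables W - W) * hT
  rw [h1, map_sub, map_add, map_sub, map_add, coeff_X_pow_mul', if_neg (by omega), ← map_pow,
    coeff_C_mul, coeff_X_pow_mul', if_neg (by omega)]
  simp

/-- The generating function of the second partial sums of the coefficients of `crankCubeGF`. -/
noncomputable def crankCubeSums : ℤ⟦X⟧⟦X⟧ := geometricU ^ 3 * toBivariate crankCubeGF

theorem swapVariables_crankCubeSums : swapVariables crankCubeSums = crankCubeSums := by
  refine eq_swapVariables_of_mul (isUnit_toBivariate_partitionGF.pow 2)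
    (by rw [map_pow, swapVariables_partitionGF]) ?_
  have h : crankCubeSums * toBivariate partitionGF ^ 2 =
      (geometricU * toBivariate crankGF) ^ 3 := by
    rw [crankCubeSums, mul_assoc, ← map_pow, ← map_mul, crankCubeGF_mul, map_pow, mul_pow]
  rw [h, map_pow, swapVariables_crankGF]

theorem two_mul_coeff_crankCubeSums (i j : ℕ) :
    2 * coeff i (coeff j crankCubeSums) = ∑ l ∈ range (i + 1),
      (coeff j crankCubeGF).coeff l * (((i : ℤ) + 1 - l) * ((i : ℤ) + 2 - l)) := by
  have h1 : coeff j (toBivariate crankCubeGF) = ((coeff j crankCubeGF : Polynomial ℤ) : ℤ⟦X⟧) :=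
    coeff_map _ _ _
  rw [crankCubeSums, geometricU, ← map_pow, coeff_C_mul, h1, mk_one_pow_eq_mk_choose_add,
    
    mul_comm _ ((coeff j crankCubeGF : Polynomial ℤ) : ℤ⟦X⟧), coeff_mul,
        Nat.sum_antidiagonal_eq_sum_range_succ_mk, mul_sum]
  refine sum_congr rfl fun l hl => ?_
  have hl := mem_range.1 hl
  rw [Polynomial.coeff_coe, coeff_mk]
  have h2 : ((2 + (i - l)).choose 2 : ℤ) * 2 = ((i : ℤ) + 1 - l) * ((i : ℤ) + 2 - l) := by
    have h4 : (2 + (i - l)).choose 2 * 2 = (i - l + 2) * (i - l + 1) := by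
      rw [Nat.choose_two_right, add_comm 2, Nat.add_sub_assoc (by norm_num),
        Nat.div_mul_cancel]
      have := Nat.even_mul_succ_self (i - l + 1)
      rw [mul_comm]
      exact this.two_dvd
    have h5 : ((i - l : ℕ) : ℤ) = i - l := Nat.cast_sub (by omega)
    have h6 := congrArg (Nat.cast (R := ℤ)) h4
    push_cast at h6
    rw [h5] at h6
    rw [h6]
    ring
  linear_combination (coeff j crankCubeGF).coeff l * h2

end Swap

/-! ### The rank-crank equation -/

section RankCrankEquation

/-- The coefficient of `z ^ (l - n) q ^ n` in the generating function `crankCubeGF`. -/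
noncomputable def crankCubeCoeff (l n : ℕ) : ℤ := (coeff n crankCubeGF).coeff l

theorem crankCubeCoeff_eq_zero {l n : ℕ} (h : 2 * n < l) : crankCubeCoeff l n = 0 :=
  Polynomial.coeff_eq_zero_of_natDegree_lt ((isPalindromic_crankCubeGF n).1.trans_lt h)

theorem crankCubeCoeff_reflect {l n : ℕ} (h : l ≤ 2 * n) :
    crankCubeCoeff (2 * n - l) n = crankCubeCoeff l n := by
  have h1 := congrArg (fun p => Polynomial.coeff p l) (isPalindromic_crankCubeGF n).2
  simp only [Polynomial.coeff_reflect, Polynomial.revAt_le h] at h1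
  exact h1

theorem sum_range_reflect_crankCube {n : ℕ} (φ : ℤ → ℤ) :
    ∑ l ∈ range (2 * n + 1), crankCubeCoeff l n * φ (l - n) =
      ∑ l ∈ range (2 * n + 1), crankCubeCoeff l n * φ (n - l) := by
  rw [← sum_range_reflect]
  refine sum_congr rfl fun l hl => ?_
  have hl := mem_range.1 hl
  rw [show 2 * n + 1 - 1 - l = 2 * n - l by omega, crankCubeCoeff_reflect (by omega),
    Nat.cast_sub (by omega)]
  congr 2
  push_cast
  ring

theorem coeff_zMoment_crankCubeGF (a n : ℕ) : coeff n (zMoment crankCubeGF a) =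
    ∑ l ∈ range (2 * n + 1), crankCubeCoeff l n * ((l : ℤ) - n) ^ a :=
  coeff_zMoment ((coeff n crankCubeGF).as_sum_range_C_mul_X_pow'
    (Nat.lt_succ_of_le (isPalindromic_crankCubeGF n).1)) a

theorem coeff_partitionSeries (n : ℕ) :
    coeff n partitionSeries = (Fintype.card n.Partition : ℤ) := by
  rw [partitionSeries, coeff_weightSeries]
  simp

theorem sum_crankCubeCoeff (n : ℕ) :
    ∑ l ∈ range (2 * n + 1), crankCubeCoeff l n = (Fintype.card n.Partition : ℤ) := by
  have h := coeff_zMoment_crankCubeGF 0 n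
  rw [zMoment_crankCubeGF_zero, coeff_partitionSeries] at h
  simpa using h.symm

theorem sum_crankCubeCoeff_mul (n : ℕ) :
    ∑ l ∈ range (2 * n + 1), crankCubeCoeff l n * ((l : ℤ) - n) = 0 := by
  have h1 := sum_range_reflect_crankCube (n := n) fun x => x
  have h2 : ∑ l ∈ range (2 * n + 1), crankCubeCoeff l n * ((n : ℤ) - l) =
      -∑ l ∈ range (2 * n + 1), crankCubeCoeff l n * ((l : ℤ) - n) := by
    rw [← sum_neg_distrib]
    exact sum_congr rfl fun l _ => by ring
  linarith

/-- The first step of the moment recursion with κ = 3: the second moment is 6Φ₁P = 6θP. This is the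
source of the 6n in the rank-crank equation. -/
theorem sum_crankCubeCoeff_mul_sq (n : ℕ) :
    ∑ l ∈ range (2 * n + 1), crankCubeCoeff l n * ((l : ℤ) - n) ^ 2 =
      6 * n * (Fintype.card n.Partition : ℤ) := by
  have h := zMoment_even_succ zDerivation_crankCubeGF 0
  rw [zero_add, range_one, sum_singleton] at h
  simp only [mul_zero, zero_add, Nat.sub_self, zMoment_crankCubeGF_zero, mul_one,
    Nat.choose_self, Nat.reduceMul, ← theta_partitionSeries] at h
  rw [← coeff_zMoment_crankCubeGF, h, coeff_natCast_mul, coeff_theta, coeff_partitionSeries]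
  push_cast
  ring

/-- Twice the coefficient of `z ^ m q ^ n` in the generating function `crankCubeSums`, shifted. -/
noncomputable def crankCubeSum (m : ℤ) (n : ℕ) : ℤ := ∑ l ∈ range (2 * n + 1),
  crankCubeCoeff l n * if (l : ℤ) - n ≤ m then (m - (l - n)) * (m - (l - n) + 1) else 0

theorem crankCubeSum_eq (i j : ℕ) :
    crankCubeSum (i + 1 - j) j = 2 * coeff i (coeff j crankCubeSums) := by
  rw [two_mul_coeff_crankCubeSums, crankCubeSum]
  have h1 : ∑ l ∈ range (2 * j + 1), crankCubeCoeff l j * (if (l : ℤ) - j ≤ i + 1 - j then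
        ((i : ℤ) + 1 - j - (l - j)) * (i + 1 - j - (l - j) + 1) else 0) =
      ∑ l ∈ range (2 * j + 1 + (i + 1)), crankCubeCoeff l j * (if (l : ℤ) - j ≤ i + 1 - j then
        ((i : ℤ) + 1 - j - (l - j)) * (i + 1 - j - (l - j) + 1) else 0) :=
    sum_subset (range_mono (by omega)) fun l _ hl => by
      rw [mem_range] at hl
      rw [crankCubeCoeff_eq_zero (by omega), zero_mul]
  rw [h1]
  refine (sum_subset_zero_on_sdiff (range_mono (by omega)) (fun l hl => ?_) fun l hl => ?_).symm
  -- Of the additional terms only l = i + 1 satisfies the inequality, and there the factor i + 1 - l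
  -- vanishes.
  · rw [mem_sdiff, mem_range, mem_range] at hl
    split_ifs with h2
    · have h3 : l = i + 1 := by omega
      subst h3
      push_cast
      ring
    · exact mul_zero _
  · rw [mem_range] at hl
    rw [if_pos (by omega)]
    change crankCubeCoeff l j * _ = _
    ring

theorem crankCubeSum_comm (i j : ℕ) :
    crankCubeSum (i + 1 - j) j = crankCubeSum (j + 1 - i) i := by
  rw [crankCubeSum_eq, crankCubeSum_eq, ← coeff_coeff_swapVariables, swapVariables_crankCubeSums]

/-- After reflecting k to -k in the second sum, each k satisfies exactly one of the two inequalities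
and contributes (m - k)(m - k + 1) either way. The total is a combination of the moments of order 0,
1 and 2. -/
theorem crankCubeSum_add (m : ℤ) (n : ℕ) :
    crankCubeSum m n + crankCubeSum (-1 - m) n =
      (6 * n + m * (m + 1)) * Fintype.card n.Partition := by
  have h1 : crankCubeSum (-1 - m) n = ∑ l ∈ range (2 * n + 1), crankCubeCoeff l n *
      if (n : ℤ) - l ≤ -1 - m then (-1 - m - (n - l)) * (-1 - m - (n - l) + 1) else 0 :=
    sum_range_reflect_crankCube fun k =>
      if k ≤ -1 - m then (-1 - m - k) * (-1 - m - k + 1) else 0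
  rw [h1, crankCubeSum, ← sum_add_distrib]
  have h2 : ∀ l ∈ range (2 * n + 1),
      (crankCubeCoeff l n * if (l : ℤ) - n ≤ m then (m - (l - n)) * (m - (l - n) + 1) else 0) +
        (crankCubeCoeff l n *
          if (n : ℤ) - l ≤ -1 - m then (-1 - m - (n - l)) * (-1 - m - (n - l) + 1) else 0) =
      m * (m + 1) * crankCubeCoeff l n - (2 * m + 1) * (crankCubeCoeff l n * ((l : ℤ) - n)) +
        crankCubeCoeff l n * ((l : ℤ) - n) ^ 2 := fun l _ => by
    by_cases h3 : (l : ℤ) - n ≤ m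
    · rw [if_pos h3, if_neg (by omega)]
      ring
    · rw [if_neg h3, if_pos (by omega)]
      ring
  rw [sum_congr rfl h2, sum_add_distrib, sum_sub_distrib, ← mul_sum, ← mul_sum,
    sum_crankCubeCoeff, sum_crankCubeCoeff_mul, sum_crankCubeCoeff_mul_sq]
  ring

theorem crankCubeSum_eq_zero {m : ℤ} {n : ℕ} (h : m ≤ -n) : crankCubeSum m n = 0 := by
  refine sum_eq_zero fun l _ => ?_
  split_ifs with h1
  · have h2 : l = 0 := by omega
    have h3 : m = -n := by omega
    subst h2 h3
    push_cast
    ring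
  · exact mul_zero _

/-- The rank-crank differential equation of Atkin and Garvan, for coefficients. -/
theorem rankLE_eq_crankCubeSum (m : ℤ) (n : ℕ) :
    (6 * n + m * (m + 1)) * rankLE m n = crankCubeSum m n := by
  induction n using Nat.strong_induction_on generalizing m with
  | h n ih =>
    have h1 : ∀ m : ℤ, m ≤ -1 → (6 * n + m * (m + 1)) * rankLE m n = crankCubeSum m n := by
      intro m hm
      rcases lt_trichotomy m (-(n : ℤ)) with h | rfl | h
      · rw [rankLE_eq_zero h, crankCubeSum_eq_zero h.le, mul_zero]
      · rw [crankCubeSum_eq_zero le_rfl, rankLE_neg (by omega), mul_zero]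
      -- For m = i + 1 - n the weight is (i - n)² + 3(i + n) + 2, symmetric in i and n. As m is
      -- negative, i < n, and the exchange reduces to the induction hypothesis.
      · obtain ⟨i, hi⟩ : ∃ i : ℕ, (i : ℤ) = m + n - 1 := ⟨(m + n - 1).toNat, by omega⟩
        have hm' : m = i + 1 - n := by omega
        rw [hm', rankLE_comm, crankCubeSum_comm, ← ih i (by omega)]
        ring
    rcases le_or_gt m (-1) with h | h
    · exact h1 m h
    -- Nonnegative m follow by the reflection m ↦ -1 - m, under which m(m + 1) is invariant.
    · have h2 := h1 (-1 - m) (by omega)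
      have h3 := rankLE_add_rankLE m n
      have h4 := crankCubeSum_add m n
      linear_combination (6 * (n : ℤ) + m * (m + 1)) * h3 - h4 - h2

theorem rankLE_sub_rankLE (m : ℤ) (n : ℕ) :
    rankLE m n - rankLE (m - 1) n = ∑ p : n.Partition, if rank p = m then 1 else 0 := by
  rw [rankLE, rankLE, ← sum_sub_distrib]
  refine sum_congr rfl fun p _ => ?_
  split_ifs <;> omega

/-- The third difference undoes division by (1 - z)³: that of (m - k)(m - k + 1), cut off at k ≤ m,
is 2 at m = k and 0 elsewhere. -/
theorem crankCubeSum_third_difference (m : ℤ) (n : ℕ) :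
    crankCubeSum (m + 1) n - 3 * crankCubeSum m n + 3 * crankCubeSum (m - 1) n
        - crankCubeSum (m - 2) n =
      2 * ∑ l ∈ range (2 * n + 1), crankCubeCoeff l n * if (l : ℤ) - n = m then 1 else 0 := by
  simp only [crankCubeSum, mul_sum]
  rw [← sum_sub_distrib, ← sum_add_distrib, ← sum_sub_distrib]
  refine sum_congr rfl fun l _ => ?_
  generalize (l : ℤ) - n = k
  generalize crankCubeCoeff l n = c
  obtain ⟨d, rfl⟩ : ∃ d, m = k + d := ⟨m - k, by ring⟩
  rcases lt_or_ge d (-1) with h | h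
  · rw [if_neg (by omega), if_neg (by omega), if_neg (by omega), if_neg (by omega),
      if_neg (by omega)]
    ring
  rcases le_or_gt 2 d with h' | h'
  · rw [if_pos (by omega), if_pos (by omega), if_pos (by omega), if_pos (by omega),
      if_neg (by omega)]
    ring
  · interval_cases d <;> split_ifs <;> first | (exfalso; omega) | ring

/-- The weight 6n + m(m + 1) is quadratic in m, so its own third difference vanishes, and only the
differences N(m, n) of `rankLE` remain. -/
theorem rank_third_difference (m : ℤ) (n : ℕ) :
    (6 * n + (m + 1) * (m + 2)) * (∑ p : n.Partition, if rank p = m + 1 then 1 else 0)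
      - 2 * (6 * n + m ^ 2 - 1) * (∑ p : n.Partition, if rank p = m then 1 else 0)
      + (6 * n + (m - 1) * (m - 2)) * (∑ p : n.Partition, if rank p = m - 1 then 1 else 0) =
    2 * ∑ l ∈ range (2 * n + 1), crankCubeCoeff l n * if (l : ℤ) - n = m then 1 else 0 := by
  rw [← crankCubeSum_third_difference, ← rankLE_sub_rankLE, ← rankLE_sub_rankLE,
    ← rankLE_sub_rankLE, ← rankLE_eq_crankCubeSum, ← rankLE_eq_crankCubeSum,
    ← rankLE_eq_crankCubeSum, ← rankLE_eq_crankCubeSum, show m + 1 - 1 = m by ring,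
    show m - 1 - 1 = m - 2 by ring]
  ring

theorem sum_Icc_mul_sum_ite {ι : Type*} (s : Finset ι) (c : ι → ℤ) (r : ι → ℤ) (N b : ℤ)
    (h : ι → ℤ → ℤ) (hr : ∀ x ∈ s, -N ≤ r x - b ∧ r x - b ≤ N) :
    ∑ m ∈ Icc (-N) N, ∑ x ∈ s, c x * h x m * (if r x = m + b then 1 else 0) =
      ∑ x ∈ s, c x * h x (r x - b) := by
  rw [sum_comm]
  refine sum_congr rfl fun x hx => ?_
  have h1 : ∀ m, (r x = m + b) ↔ (r x - b = m) := fun m => by omega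
  simp only [h1, mul_ite, mul_one, mul_zero]
  rw [sum_ite_eq, if_pos (mem_Icc.2 (hr x hx))]

/-- The equation for the moments of the rank. -/
theorem sum_rank_moment_equation (a n : ℕ) :
    ∑ p : n.Partition, ((6 * n + rank p ^ 2) *
        ((rank p - 1) ^ a - 2 * rank p ^ a + (rank p + 1) ^ a)
      + rank p * ((rank p - 1) ^ a - (rank p + 1) ^ a) + 2 * rank p ^ a) =
      2 * coeff n (zMoment crankCubeGF a) := by
  -- Ranks lie in [-n, n]; the larger interval makes room for the shifts by ±1.
  have h : ∑ m ∈ Icc (-((n : ℤ) + 1)) (n + 1), m ^ a *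
      ((6 * n + (m + 1) * (m + 2)) * (∑ p : n.Partition, if rank p = m + 1 then 1 else 0)
      - 2 * (6 * n + m ^ 2 - 1) * (∑ p : n.Partition, if rank p = m then 1 else 0)
      + (6 * n + (m - 1) * (m - 2)) * (∑ p : n.Partition, if rank p = m - 1 then 1 else 0)) =
      ∑ m ∈ Icc (-((n : ℤ) + 1)) (n + 1), m ^ a * (2 * ∑ l ∈ range (2 * n + 1),
        crankCubeCoeff l n * if (l : ℤ) - n = m then 1 else 0) :=
    sum_congr rfl fun m _ => by rw [rank_third_difference]
  have h1 := fun b hb => sum_Icc_mul_sum_ite (univ : Finset n.Partition) (fun _ => 1) rank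
    ((n : ℤ) + 1) b (fun _ m => m ^ a * (6 * n + (m + b) * (m + 2 * b)))
    (hb : ∀ p ∈ (univ : Finset n.Partition), _)
  have h2 := sum_Icc_mul_sum_ite (univ : Finset n.Partition) (fun _ => 1) rank
    ((n : ℤ) + 1) 0 (fun _ m => m ^ a * (6 * n + m ^ 2 - 1))
    fun p _ => by have := abs_rank_le p; constructor <;> omega
  have h3 := sum_Icc_mul_sum_ite (range (2 * n + 1)) (fun l => crankCubeCoeff l n)
    (fun l => (l : ℤ) - n) ((n : ℤ) + 1) 0 (fun _ m => m ^ a)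
    fun l hl => by have := mem_range.1 hl; constructor <;> omega
  have h4 := h1 1 fun p _ => by have := abs_rank_le p; constructor <;> omega
  have h5 := h1 (-1) fun p _ => by have := abs_rank_le p; constructor <;> omega
  simp only [sub_zero] at h3
  rw [← coeff_zMoment_crankCubeGF] at h3
  rw [← h3, mul_sum]
  have h6 : ∀ m : ℤ, m ^ a * (2 * ∑ l ∈ range (2 * n + 1),
        crankCubeCoeff l n * if (l : ℤ) - n = m then 1 else 0) =
      2 * ∑ l ∈ range (2 * n + 1),
        crankCubeCoeff l n * m ^ a * if (l : ℤ) - n = m + 0 then 1 else 0 := fun m => by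
    rw [add_zero, mul_left_comm, mul_sum]
    congr 1
    exact sum_congr rfl fun l _ => by ring
  simp only [h6] at h
  rw [← h]
  have h7 : ∀ m : ℤ, m ^ a *
      ((6 * n + (m + 1) * (m + 2)) * (∑ p : n.Partition, if rank p = m + 1 then 1 else 0)
      - 2 * (6 * n + m ^ 2 - 1) * (∑ p : n.Partition, if rank p = m then 1 else 0)
      + (6 * n + (m - 1) * (m - 2)) * (∑ p : n.Partition, if rank p = m - 1 then 1 else 0)) =
      (∑ p : n.Partition, 1 * (m ^ a * (6 * n + (m + 1) * (m + 2 * 1))) *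
        if rank p = m + 1 then 1 else 0)
      - 2 * (∑ p : n.Partition, 1 * (m ^ a * (6 * n + m ^ 2 - 1)) *
        if rank p = m + 0 then 1 else 0)
      + ∑ p : n.Partition, 1 * (m ^ a * (6 * n + (m + -1) * (m + 2 * -1))) *
        if rank p = m + -1 then 1 else 0 := fun m => by
    rw [← mul_sum, ← mul_sum, ← mul_sum, add_zero, ← sub_eq_add_neg]
    ring
  simp only [h7]
  symm
  rw [sum_add_distrib, sum_sub_distrib, ← mul_sum, h2, h4, h5, mul_sum, ← sum_sub_distrib,
    ← sum_add_distrib]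
  refine sum_congr rfl fun p _ => ?_
  rw [sub_zero, sub_neg_eq_add]
  ring

theorem rankMoment_eq_sum (a n : ℕ) : rankMoment a n = ∑ p : n.Partition, rank p ^ a := by
  rw [rankMoment, finsum_eq_sum_of_support_subset (s := Icc (-(n : ℤ)) n)]
  · rw [← sum_fiberwise_of_maps_to (s := univ) (t := Icc (-(n : ℤ)) n)
      (g := fun p : n.Partition => rank p) fun p _ => mem_Icc.2 (abs_rank_le p)]
    refine sum_congr rfl fun k _ => ?_
    rw [rankCount, mul_comm, ← nsmul_eq_mul, ← sum_const]
    exact sum_congr rfl fun p hp => by rw [(mem_filter.1 hp).2]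
  · intro k hk
    by_contra h
    refine hk ?_
    have h1 : rankCount k n = 0 := by
      rw [rankCount, Int.natCast_eq_zero, card_eq_zero, filter_eq_empty_iff]
      rintro p - rfl
      exact h (by simpa using abs_rank_le p)
    simp [h1]

end RankCrankEquation

/-! ### Relations between rank moments and the moments of C³/P² -/

section RankMomentEquations

theorem rankMoment_zero (n : ℕ) : rankMoment 0 n = Fintype.card n.Partition := by
  simp [rankMoment_eq_sum]

/-- For even a > 0 the terms in k^(a+2) and k^(a+1) cancel, so φ has degree at most a and the
equation for order a involves only N_0, …, N_a. -/
theorem two_mul_sum_eq_of_forall_rank {n a : ℕ} {s : ℤ} {φ : ℤ → ℤ}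
    (hφ : ∀ k : ℤ, (6 * n + k ^ 2) * ((k - 1) ^ a - 2 * k ^ a + (k + 1) ^ a)
      + k * ((k - 1) ^ a - (k + 1) ^ a) + 2 * k ^ a = 2 * φ k)
    (hs : s = ∑ p : n.Partition, φ (rank p)) : s = coeff n (zMoment crankCubeGF a) := by
  have h := sum_rank_moment_equation a n
  simp only [hφ, ← mul_sum] at h
  rw [hs]
  linarith

theorem rankMoment_equation_four (n : ℕ) :
    3 * rankMoment 4 n + (36 * n - 3) * rankMoment 2 n + 6 * n * rankMoment 0 n =
      coeff n (zMoment crankCubeGF 4) := by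
  refine two_mul_sum_eq_of_forall_rank (φ := fun k =>
    3 * k ^ 4 + (36 * n - 3) * k ^ 2 + 6 * n * k ^ 0) (fun k => by ring) ?_
  simp only [rankMoment_eq_sum, mul_sum, ← sum_add_distrib]

theorem rankMoment_equation_six (n : ℕ) :
    10 * rankMoment 6 n + (90 * n - 5) * rankMoment 4 n + (90 * n - 5) * rankMoment 2 n +
        6 * n * rankMoment 0 n =
      coeff n (zMoment crankCubeGF 6) := by
  refine two_mul_sum_eq_of_forall_rank (φ := fun k =>
    10 * k ^ 6 + (90 * n - 5) * k ^ 4 + (90 * n - 5) * k ^ 2 + 6 * n * k ^ 0) (fun k => by ring) ?_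
  simp only [rankMoment_eq_sum, mul_sum, ← sum_add_distrib]

theorem rankMoment_equation_eight (n : ℕ) :
    21 * rankMoment 8 n + (168 * n + 14) * rankMoment 6 n + (420 * n - 28) * rankMoment 4 n +
        (168 * n - 7) * rankMoment 2 n + 6 * n * rankMoment 0 n =
      coeff n (zMoment crankCubeGF 8) := by
  refine two_mul_sum_eq_of_forall_rank (φ := fun k =>
    21 * k ^ 8 + (168 * n + 14) * k ^ 6 + (420 * n - 28) * k ^ 4 + (168 * n - 7) * k ^ 2 +
        6 * n * k ^ 0) (fun k => by ring) ?_
  simp only [rankMoment_eq_sum, mul_sum, ← sum_add_distrib]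

theorem rankMoment_equation_ten (n : ℕ) :
    36 * rankMoment 10 n + (270 * n + 90) * rankMoment 8 n + (1260 * n - 42) * rankMoment 6 n +
        (1260 * n - 75) * rankMoment 4 n + (270 * n - 9) * rankMoment 2 n + 6 * n * rankMoment 0 n =
      coeff n (zMoment crankCubeGF 10) := by
  refine two_mul_sum_eq_of_forall_rank (φ := fun k =>
    36 * k ^ 10 + (270 * n + 90) * k ^ 8 + (1260 * n - 42) * k ^ 6 + (1260 * n - 75) * k ^ 4 +
        (270 * n - 9) * k ^ 2 + 6 * n * k ^ 0) (fun k => by ring) ?_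
  simp only [rankMoment_eq_sum, mul_sum, ← sum_add_distrib]

theorem rankMoment_equation_twelve (n : ℕ) :
    55 * rankMoment 12 n + (396 * n + 275) * rankMoment 10 n + (2970 * n + 132) * rankMoment 8 n +
        (5544 * n - 297) * rankMoment 6 n + (2970 * n - 154) * rankMoment 4 n + (396 * n -
        11) * rankMoment 2 n + 6 * n * rankMoment 0 n =
      coeff n (zMoment crankCubeGF 12) := by
  refine two_mul_sum_eq_of_forall_rank (φ := fun k =>
    55 * k ^ 12 + (396 * n + 275) * k ^ 10 + (2970 * n + 132) * k ^ 8 + (5544 * n - 297) * k ^ 6 +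
        (2970 * n - 154) * k ^ 4 + (396 * n - 11) * k ^ 2 + 6 * n * k ^ 0) (fun k => by ring) ?_
  simp only [rankMoment_eq_sum, mul_sum, ← sum_add_distrib]

/-- The elimination of the moments `N_4, …, N_10` of the rank. -/
theorem rankMoment_twelve_eq (n : ℕ) :
    13860 * rankMoment 12 n =
      (13860 - 831600 * n + 17962560 * n ^ 2 - 167650560 * n ^ 3 + 628689600 * n ^ 4 -
          646652160 * n ^ 5) * rankMoment 2 n
      + (-33192 * n + 1183248 * n ^ 2 - 16879104 * n ^ 3 + 90411552 * n ^ 4 -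
          107775360 * n ^ 5) * coeff n (zMoment crankCubeGF 0)
      + (10472 - 173250 * n + 2494800 * n ^ 2 - 14469840 * n ^ 3 +
          17962560 * n ^ 4) * coeff n (zMoment crankCubeGF 4)
      + (-9933 - 22176 * n + 282744 * n ^ 2 - 598752 * n ^ 3) * coeff n (zMoment crankCubeGF 6)
      + (6666 + 990 * n + 35640 * n ^ 2) * coeff n (zMoment crankCubeGF 8)
      + (-1925 - 2772 * n) * coeff n (zMoment crankCubeGF 10)
      + (252) * coeff n (zMoment crankCubeGF 12) := by
  rw [zMoment_crankCubeGF_zero, coeff_partitionSeries, ← rankMoment_zero]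
  linear_combination (10472 - 173250 * n + 2494800 * n ^ 2 - 14469840 * n ^ 3 +
      17962560 * n ^ 4) * rankMoment_equation_four n
    + (-9933 - 22176 * n + 282744 * n ^ 2 - 598752 * n ^ 3) * rankMoment_equation_six n
    + (6666 + 990 * n + 35640 * n ^ 2) * rankMoment_equation_eight n
    + (-1925 - 2772 * n) * rankMoment_equation_ten n
    + (252) * rankMoment_equation_twelve n

end RankMomentEquations

/-! ### Reduction modulo p and transfer to polynomials -/

section Reduction

theorem map_theta {R S : Type*} [CommRing R] [CommRing S] (g : R →+* S) (f : R⟦X⟧) :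
    PowerSeries.map g (theta f) = theta (PowerSeries.map g f) := by
  ext n
  rw [coeff_map, coeff_theta, coeff_theta, coeff_map, map_mul, map_natCast]

variable {p : ℕ}

/-- The reduction of an integral power series modulo `p`. -/
noncomputable def reduceMod (p : ℕ) : ℤ⟦X⟧ →+* (ZMod p)⟦X⟧ :=
  PowerSeries.map (Int.castRingHom (ZMod p))

theorem theta_reduceMod (f : ℤ⟦X⟧) : theta (reduceMod p f) = reduceMod p (theta f) :=
  (map_theta _ f).symm

theorem coeff_reduceMod (n : ℕ) (f : ℤ⟦X⟧) :
    coeff n (reduceMod p f) = ((coeff n f : ℤ) : ZMod p) := coeff_map _ _ _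

theorem natCast_self_powerSeries (p : ℕ) : (p : (ZMod p)⟦X⟧) = 0 := by
  rw [← map_natCast (C (R := ZMod p)), ZMod.natCast_self, map_zero]

namespace TriPoly

/-- The value of a polynomial at the divisor series of orders `1`, `3` and `5`. -/
noncomputable def evalDivisor (p : ℕ) (f : TriPoly) : (ZMod p)⟦X⟧ :=
  eval (reduceMod p (divisorSeries 1)) (reduceMod p (divisorSeries 3))
    (reduceMod p (divisorSeries 5)) f

/-- The derivative of `divisorSeries 1`, where `m = -1` and `a = 1 / 6`. -/
def thetaOne (m a : ℕ) : TriPoly := [(a, 1, 0, 0), (12 * m * a, 2, 0, 0), (5 * a, 0, 1, 0)]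

/-- The derivative of `divisorSeries 3`, where `m = -1` and `b = 1 / 30`. -/
def thetaThree (m b : ℕ) : TriPoly :=
  [(m * b, 1, 0, 0), (10 * b, 0, 1, 0), (240 * m * b, 1, 1, 0), (21 * b, 0, 0, 1)]

/-- The derivative of `divisorSeries 5`, where `m = -1` and `c = 1 / 42`. -/
def thetaFive (m c : ℕ) : TriPoly :=
  [(c, 1, 0, 0), (20 * c, 0, 1, 0), (2400 * c, 0, 2, 0), (21 * c, 0, 0, 1),
    (504 * m * c, 1, 0, 1)]

/-- The divisor series of orders `1`, `3`, `5` and `7`. -/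
def divisorsUpToSeven : List TriPoly :=
  [[(1, 1, 0, 0)], [(1, 0, 1, 0)], [(1, 0, 0, 1)], [(1, 0, 1, 0), (120, 0, 2, 0)]]

/-- The divisor series of odd orders up to `13`, where `m = -1`, `e = 1 / 11` and `f = 1 / 13`. -/
def divisorsUpToThirteen (m e f : ℕ) : List TriPoly :=
  [[(1, 1, 0, 0)], [(1, 0, 1, 0)], [(1, 0, 0, 1)], [(1, 0, 1, 0), (120, 0, 2, 0)],
    [(10 * m * e, 0, 1, 0), (21 * e, 0, 0, 1), (5040 * e, 0, 1, 1)],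
    [(63 * f, 0, 1, 0), (15120 * f, 0, 2, 0), (1209600 * f, 0, 3, 0), (50 * m * f, 0, 0, 1),
      (12600 * f, 0, 0, 2)],
    [(20 * m, 0, 1, 0), (2400 * m, 0, 2, 0), (21, 0, 0, 1), (10080, 0, 1, 1),
      (1209600, 0, 2, 1)]]

theorem natCast_eq_neg_one {m : ℕ} (h : m + 1 = p) : (m : (ZMod p)⟦X⟧) = -1 := by
  have h1 := natCast_self_powerSeries p
  rw [← h] at h1
  push_cast at h1
  rw [← h]
  linear_combination h1

theorem natCast_mul_eq_one {k a : ℕ} (h : k * a % p = 1) : (k : (ZMod p)⟦X⟧) * a = 1 := by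
  rw [← Nat.cast_mul, ← cast_mod_eq (natCast_self_powerSeries p), h, Nat.cast_one]

theorem theta_evalDivisor_one {m a : ℕ} (hm : m + 1 = p) (ha : 6 * a % p = 1) :
    theta (reduceMod p (divisorSeries 1)) = evalDivisor p (thetaOne m a) := by
  have h := congrArg (reduceMod p) theta_divisorSeries_one
  simp only [map_mul, map_ofNat, map_add, map_sub, ← theta_reduceMod] at h
  have h1 := natCast_mul_eq_one ha
  have h2 := natCast_eq_neg_one hm
  simp only [evalDivisor, thetaOne, eval]
  push_cast at h1 ⊢
  rw [h2]
  linear_combination (-(theta (reduceMod p (divisorSeries 1)))) * h1 + (a : (ZMod p)⟦X⟧) * h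

theorem theta_evalDivisor_three {m b : ℕ} (hm : m + 1 = p) (hb : 30 * b % p = 1) :
    theta (reduceMod p (divisorSeries 3)) = evalDivisor p (thetaThree m b) := by
  have h := congrArg (reduceMod p) theta_divisorSeries_three
  simp only [map_mul, map_ofNat, map_add, map_sub, ← theta_reduceMod] at h
  have h1 := natCast_mul_eq_one hb
  have h2 := natCast_eq_neg_one hm
  simp only [evalDivisor, thetaThree, eval]
  push_cast at h1 ⊢
  rw [h2]
  linear_combination (-(theta (reduceMod p (divisorSeries 3)))) * h1 + (b : (ZMod p)⟦X⟧) * h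

theorem theta_evalDivisor_five {m c : ℕ} (hm : m + 1 = p) (hc : 42 * c % p = 1) :
    theta (reduceMod p (divisorSeries 5)) = evalDivisor p (thetaFive m c) := by
  have h := congrArg (reduceMod p) theta_divisorSeries_five
  have h' := congrArg (reduceMod p) divisorSeries_three_sq
  simp only [map_mul, map_ofNat, map_add, map_sub, ← theta_reduceMod] at h h'
  have h1 := natCast_mul_eq_one hc
  have h2 := natCast_eq_neg_one hm
  simp only [evalDivisor, thetaFive, eval]
  push_cast at h1 ⊢
  rw [h2]
  linear_combination (-(theta (reduceMod p (divisorSeries 5)))) * h1 + (c : (ZMod p)⟦X⟧) * h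
    - 27 * (c : (ZMod p)⟦X⟧) * h'

theorem evalDivisor_seven :
    evalDivisor p [(1, 0, 1, 0), (120, 0, 2, 0)] = reduceMod p (divisorSeries 7) := by
  have h := congrArg (reduceMod p) divisorSeries_three_sq
  simp only [map_mul, map_ofNat, map_sub] at h
  simp only [evalDivisor, eval]
  push_cast
  linear_combination h

theorem evalDivisor_divisorsUpToSeven (j : ℕ) (h : j < divisorsUpToSeven.length) :
    evalDivisor p divisorsUpToSeven[j] = reduceMod p (divisorSeries (2 * j + 1)) := by
  match j, h with
  | 0, _ => simp [divisorsUpToSeven, evalDivisor, eval]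
  | 1, _ => simp [divisorsUpToSeven, evalDivisor, eval]
  | 2, _ => simp [divisorsUpToSeven, evalDivisor, eval]
  | 3, _ => exact evalDivisor_seven

theorem evalDivisor_divisorsUpToThirteen {m e f : ℕ} (hm : m + 1 = p) (he : 11 * e % p = 1)
    (hf : 13 * f % p = 1) (j : ℕ) (h : j < (divisorsUpToThirteen m e f).length) :
    evalDivisor p (divisorsUpToThirteen m e f)[j] = reduceMod p (divisorSeries (2 * j + 1)) := by
  have h1 := natCast_eq_neg_one hm
  have h2 := natCast_mul_eq_one he
  have h3 := natCast_mul_eq_one hf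
  have h7 := congrArg (reduceMod p) divisorSeries_three_sq
  have h9 := congrArg (reduceMod p) divisorSeries_three_mul_five
  have h11 := congrArg (reduceMod p) divisorSeries_three_mul_seven
  have h13 := congrArg (reduceMod p) divisorSeries_five_mul_seven
  simp only [map_mul, map_ofNat, map_add, map_sub] at h7 h9 h11 h13
  push_cast at h2 h3
  match j, h with
  | 0, _ => simp [divisorsUpToThirteen, evalDivisor, eval]
  | 1, _ => simp [divisorsUpToThirteen, evalDivisor, eval]
  | 2, _ => simp [divisorsUpToThirteen, evalDivisor, eval]
  | 3, _ => exact evalDivisor_seven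
  | 4, _ =>
    change evalDivisor p [(10 * m * e, 0, 1, 0), (21 * e, 0, 0, 1), (5040 * e, 0, 1, 1)] =
      reduceMod p (divisorSeries 9)
    simp only [evalDivisor, eval]
    push_cast
    rw [h1]
    linear_combination (e : (ZMod p)⟦X⟧) * h9 + reduceMod p (divisorSeries 9) * h2
  | 5, _ =>
    change evalDivisor p [(63 * f, 0, 1, 0), (15120 * f, 0, 2, 0), (1209600 * f, 0, 3, 0),
      (50 * m * f, 0, 0, 1), (12600 * f, 0, 0, 2)] = reduceMod p (divisorSeries 11)
    simp only [evalDivisor, eval]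
    push_cast
    rw [h1]
    linear_combination (f : (ZMod p)⟦X⟧) * h11 + reduceMod p (divisorSeries 11) * h3
      + (f : (ZMod p)⟦X⟧) * (42 + 10080 * reduceMod p (divisorSeries 3)) * h7
  | 6, _ =>
    change evalDivisor p [(20 * m, 0, 1, 0), (2400 * m, 0, 2, 0), (21, 0, 0, 1), (10080, 0, 1, 1),
      (1209600, 0, 2, 1)] = reduceMod p (divisorSeries 13)
    simp only [evalDivisor, eval]
    push_cast
    rw [h1]
    linear_combination h13 + (10080 * reduceMod p (divisorSeries 5) - 20) * h7

theorem theta_reduceMod_partitionSeries : theta (reduceMod p partitionSeries) =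
    reduceMod p (divisorSeries 1) * reduceMod p partitionSeries := by
  rw [theta_reduceMod, theta_partitionSeries, map_mul]

theorem reduceMod_zMoment_even_succ {f : (Polynomial ℤ)⟦X⟧} {κ : ℕ}
    (hf : zDerivation f = κ • (crankLog * f)) (t : ℕ) :
    reduceMod p (zMoment f (2 * (t + 1))) = ∑ j ∈ range (t + 1),
      ((2 * κ * (2 * t + 1).choose (2 * j + 1) : ℕ) : (ZMod p)⟦X⟧) *
        (reduceMod p (divisorSeries (2 * j + 1)) * reduceMod p (zMoment f (2 * (t - j)))) := by
  rw [zMoment_even_succ hf, map_sum]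
  exact sum_congr rfl fun j _ => by rw [map_mul, map_mul, map_natCast]

/-- Linear relations modulo `p` between the moments of the crank and those of the coefficients of
`crankCubeGF` hold if a polynomial vanishes. -/
theorem hornerValue_moments_eq_zero [NeZero p] {z : (ZMod p)⟦X⟧} {dx dy dz : TriPoly}
    {φs : List TriPoly}
    (hx : theta (reduceMod p (divisorSeries 1)) =
      eval (reduceMod p (divisorSeries 1)) (reduceMod p (divisorSeries 3)) z dx)
    (hy : theta (reduceMod p (divisorSeries 3)) =
      eval (reduceMod p (divisorSeries 1)) (reduceMod p (divisorSeries 3)) z dy)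
    (hz : theta z = eval (reduceMod p (divisorSeries 1)) (reduceMod p (divisorSeries 3)) z dz)
    (hφ : ∀ j (h : j < φs.length),
      eval (reduceMod p (divisorSeries 1)) (reduceMod p (divisorSeries 3)) z φs[j] =
        reduceMod p (divisorSeries (2 * j + 1)))
    {t : ℕ} (ht : t ≤ φs.length) (n : ℕ) {css : List (List ℤ)}
    (h : eval (reduceMod p (divisorSeries 1)) (reduceMod p (divisorSeries 3)) z
      (horner p dx dy dz (moments p 2 φs t ++ moments p 6 φs t) css) = 0) :
    hornerValue (n : ZMod p)
      ((List.range (t + 1)).map (fun i => (crankMoment (2 * (t - i)) n : ZMod p)) ++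
        (List.range (t + 1)).map fun i =>
          ((coeff n (zMoment crankCubeGF (2 * (t - i))) : ℤ) : ZMod p)) css = 0 := by
  have hpA := natCast_self_powerSeries p
  have h1 := coeff_eval_horner (ZMod.natCast_self p) hx hy hz theta_reduceMod_partitionSeries n
    (moments p 2 φs t ++ moments p 6 φs t) css
  rw [h, mul_zero, map_zero] at h1
  have h2 := eval_moments hpA _ _ z (reduceMod p partitionSeries) 2
    (fun j => reduceMod p (divisorSeries (2 * j + 1)))
    (fun t => reduceMod p (zMoment crankGF (2 * t))) φs hφ
    (by rw [mul_zero, zMoment_crankGF_zero])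
    (fun t => reduceMod_zMoment_even_succ zDerivation_crankGF t) t ht
  have h3 := eval_moments hpA _ _ z (reduceMod p partitionSeries) 6
    (fun j => reduceMod p (divisorSeries (2 * j + 1)))
    (fun t => reduceMod p (zMoment crankCubeGF (2 * t))) φs hφ
    (by rw [mul_zero, zMoment_crankCubeGF_zero])
    (fun t => reduceMod_zMoment_even_succ zDerivation_crankCubeGF t) t ht
  have h4 := congrArg (List.map (coeff n)) h2
  have h5 := congrArg (List.map (coeff n)) h3
  simp only [List.map_map, Function.comp_def, coeff_reduceMod, zMoment_crankGF, coeff_mk] at h4 h5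
  rw [h1, List.map_append, h4, h5]

end TriPoly

end Reduction

namespace TriPoly

theorem hornerValue_moments_eq_zero_of_isZero {p : ℕ} [NeZero p] {m a b c e f t : ℕ}
    (hm : m + 1 = p) (ha : 6 * a % p = 1) (hb : 30 * b % p = 1) (hc : 42 * c % p = 1)
    (he : 11 * e % p = 1) (hf : 13 * f % p = 1) (ht : t ≤ 7) (n : ℕ) {css : List (List ℤ)}
    (h : isZero p (horner p (thetaOne m a) (thetaThree m b) (thetaFive m c)
      (moments p 2 (divisorsUpToThirteen m e f) t ++ moments p 6 (divisorsUpToThirteen m e f) t)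
      css) = true) :
    hornerValue (n : ZMod p)
      ((List.range (t + 1)).map (fun i => (crankMoment (2 * (t - i)) n : ZMod p)) ++
        (List.range (t + 1)).map fun i =>
          ((coeff n (zMoment crankCubeGF (2 * (t - i))) : ℤ) : ZMod p)) css = 0 :=
  hornerValue_moments_eq_zero (theta_evalDivisor_one hm ha) (theta_evalDivisor_three hm hb)
    (theta_evalDivisor_five hm hc) (evalDivisor_divisorsUpToThirteen hm he hf) ht n
    (eval_eq_zero_of_isZero (natCast_self_powerSeries p) _ _ _ _ h)

/-- Since 11 is not invertible here, Φ₉ is not available as a polynomial; the series up to Φ₇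
suffice for moments of order at most 8. -/
theorem hornerValue_moments_eleven {t : ℕ} (ht : t ≤ 4) (n : ℕ) {css : List (List ℤ)}
    (h : evalDivisor 11 (horner 11 (thetaOne 10 2) (thetaThree 10 7) (thetaFive 10 5)
      (moments 11 2 divisorsUpToSeven t ++ moments 11 6 divisorsUpToSeven t) css) = 0) :
    hornerValue (n : ZMod 11)
      ((List.range (t + 1)).map (fun i => (crankMoment (2 * (t - i)) n : ZMod 11)) ++
        (List.range (t + 1)).map fun i =>
          ((coeff n (zMoment crankCubeGF (2 * (t - i))) : ℤ) : ZMod 11)) css = 0 :=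
  hornerValue_moments_eq_zero (theta_evalDivisor_one rfl rfl) (theta_evalDivisor_three rfl rfl)
    (theta_evalDivisor_five rfl rfl) evalDivisor_divisorsUpToSeven ht n h

/-- Φ₅ drops out because 7 divides its coefficient 21. So modulo 7 the polynomials in Φ₁ and Φ₃ are
closed under θ, and the third variable is set to 0. -/
theorem theta_evalDivisor_three_seven : theta (reduceMod 7 (divisorSeries 3)) =
    eval (reduceMod 7 (divisorSeries 1)) (reduceMod 7 (divisorSeries 3)) 0
      [(3, 1, 0, 0), (5, 0, 1, 0), (6, 1, 1, 0)] := by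
  have h := congrArg (reduceMod 7) theta_divisorSeries_three
  simp only [map_mul, map_ofNat, map_add, map_sub, ← theta_reduceMod] at h
  have h1 := natCast_self_powerSeries 7
  simp only [eval]
  push_cast at h1 ⊢
  linear_combination 4 * h +
      (-17 * theta (reduceMod 7 (divisorSeries 3)) - reduceMod 7 (divisorSeries 1)
    + 5 * reduceMod 7 (divisorSeries 3) + 12 * reduceMod 7 (divisorSeries 5)
    - 138 * (reduceMod 7 (divisorSeries 1) * reduceMod 7 (divisorSeries 3))) * h1

theorem hornerValue_moments_seven (n : ℕ) {css : List (List ℤ)}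
    (h : isZero 7 (horner 7 (thetaOne 6 6) [(3, 1, 0, 0), (5, 0, 1, 0), (6, 1, 1, 0)] []
      (moments 7 2 (divisorsUpToSeven.take 2) 2 ++ moments 7 6 (divisorsUpToSeven.take 2) 2)
      css) = true) :
    hornerValue (n : ZMod 7)
      ((List.range (2 + 1)).map (fun i => (crankMoment (2 * (2 - i)) n : ZMod 7)) ++
        (List.range (2 + 1)).map fun i =>
          ((coeff n (zMoment crankCubeGF (2 * (2 - i))) : ℤ) : ZMod 7)) css = 0 := by
  refine hornerValue_moments_eq_zero (z := 0) ?_ theta_evalDivisor_three_seven (map_zero theta)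
    (fun j hj => ?_) (by decide) n (eval_eq_zero_of_isZero (natCast_self_powerSeries 7) _ _ _ _ h)
  · rw [theta_evalDivisor_one (m := 6) (a := 6) rfl rfl]
    simp [evalDivisor, thetaOne, eval]
  · match j, hj with
    | 0, _ => simp [divisorsUpToSeven, eval]
    | 1, _ => simp [divisorsUpToSeven, eval]

end TriPoly

open TriPoly

/-! ### The congruences -/

section Congruences

theorem moments_congruence_seven (n : ℕ) :
    (n + 2) * crankMoment 4 n + (6 * n ^ 2 + 4 * n + 1) * crankMoment 2 n ≡ 0 [ZMOD 7] := by
  have h : hornerValue (n : ZMod 7) [(crankMoment 4 n : ZMod 7),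
      (crankMoment 2 n : ZMod 7),
      (crankMoment 0 n : ZMod 7),
      ((coeff n (zMoment crankCubeGF 4) : ℤ) : ZMod 7),
      ((coeff n (zMoment crankCubeGF 2) : ℤ) : ZMod 7),
      ((coeff n (zMoment crankCubeGF 0) : ℤ) : ZMod 7)]
      -- Row i holds the coefficients of n^i, in the order M_4, M_2, M_0. Rows may be shorter than
      -- the list of moments; absent entries count as 0, so the moments of C³/P² do not enter.
      [[2, 1, 0],
       [1, 4, 0],
       [0, 6, 0]] = 0 :=
    hornerValue_moments_seven n (by decide +kernel)
  simp only [hornerValue, List.zipWith_cons_cons, List.zipWith_nil_left, List.sum_cons,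
    List.sum_nil] at h
  refine (ZMod.intCast_eq_intCast_iff _ _ 7).1 ?_
  push_cast at h ⊢
  linear_combination h

theorem moments_congruence_eleven_two_four (n : ℕ) :
    (n + 5) ^ 3 * crankMoment 4 n ≡
      (5 * n ^ 4 + 10 * n ^ 3 + 8 * n ^ 2 + 8 * n + 9) * crankMoment 2 n [ZMOD 11] := by
  have h : hornerValue (n : ZMod 11) [(crankMoment 4 n : ZMod 11),
      (crankMoment 2 n : ZMod 11),
      (crankMoment 0 n : ZMod 11),
      ((coeff n (zMoment crankCubeGF 4) : ℤ) : ZMod 11),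
      ((coeff n (zMoment crankCubeGF 2) : ℤ) : ZMod 11),
      ((coeff n (zMoment crankCubeGF 0) : ℤ) : ZMod 11)]
      [[125, -9, 0],
       [75, -8, 0],
       [15, -8, 0],
       [1, -10, 0],
       [0, -5, 0]] = 0 :=
    hornerValue_moments_eleven (t := 2) (by norm_num) n (by
      -- Here the polynomial itself is not zero. It is -7 times 2Φ₃Φ₅ + Φ₃ - Φ₅, which vanishes as a
      -- series modulo 11 by `divisorSeries_three_mul_five` (E₄E₆ = E₁₀ ≡ 1).
      have h1 := eval_eq_zero_of_isZero (natCast_self_powerSeries 11)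
        (reduceMod 11 (divisorSeries 1)) (reduceMod 11 (divisorSeries 3))
        (reduceMod 11 (divisorSeries 5)) (add 11 (horner 11 (thetaOne 10 2) (thetaThree 10 7)
          (thetaFive 10 5) (moments 11 2 divisorsUpToSeven 2 ++ moments 11 6 divisorsUpToSeven 2)
          [[125, -9, 0],
           [75, -8, 0],
           [15, -8, 0],
           [1, -10, 0],
           [0, -5, 0]]) [(7, 0, 1, 0), (4, 0, 0, 1), (3, 0, 1, 1)]) (by decide +kernel)
      rw [eval_add (natCast_self_powerSeries 11)] at h1
      have h2 := congrArg (reduceMod 11) divisorSeries_three_mul_five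
      simp only [map_mul, map_ofNat, map_add, map_sub] at h2
      have h3 := natCast_self_powerSeries 11
      simp only [eval] at h1
      push_cast at h1 h3
      rw [evalDivisor]
      linear_combination h1 - 7 * h2 + (-7 * reduceMod 11 (divisorSeries 9)
        - 7 * reduceMod 11 (divisorSeries 3) + 13 * reduceMod 11 (divisorSeries 5)
        + 3207 * (reduceMod 11 (divisorSeries 3) * reduceMod 11 (divisorSeries 5))) * h3)
  simp only [hornerValue, List.zipWith_cons_cons, List.zipWith_nil_left, List.sum_cons,
    List.sum_nil] at h
  refine (ZMod.intCast_eq_intCast_iff _ _ 11).1 ?_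
  push_cast at h ⊢
  linear_combination h

theorem moments_congruence_eleven_six (n : ℕ) :
    crankMoment 6 n ≡
      2 * (n + 7) * crankMoment 4 n - (n + 8) ^ 2 * crankMoment 2 n [ZMOD 11] := by
  have h : hornerValue (n : ZMod 11) [(crankMoment 6 n : ZMod 11),
      (crankMoment 4 n : ZMod 11),
      (crankMoment 2 n : ZMod 11),
      (crankMoment 0 n : ZMod 11),
      ((coeff n (zMoment crankCubeGF 6) : ℤ) : ZMod 11),
      ((coeff n (zMoment crankCubeGF 4) : ℤ) : ZMod 11),
      ((coeff n (zMoment crankCubeGF 2) : ℤ) : ZMod 11),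
      ((coeff n (zMoment crankCubeGF 0) : ℤ) : ZMod 11)]
      [[1, -14, 64, 0],
       [0, -2, 16, 0],
       [0, 0, 1, 0]] = 0 :=
    hornerValue_moments_eleven (t := 3) (by norm_num) n
      (eval_eq_zero_of_isZero (natCast_self_powerSeries 11) _ _ _ _ (by decide +kernel))
  simp only [hornerValue, List.zipWith_cons_cons, List.zipWith_nil_left, List.sum_cons,
    List.sum_nil] at h
  refine (ZMod.intCast_eq_intCast_iff _ _ 11).1 ?_
  push_cast at h ⊢
  linear_combination h

theorem moments_congruence_eleven_eight (n : ℕ) :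
    crankMoment 8 n ≡
      2 * (n + 5) * (n ^ 2 + 5 * n + 10) * crankMoment 2 n
        + 6 * (n ^ 2 + n + 1) * crankMoment 4 n [ZMOD 11] := by
  have h : hornerValue (n : ZMod 11) [(crankMoment 8 n : ZMod 11),
      (crankMoment 6 n : ZMod 11),
      (crankMoment 4 n : ZMod 11),
      (crankMoment 2 n : ZMod 11),
      (crankMoment 0 n : ZMod 11),
      ((coeff n (zMoment crankCubeGF 8) : ℤ) : ZMod 11),
      ((coeff n (zMoment crankCubeGF 6) : ℤ) : ZMod 11),
      ((coeff n (zMoment crankCubeGF 4) : ℤ) : ZMod 11),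
      ((coeff n (zMoment crankCubeGF 2) : ℤ) : ZMod 11),
      ((coeff n (zMoment crankCubeGF 0) : ℤ) : ZMod 11)]
      [[1, 0, -6, -100, 0],
       [0, 0, -6, -70, 0],
       [0, 0, -6, -20, 0],
       [0, 0, 0, -2, 0]] = 0 :=
    hornerValue_moments_eleven (t := 4) (by norm_num) n
      (eval_eq_zero_of_isZero (natCast_self_powerSeries 11) _ _ _ _ (by decide +kernel))
  simp only [hornerValue, List.zipWith_cons_cons, List.zipWith_nil_left, List.sum_cons,
    List.sum_nil] at h
  refine (ZMod.intCast_eq_intCast_iff _ _ 11).1 ?_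
  push_cast at h ⊢
  linear_combination h

theorem moments_congruence_fortyOne (n : ℕ) :
    crankMoment 10 n ≡
      4 * (n + 7) * (n ^ 3 + 5 * n ^ 2 + 29 * n + 32) * crankMoment 2 n
        + 39 * (n + 7) * (n + 14) * (n + 39) * crankMoment 4 n
        + (6 * n ^ 2 + 34 * n + 39) * crankMoment 6 n
        + 35 * (n + 13) * crankMoment 8 n [ZMOD 41] := by
  have h : hornerValue (n : ZMod 41) [(crankMoment 10 n : ZMod 41),
      (crankMoment 8 n : ZMod 41),
      (crankMoment 6 n : ZMod 41),
      (crankMoment 4 n : ZMod 41),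
      (crankMoment 2 n : ZMod 41),
      (crankMoment 0 n : ZMod 41),
      ((coeff n (zMoment crankCubeGF 10) : ℤ) : ZMod 41),
      ((coeff n (zMoment crankCubeGF 8) : ℤ) : ZMod 41),
      ((coeff n (zMoment crankCubeGF 6) : ℤ) : ZMod 41),
      ((coeff n (zMoment crankCubeGF 4) : ℤ) : ZMod 41),
      ((coeff n (zMoment crankCubeGF 2) : ℤ) : ZMod 41),
      ((coeff n (zMoment crankCubeGF 0) : ℤ) : ZMod 41)]
      -- The entries are the expanded integer coefficients, not reduced modulo 41, so the final
      -- `linear_combination` is an identity over the integers.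
      [[1, -455, -39, -149058, -896, 0],
       [0, -35, -34, -35763, -940, 0],
       [0, 0, -6, -2340, -256, 0],
       [0, 0, 0, -39, -48, 0],
       [0, 0, 0, 0, -4, 0]] = 0 :=
    -- m stands for -1, and a, b, c, e, f are the inverses of 6, 30, 42, 11, 13 modulo 41.
    hornerValue_moments_eq_zero_of_isZero (t := 5) (m := 40) (a := 7) (b := 26) (c := 1)
      (e := 15) (f := 19) (by norm_num) (by norm_num) (by norm_num) (by norm_num)
      (by norm_num) (by norm_num) (by norm_num) n (by decide +kernel)
  simp only [hornerValue, List.zipWith_cons_cons, List.zipWith_nil_left, List.sum_cons,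
    List.sum_nil] at h
  refine (ZMod.intCast_eq_intCast_iff _ _ 41).1 ?_
  push_cast at h ⊢
  linear_combination h

theorem moments_congruence_fortyThree (n : ℕ) :
    (n + 7) * (n + 25) * (n + 31) * (n ^ 2 + 28 * n + 6) * rankMoment 2 n + rankMoment 12 n ≡
      (4 * n ^ 5 + 10 * n ^ 4 + 6 * n ^ 3 + 30 * n ^ 2 + 31 * n + 33) * crankMoment 2 n
        + (n ^ 4 + 4 * n ^ 3 + 42 * n ^ 2 + 24 * n + 30) * crankMoment 4 n
        + 40 * (n + 10) * (n ^ 2 + 32 * n + 7) * crankMoment 6 n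
        + 31 * (n + 13) * (n + 41) * crankMoment 8 n
        + (n + 11) * crankMoment 10 n
        + 22 * crankMoment 12 n [ZMOD 43] := by
  have h : hornerValue (n : ZMod 43) [(crankMoment 12 n : ZMod 43),
      (crankMoment 10 n : ZMod 43),
      (crankMoment 8 n : ZMod 43),
      (crankMoment 6 n : ZMod 43),
      (crankMoment 4 n : ZMod 43),
      (crankMoment 2 n : ZMod 43),
      (crankMoment 0 n : ZMod 43),
      ((coeff n (zMoment crankCubeGF 12) : ℤ) : ZMod 43),
      ((coeff n (zMoment crankCubeGF 10) : ℤ) : ZMod 43),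
      ((coeff n (zMoment crankCubeGF 8) : ℤ) : ZMod 43),
      ((coeff n (zMoment crankCubeGF 6) : ℤ) : ZMod 43),
      ((coeff n (zMoment crankCubeGF 4) : ℤ) : ZMod 43),
      ((coeff n (zMoment crankCubeGF 2) : ℤ) : ZMod 43),
      ((coeff n (zMoment crankCubeGF 0) : ℤ) : ZMod 43)]
      -- The crank coefficients are multiplied by -13860; the other columns are the coefficients in
      -- `rankMoment_twelve_eq`.
      [[-304920, -152460, -229008780, -38808000, -415800, -457380, 0, 252, -1925, 6666, -9933,
          10472, 0, 0],
       [0, -13860, -23201640, -181288800, -332640, -429660, 0, 0, -2772, 990, -22176, -173250, 0,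
           -33192],
       [0, 0, -429660, -23284800, -582120, -415800, 0, 0, 0, 35640, 282744, 2494800, 0, 1183248],
       [0, 0, 0, -554400, -55440, -83160, 0, 0, 0, 0, -598752, -14469840, 0, -16879104],
       [0, 0, 0, 0, -13860, -138600, 0, 0, 0, 0, 0, 17962560, 0, 90411552],
       [0, 0, 0, 0, 0, -55440, 0, 0, 0, 0, 0, 0, 0, -107775360]] = 0 :=
    hornerValue_moments_eq_zero_of_isZero (t := 6) (m := 42) (a := 36) (b := 33) (c := 42)
      (e := 4) (f := 10) (by norm_num) (by norm_num) (by norm_num) (by norm_num)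
      (by norm_num) (by norm_num) (by norm_num) n (by decide +kernel)
  simp only [hornerValue, List.zipWith_cons_cons, List.zipWith_nil_right, List.sum_cons,
    List.sum_nil] at h
  have h1 := congrArg (Int.cast : ℤ → ZMod 43) (rankMoment_twelve_eq n)
  have h2 : (43 : ZMod 43) = 0 := ZMod.natCast_self 43
  have h3 : (13860 : ZMod 43) ≠ 0 := by decide +kernel
  have : Fact (Nat.Prime 43) := ⟨by norm_num⟩
  refine (ZMod.intCast_eq_intCast_iff _ _ 43).1 (sub_eq_zero.1 ?_)
  refine (mul_eq_zero.1 (?_ : (13860 : ZMod 43) * _ = 0)).resolve_left h3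
  push_cast at h h1 ⊢
  -- The two polynomial coefficients of N_2 agree only modulo 43; the explicit polynomial is their
  -- difference divided by 43.
  linear_combination h + h1 + ((10492020) + (51198840) * (n : ZMod 43) ^ 1 +
      (12820500) * (n : ZMod 43) ^ 2 + (-2952180) * (n : ZMod 43) ^ 3 +
      (14650020) * (n : ZMod 43) ^ 4 +
      (-15038100) * (n : ZMod 43) ^ 5) * (rankMoment 2 n : ZMod 43) * h2

theorem moments_congruence_fiftyThree (n : ℕ) :
    crankMoment 10 n ≡
      36 * (n + 19) * (n ^ 3 + 50 * n ^ 2 + 20 * n + 36) * crankMoment 2 n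
        + (52 * n ^ 3 + 28 * n ^ 2 + 26 * n + 52) * crankMoment 4 n
        + (36 * n ^ 2 + 11 * n + 32) * crankMoment 6 n
        + 47 * (n + 17) * crankMoment 8 n [ZMOD 53] := by
  have h : hornerValue (n : ZMod 53) [(crankMoment 10 n : ZMod 53),
      (crankMoment 8 n : ZMod 53),
      (crankMoment 6 n : ZMod 53),
      (crankMoment 4 n : ZMod 53),
      (crankMoment 2 n : ZMod 53),
      (crankMoment 0 n : ZMod 53),
      ((coeff n (zMoment crankCubeGF 10) : ℤ) : ZMod 53),
      ((coeff n (zMoment crankCubeGF 8) : ℤ) : ZMod 53),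
      ((coeff n (zMoment crankCubeGF 6) : ℤ) : ZMod 53),
      ((coeff n (zMoment crankCubeGF 4) : ℤ) : ZMod 53),
      ((coeff n (zMoment crankCubeGF 2) : ℤ) : ZMod 53),
      ((coeff n (zMoment crankCubeGF 0) : ℤ) : ZMod 53)]
      [[1, -799, -32, -52, -24624, 0],
       [0, -47, -11, -26, -14976, 0],
       [0, 0, -36, -28, -34920, 0],
       [0, 0, 0, -52, -2484, 0],
       [0, 0, 0, 0, -36, 0]] = 0 :=
    hornerValue_moments_eq_zero_of_isZero (t := 5) (m := 52) (a := 9) (b := 23) (c := 24)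
      (e := 29) (f := 49) (by norm_num) (by norm_num) (by norm_num) (by norm_num)
      (by norm_num) (by norm_num) (by norm_num) n (by decide +kernel)
  simp only [hornerValue, List.zipWith_cons_cons, List.zipWith_nil_left, List.sum_cons,
    List.sum_nil] at h
  refine (ZMod.intCast_eq_intCast_iff _ _ 53).1 ?_
  push_cast at h ⊢
  linear_combination h

theorem moments_congruence_eightyThree (n : ℕ) :
    crankMoment 8 n ≡
      (10 * n ^ 3 + 73 * n ^ 2 + 40 * n + 82) * crankMoment 2 n
        + (72 * n ^ 2 + 23 * n + 28) * crankMoment 4 n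
        + 10 * (n + 41) * crankMoment 6 n [ZMOD 83] := by
  have h : hornerValue (n : ZMod 83) [(crankMoment 8 n : ZMod 83),
      (crankMoment 6 n : ZMod 83),
      (crankMoment 4 n : ZMod 83),
      (crankMoment 2 n : ZMod 83),
      (crankMoment 0 n : ZMod 83),
      ((coeff n (zMoment crankCubeGF 8) : ℤ) : ZMod 83),
      ((coeff n (zMoment crankCubeGF 6) : ℤ) : ZMod 83),
      ((coeff n (zMoment crankCubeGF 4) : ℤ) : ZMod 83),
      ((coeff n (zMoment crankCubeGF 2) : ℤ) : ZMod 83),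
      ((coeff n (zMoment crankCubeGF 0) : ℤ) : ZMod 83)]
      [[1, -410, -28, -82, 0],
       [0, -10, -23, -40, 0],
       [0, 0, -72, -73, 0],
       [0, 0, 0, -10, 0]] = 0 :=
    hornerValue_moments_eq_zero_of_isZero (t := 4) (m := 82) (a := 14) (b := 36) (c := 2)
      (e := 68) (f := 32) (by norm_num) (by norm_num) (by norm_num) (by norm_num)
      (by norm_num) (by norm_num) (by norm_num) n (by decide +kernel)
  simp only [hornerValue, List.zipWith_cons_cons, List.zipWith_nil_left, List.sum_cons,
    List.sum_nil] at h
  refine (ZMod.intCast_eq_intCast_iff _ _ 83).1 ?_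
  push_cast at h ⊢
  linear_combination h

theorem moments_congruence_sevenHundredNinetySeven (n : ℕ) :
    rankMoment 12 n
        - 367 * (n + 332) * (n + 487) * (n + 664) * (n ^ 2 + 265 * n + 155) * rankMoment 2 n ≡
      352 * (n + 247) * (n + 734) * (n ^ 3 + 147 * n ^ 2 + 597 * n + 363) * crankMoment 2 n
        + 88 * (n + 530) * (n + 701) * (n + 709) * (n + 740) * crankMoment 4 n
        + 577 * (n + 114) * (n + 427) * (n + 682) * crankMoment 6 n
        + (295 * n ^ 2 + 177 * n + 674) * crankMoment 8 n
        + 271 * (n + 336) * crankMoment 10 n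
        + 654 * crankMoment 12 n [ZMOD 797] := by
  have h : hornerValue (n : ZMod 797) [(crankMoment 12 n : ZMod 797),
      (crankMoment 10 n : ZMod 797),
      (crankMoment 8 n : ZMod 797),
      (crankMoment 6 n : ZMod 797),
      (crankMoment 4 n : ZMod 797),
      (crankMoment 2 n : ZMod 797),
      (crankMoment 0 n : ZMod 797),
      ((coeff n (zMoment crankCubeGF 12) : ℤ) : ZMod 797),
      ((coeff n (zMoment crankCubeGF 10) : ℤ) : ZMod 797),
      ((coeff n (zMoment crankCubeGF 8) : ℤ) : ZMod 797),
      ((coeff n (zMoment crankCubeGF 6) : ℤ) : ZMod 797),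
      ((coeff n (zMoment crankCubeGF 4) : ℤ) : ZMod 797),
      ((coeff n (zMoment crankCubeGF 2) : ℤ) : ZMod 797),
      ((coeff n (zMoment crankCubeGF 0) : ℤ) : ZMod 797)]
      [[-9064440, -1262036160, -9341640, -265494876459120, -237748477738464000, -321074290817280,
          0, 252, -1925, 6666, -9933, 10472, 0, 0],
       [0, -3756060, -2453220, -3339958960800, -1444349239502400, -529785127428480, 0, 0, -2772,
           990, -22176, -173250, 0, -33192],
       [0, 0, -4088700, -9780600060, -3268631409120, -132880847742720, 0, 0, 0, 35640, 282744,
           2494800, 0, 1183248],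
       [0, 0, 0, -7997220, -3268742400, -1590960349440, 0, 0, 0, 0, -598752, -14469840, 0,
           -16879104],
       [0, 0, 0, 0, -1219680, -5503196160, 0, 0, 0, 0, 0, 17962560, 0, 90411552],
       [0, 0, 0, 0, 0, -4878720, 0, 0, 0, 0, 0, 0, 0, -107775360]] = 0 :=
    hornerValue_moments_eq_zero_of_isZero (t := 6) (m := 796) (a := 133) (b := 186) (c := 19)
      (e := 145) (f := 184) (by norm_num) (by norm_num) (by norm_num) (by norm_num)
      (by norm_num) (by norm_num) (by norm_num) n (by decide +kernel)
  simp only [hornerValue, List.zipWith_cons_cons, List.zipWith_nil_right, List.sum_cons,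
    List.sum_nil] at h
  have h1 := congrArg (Int.cast : ℤ → ZMod 797) (rankMoment_twelve_eq n)
  have h2 : (797 : ZMod 797) = 0 := ZMod.natCast_self 797
  have h3 : (13860 : ZMod 797) ≠ 0 := by decide +kernel
  have : Fact (Nat.Prime 797) := ⟨by norm_num⟩
  refine (ZMod.intCast_eq_intCast_iff _ _ 797).1 (sub_eq_zero.1 ?_)
  refine (mul_eq_zero.1 (?_ : (13860 : ZMod 797) * _ = 0)).resolve_left h3
  push_cast at h h1 ⊢
  linear_combination h + h1 + ((-106203247185420) + (-182271204007200) * (n : ZMod 797) ^ 1 +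
      (-1879850968380) * (n : ZMod 797) ^ 2 + (-7012023480) * (n : ZMod 797) ^ 3 +
      (-10367280) * (n : ZMod 797) ^ 4 +
      (-817740) * (n : ZMod 797) ^ 5) * (rankMoment 2 n : ZMod 797) * h2

/-- Only the invertibility of 6, 30, 42, 11 and 13 enters; the primality of the modulus plays no
role. -/
theorem moments_congruence_large_prime (n : ℕ) :
    crankMoment 14 n ≡
      (44976165 * n ^ 6 + 23584476 * n ^ 5 + 19728425 * n ^ 4 + 8711555 * n ^ 3
          + 36781660 * n ^ 2 + 70780973 * n + 108798274) * crankMoment 2 n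
        + 77429163 * (n + 4141548) * (n + 113894720)
          * (n ^ 3 + 42853554 * n ^ 2 + 28914352 * n + 100598975) * crankMoment 4 n
        + (12571854 * n ^ 4 + 82951807 * n ^ 3 + 9501843 * n ^ 2 + 38248242 * n + 118847240)
          * crankMoment 6 n
        + 84218605 * (n + 53645347) * (n ^ 2 + 6688335 * n + 93582728) * crankMoment 8 n
        + 73449678 * (n + 40889782) * (n + 59666357) * crankMoment 10 n
        + 89188917 * (n + 120667368) * crankMoment 12 n [ZMOD 120667369] := by
  have h : hornerValue (n : ZMod 120667369) [(crankMoment 14 n : ZMod 120667369),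
      (crankMoment 12 n : ZMod 120667369),
      (crankMoment 10 n : ZMod 120667369),
      (crankMoment 8 n : ZMod 120667369),
      (crankMoment 6 n : ZMod 120667369),
      (crankMoment 4 n : ZMod 120667369),
      (crankMoment 2 n : ZMod 120667369),
      (crankMoment 0 n : ZMod 120667369),
      ((coeff n (zMoment crankCubeGF 14) : ℤ) : ZMod 120667369),
      ((coeff n (zMoment crankCubeGF 12) : ℤ) : ZMod 120667369),
      ((coeff n (zMoment crankCubeGF 10) : ℤ) : ZMod 120667369),
      ((coeff n (zMoment crankCubeGF 8) : ℤ) : ZMod 120667369),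
      ((coeff n (zMoment crankCubeGF 6) : ℤ) : ZMod 120667369),
      ((coeff n (zMoment crankCubeGF 4) : ℤ) : ZMod 120667369),
      ((coeff n (zMoment crankCubeGF 2) : ℤ) : ZMod 120667369),
      ((coeff n (zMoment crankCubeGF 0) : ℤ) : ZMod 120667369)]
      [[1, -10762191869160456, -179198435474919170835972, -422800802862390510090680, -118847240,
          -3674213687834187804622699488000, -108798274, 0],
       [0, -89188917, -7385816030473242, -30217479291436939647665, -38248242,
           -1056050525225425881144277730460, -70780973, 0],
       [0, 0, -73449678, -5081218532553610, -9501843, -1565156516391483963009833961813, -36781660,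
           0],
       [0, 0, 0, -84218605, -82951807, -428181263143665546029592, -8711555, 0],
       [0, 0, 0, 0, -12571854, -12457564252678986, -19728425, 0],
       [0, 0, 0, 0, 0, -77429163, -23584476, 0],
       [0, 0, 0, 0, 0, 0, -44976165, 0]] = 0 :=
    hornerValue_moments_eq_zero_of_isZero (t := 7) (m := 120667368) (a := 100556141) (b :=
        44244702) (c := 14365163)
      (e := 65818565) (f := 27846316) (by norm_num) (by norm_num) (by norm_num) (by norm_num)
      (by norm_num) (by norm_num) (by norm_num) n (by decide +kernel)
  simp only [hornerValue, List.zipWith_cons_cons, List.zipWith_nil_left, List.sum_cons,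
    List.sum_nil] at h
  refine (ZMod.intCast_eq_intCast_iff _ _ 120667369).1 ?_
  push_cast at h ⊢
  linear_combination h

end Congruences

theorem theorem6p1 (n : ℕ) :
    ((n + 2) * crankMoment 4 n + (6 * n ^ 2 + 4 * n + 1) * crankMoment 2 n ≡ 0 [ZMOD 7]) ∧
    ((n + 5) ^ 3 * crankMoment 4 n ≡
      (5 * n ^ 4 + 10 * n ^ 3 + 8 * n ^ 2 + 8 * n + 9) * crankMoment 2 n [ZMOD 11]) ∧
    (crankMoment 6 n ≡
      2 * (n + 7) * crankMoment 4 n - (n + 8) ^ 2 * crankMoment 2 n [ZMOD 11]) ∧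
    (crankMoment 8 n ≡
      2 * (n + 5) * (n ^ 2 + 5 * n + 10) * crankMoment 2 n
        + 6 * (n ^ 2 + n + 1) * crankMoment 4 n [ZMOD 11]) ∧
    (crankMoment 10 n ≡
      4 * (n + 7) * (n ^ 3 + 5 * n ^ 2 + 29 * n + 32) * crankMoment 2 n
        + 39 * (n + 7) * (n + 14) * (n + 39) * crankMoment 4 n
        + (6 * n ^ 2 + 34 * n + 39) * crankMoment 6 n
        + 35 * (n + 13) * crankMoment 8 n [ZMOD 41]) ∧
    ((n + 7) * (n + 25) * (n + 31) * (n ^ 2 + 28 * n + 6) * rankMoment 2 n + rankMoment 12 n ≡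
      (4 * n ^ 5 + 10 * n ^ 4 + 6 * n ^ 3 + 30 * n ^ 2 + 31 * n + 33) * crankMoment 2 n
        + (n ^ 4 + 4 * n ^ 3 + 42 * n ^ 2 + 24 * n + 30) * crankMoment 4 n
        + 40 * (n + 10) * (n ^ 2 + 32 * n + 7) * crankMoment 6 n
        + 31 * (n + 13) * (n + 41) * crankMoment 8 n
        + (n + 11) * crankMoment 10 n
        + 22 * crankMoment 12 n [ZMOD 43]) ∧
    (crankMoment 10 n ≡
      36 * (n + 19) * (n ^ 3 + 50 * n ^ 2 + 20 * n + 36) * crankMoment 2 n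
        + (52 * n ^ 3 + 28 * n ^ 2 + 26 * n + 52) * crankMoment 4 n
        + (36 * n ^ 2 + 11 * n + 32) * crankMoment 6 n
        + 47 * (n + 17) * crankMoment 8 n [ZMOD 53]) ∧
    (crankMoment 8 n ≡
      (10 * n ^ 3 + 73 * n ^ 2 + 40 * n + 82) * crankMoment 2 n
        + (72 * n ^ 2 + 23 * n + 28) * crankMoment 4 n
        + 10 * (n + 41) * crankMoment 6 n [ZMOD 83]) ∧
    (rankMoment 12 n
        - 367 * (n + 332) * (n + 487) * (n + 664) * (n ^ 2 + 265 * n + 155) * rankMoment 2 n ≡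
      352 * (n + 247) * (n + 734) * (n ^ 3 + 147 * n ^ 2 + 597 * n + 363) * crankMoment 2 n
        + 88 * (n + 530) * (n + 701) * (n + 709) * (n + 740) * crankMoment 4 n
        + 577 * (n + 114) * (n + 427) * (n + 682) * crankMoment 6 n
        + (295 * n ^ 2 + 177 * n + 674) * crankMoment 8 n
        + 271 * (n + 336) * crankMoment 10 n
        + 654 * crankMoment 12 n [ZMOD 797]) ∧
    (crankMoment 14 n ≡
      (44976165 * n ^ 6 + 23584476 * n ^ 5 + 19728425 * n ^ 4 + 8711555 * n ^ 3
          + 36781660 * n ^ 2 + 70780973 * n + 108798274) * crankMoment 2 n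
        + 77429163 * (n + 4141548) * (n + 113894720)
          * (n ^ 3 + 42853554 * n ^ 2 + 28914352 * n + 100598975) * crankMoment 4 n
        + (12571854 * n ^ 4 + 82951807 * n ^ 3 + 9501843 * n ^ 2 + 38248242 * n + 118847240)
          * crankMoment 6 n
        + 84218605 * (n + 53645347) * (n ^ 2 + 6688335 * n + 93582728) * crankMoment 8 n
        + 73449678 * (n + 40889782) * (n + 59666357) * crankMoment 10 n
        + 89188917 * (n + 120667368) * crankMoment 12 n [ZMOD 120667369]) :=
  ⟨moments_congruence_seven n,
    moments_congruence_eleven_two_four n,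
    moments_congruence_eleven_six n,
    moments_congruence_eleven_eight n,
    moments_congruence_fortyOne n,
    moments_congruence_fortyThree n,
    moments_congruence_fiftyThree n,
    moments_congruence_eightyThree n,
    moments_congruence_sevenHundredNinetySeven n,
    moments_congruence_large_prime n⟩
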